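/- **Setting.** Let $N\ge 2$, $r\in(0,1]$, and let $\mu$ be a probability measure on $[0,1]$ with a density and CDF $F$ such that $F(0)=0<F(v)$ for $v\in(0,1]$ and $F(v)<1$ for $v<r$. An auctioneer runs a procurement auction with reserve price $r$ (the lowest bid not exceeding $r$ wins, ties being broken uniformly; in the first-price auction (FPA) the winner is paid his bid, in the second-price auction (SPA) the minimum of $r$ and the lowest competing bid). Each of $N$ sellers owns one item, which he values at $v_i$; the $v_i$ are private and i.i.d. with law $\mu$. Before the auction, a speculator (with value $0$ for items and no item) makes a take-it-or-leave-it offer $p\in[0,r]$ to all sellers, and each seller accepts (possibly randomly) or rejects. A seller who accepts gets $p-v_i$. The sellers who rejected enter the auction, and so does the speculator, with a bid for one item, if at least one seller accepted; the number $m$ of sellers in the auction and the presence of the speculator are public. A seller of value $v_i$ who wins at price $q$ gets $q-v_i$; the speculator's profit is his auction revenue minus $p$ times the number of items bought. *Equilibria.* A perfect Bayesian equilibrium (PBE) consists of equilibrium behaviour after every offer $p\in[0,r]$ and an offer that maximizes the speculator's expected profit over $[0,r]$. In the SPA game, sellers are assumed to bid their values and the speculator to bid $0$ for one item and withhold the rest;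 each seller's acceptance decision is optimal for each of his types. In the FPA game the equilibrium is symmetric across sellers, with sellers' bids a function of value and $m$ and the speculator's bid possibly mixed; bidders never bid below their values; sellers' beliefs and the speculator's about a rejecting seller's value follow from Bayes' rule whenever rejection has positive probability; each type's acceptance decision, the bids of each type that rejects with positive probability, and the speculator's bids are optimal. *Profit function.* For $0\le v\le r$, put $G(b;v)=\frac{F(b)-F(v)}{1-F(v)}$ (with $G(r;r)=0$), $\underline b(m,v)=\max_{v\le b\le r} b[1-G(b;v)]^m$, $$p^\star(v)=v+\int_v^r[1-F(x)]^{N-1}dx+\sum_{m=0}^{N-2}\binom{N-1}{m}[1-F(v)]^m[F(v)]^{N-1-m}[\underline b(m+1,v)-v],$$ $$\Pi^\star(v)=\sum_{m=1}^{N-1}\binom Nm[1-F(v)]^m[F(v)]^{N-m}\,\underline b(m,v)+[F(v)]^N r-N F(v)\,p^\star(v).$$ **Statement.** Suppose that $\Pi^\star(v)<0$ for all $v\in(0,r]$. Compare any such PBE of the FPA game with any such PBE of the SPA game. Then: 1. whatever the auctioneer's value $w\in\mathbb R$ for the item, his expected surplus (the expectation of $w$ minus the price paid, on the event of trade) is strictly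 higher in the FPA game; 2. the expected total surplus (the sum of the expected payoffs of the auctioneer, the speculator and all sellers) is strictly higher in the FPA game; 3. each seller's ex ante expected payoff is strictly lower in the FPA game. -/

import Mathlib

open MeasureTheory ProbabilityTheory

noncomputable section

/-- Sellers' private values: a probability law on `[0,1]` that has a density, with CDF `F`
satisfying `F 0 = 0 < F v` for `v ∈ (0,1]` (`F 0 = 0` follows from the density). -/
structure IsValueDistribution (μ : Measure ℝ) : Prop where
  isProbabilityMeasure : IsProbabilityMeasure μ
  support : μ (Set.Icc 0 1) = 1
  hasDensity : μ ≪ volume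
  cdf_pos : ∀ v ∈ Set.Ioc (0 : ℝ) 1, 0 < cdf μ v

/-! ### Procurement auctions with reserve price -/

/-- First-price and second-price sealed-bid procurement auctions. -/
inductive AuctionFormat
  | first
  | second

open Classical in
/-- Probability that bidder `i` wins when the set of bidders is `B` and the bids are `b`:
the lowest bid not exceeding the reserve price `r` wins, ties are broken uniformly. -/
def winShare {κ : Type} (r : ℝ) (B : Finset κ) (b : κ → ℝ) (i : κ) : ℝ :=
  if i ∈ B ∧ b i ≤ r ∧ ∀ j ∈ B, b i ≤ b j then
    1 / ((B.filter (fun j => b j = b i)).card : ℝ)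
  else 0

open Classical in
/-- Price paid to bidder `i` if he wins: his own bid in the first-price auction; the lowest
competing bid, capped at the reserve price, in the second-price auction. -/
def winPrice {κ : Type} (fmt : AuctionFormat) (r : ℝ) (B : Finset κ) (b : κ → ℝ) (i : κ) : ℝ :=
  match fmt with
  | .first => b i
  | .second => (B.erase i).fold min r b

/-- Bidders in the auction if `R` is the set of sellers who rejected the offer. `some i` is
seller `i`, `none` is the speculator, who takes part iff he bought at least one item. -/
def bidders {N : ℕ} (R : Finset (Fin N)) : Finset (Option (Fin N)) :=
  if R = Finset.univ then Finset.univ.map Function.Embedding.some else Finset.insertNone R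

/-! ### Strategies after a given acquisition offer -/

/-- Behaviour after an acquisition offer. `accept i v` is the probability that seller `i` with
value `v` accepts. The public history of the auction is determined by the number `m` of sellers
in it (the speculator is in iff `m < N`); `bid m v` is the bid of a seller with value `v`,
and `specBid m` is the (mixed) bid of the speculator for the one item that he does not withhold. -/
structure Profile (N : ℕ) where
  accept : Fin N → ℝ → ℝ
  accept_mem : ∀ i v, accept i v ∈ Set.Icc (0 : ℝ) 1
  accept_measurable : ∀ i, Measurable (accept i)
  bid : ℕ → ℝ → ℝ
  bid_measurable : ∀ m, Measurable (bid m)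
  specBid : ℕ → ProbabilityMeasure ℝ

/-- All bids, if sellers bid `β (v i)` and the speculator bids `s`. -/
def allBids {N : ℕ} (β : ℝ → ℝ) (s : ℝ) (v : Fin N → ℝ) : Option (Fin N) → ℝ
  | none => s
  | some i => β (v i)

open Classical in
/-- All bids, except that seller `i` bids `x` instead. -/
def deviationBids {N : ℕ} (β : ℝ → ℝ) (s : ℝ) (v : Fin N → ℝ) (i : Fin N) (x : ℝ) :
    Option (Fin N) → ℝ :=
  Function.update (allBids β s v) (some i) x

namespace Profile

variable {N : ℕ}

/-- Expectation of `X R v s` when the values `v` are i.i.d. with law `μ`, `R` is the random set of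
sellers who reject, and `s` is the speculator's bid. -/
def expect (σ : Profile N) (μ : Measure ℝ)
    (X : Finset (Fin N) → (Fin N → ℝ) → ℝ → ℝ) : ℝ :=
  ∫ v, ∑ R : Finset (Fin N),
    (∏ i, if i ∈ R then 1 - σ.accept i (v i) else σ.accept i (v i)) *
      ∫ s, X R v s ∂(σ.specBid R.card : Measure ℝ)
    ∂(Measure.pi fun _ => μ)

def share (σ : Profile N) (r : ℝ) (R : Finset (Fin N)) (v : Fin N → ℝ) (s : ℝ)
    (o : Option (Fin N)) : ℝ :=
  winShare r (bidders R) (allBids (σ.bid R.card) s v) o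

def price (σ : Profile N) (fmt : AuctionFormat) (r : ℝ) (R : Finset (Fin N)) (v : Fin N → ℝ)
    (s : ℝ) (o : Option (Fin N)) : ℝ :=
  winPrice fmt r (bidders R) (allBids (σ.bid R.card) s v) o

/-- Ex ante expected payoff of seller `i`, at the acquisition price `p`. -/
def sellerPayoff (σ : Profile N) (μ : Measure ℝ) (fmt : AuctionFormat) (r p : ℝ) (i : Fin N) : ℝ :=
  σ.expect μ fun R v s =>
    if i ∈ R then σ.share r R v s (some i) * (σ.price fmt r R v s (some i) - v i) else p - v i

/-- Expected profit of the speculator: auction revenue minus acquisition costs. -/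
def speculatorPayoff (σ : Profile N) (μ : Measure ℝ) (fmt : AuctionFormat) (r p : ℝ) : ℝ :=
  σ.expect μ fun R v s =>
    σ.share r R v s none * σ.price fmt r R v s none - p * (Rᶜ.card : ℝ)

/-- Expected surplus of an auctioneer whose value for the item is `w`. -/
def auctioneerPayoff (σ : Profile N) (μ : Measure ℝ) (fmt : AuctionFormat) (r w : ℝ) : ℝ :=
  σ.expect μ fun R v s =>
    ∑ o ∈ bidders R, σ.share r R v s o * (w - σ.price fmt r R v s o)

/-- Expected total surplus: the sum of the expected payoffs of the auctioneer, the speculator and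
all sellers. -/
def totalSurplus (σ : Profile N) (μ : Measure ℝ) (fmt : AuctionFormat) (r p w : ℝ) : ℝ :=
  σ.auctioneerPayoff μ fmt r w + σ.speculatorPayoff μ fmt r p +
    ∑ i, σ.sellerPayoff μ fmt r p i

/-- Expected payoff of seller `i` with value `x` if he rejects the offer and then bids `c m` in the
auction with `m` sellers, while everybody else follows `σ` (the coordinate `v i` is a dummy). -/
def rejectPayoff (σ : Profile N) (μ : Measure ℝ) (fmt : AuctionFormat) (r : ℝ) (i : Fin N)
    (x : ℝ) (c : ℕ → ℝ) : ℝ :=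
  ∫ v, ∑ R ∈ (Finset.univ : Finset (Finset (Fin N))).filter (fun R => i ∈ R),
    (∏ j ∈ Finset.univ.erase i, if j ∈ R then 1 - σ.accept j (v j) else σ.accept j (v j)) *
      ∫ s, winShare r (bidders R) (deviationBids (σ.bid R.card) s v i (c R.card)) (some i) *
        (winPrice fmt r (bidders R) (deviationBids (σ.bid R.card) s v i (c R.card)) (some i) - x)
        ∂(σ.specBid R.card : Measure ℝ)
    ∂(Measure.pi fun _ => μ)

/-- Every type of every seller decides optimally on the offer `p`: a type that accepts with positive
probability cannot gain by rejecting and then bidding in whatever way, and a type that rejects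
with positive probability gets at least `p - x` by rejecting and following his bidding strategy. -/
structure AcceptanceRational (σ : Profile N) (μ : Measure ℝ) (fmt : AuctionFormat) (r p : ℝ) :
    Prop where
  accept : ∀ i, ∀ x ∈ Set.Icc (0 : ℝ) 1, 0 < σ.accept i x →
    ∀ c : ℕ → ℝ, σ.rejectPayoff μ fmt r i x c ≤ p - x
  reject : ∀ i, ∀ x ∈ Set.Icc (0 : ℝ) 1, σ.accept i x < 1 →
    p - x ≤ σ.rejectPayoff μ fmt r i x (fun m => σ.bid m x)

/-! ### Equilibrium after a given offer: second-price auction -/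

/-- PBE of the second-price speculation game after the offer `p`, under the dominant-strategy
assumption: in the auction, sellers bid truthfully and the speculator bids `0` for one item and
withholds the others. (This bidding is optimal whatever the beliefs, so only the acceptance
decisions remain to be rational.) The sellers' acceptance strategies may differ. -/
structure IsSPAContinuation (σ : Profile N) (μ : Measure ℝ) (r p : ℝ) : Prop where
  truthful : ∀ m v, σ.bid m v = v
  withholding : ∀ m, (σ.specBid m : Measure ℝ) = Measure.dirac 0
  acceptanceRational : σ.AcceptanceRational μ .second r p

/-! ### Equilibrium after a given offer: first-price auction -/

/-- Interim expected payoff, in the first-price auction in which the set of sellers is `R`, of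
seller `i` with value `x` who bids `b`, if the other sellers' values are believed to be i.i.d. with
law `ν` (the coordinate `v i` is a dummy). -/
def sellerSubgamePayoff (σ : Profile N) (ν : Measure ℝ) (r : ℝ) (R : Finset (Fin N))
    (i : Fin N) (x b : ℝ) : ℝ :=
  ∫ v, ∫ s, winShare r (bidders R) (deviationBids (σ.bid R.card) s v i b) (some i) * (b - x)
    ∂(σ.specBid R.card : Measure ℝ) ∂(Measure.pi fun _ => ν)

/-- Expected revenue of the speculator in that auction if he bids `s`. -/
def specSubgamePayoff (σ : Profile N) (ν : Measure ℝ) (r : ℝ) (R : Finset (Fin N)) (s : ℝ) : ℝ :=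
  ∫ v, winShare r (bidders R) (allBids (σ.bid R.card) s v) none * s ∂(Measure.pi fun _ => ν)

/-- Symmetric PBE, with bidders never bidding below their values, of the first-price speculation
game after the offer `p`. `ν m` is the belief about the value of a seller who rejected, in the
auction with `m` sellers; it is given by Bayes' rule whenever rejection has positive probability.
In each auction, bids are optimal for the speculator and for each type of seller that enters the
auction with positive probability; a type that accepts the offer for sure has no profitable
deviation by `acceptanceRational`. -/
structure IsFPAContinuation (σ : Profile N) (μ : Measure ℝ) (r p : ℝ) : Prop where
  symmetric : ∀ i j, σ.accept i = σ.accept j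
  undominated : ∀ m, ∀ x ∈ Set.Icc (0 : ℝ) 1, x ≤ σ.bid m x
  undominated_spec : ∀ m, (σ.specBid m : Measure ℝ) (Set.Iio 0) = 0
  acceptanceRational : σ.AcceptanceRational μ .first r p
  biddingRational : ∃ ν : ℕ → ProbabilityMeasure ℝ,
    (∀ m, (ν m : Measure ℝ) (Set.Icc 0 1) = 1) ∧
    (∀ m i, (∫⁻ x, ENNReal.ofReal (1 - σ.accept i x) ∂μ) • (ν m : Measure ℝ) =
      μ.withDensity fun x => ENNReal.ofReal (1 - σ.accept i x)) ∧
    (∀ R : Finset (Fin N), ∀ i ∈ R, ∀ x ∈ Set.Icc (0 : ℝ) 1, σ.accept i x < 1 → ∀ b : ℝ,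
      σ.sellerSubgamePayoff (ν R.card) r R i x b ≤
        σ.sellerSubgamePayoff (ν R.card) r R i x (σ.bid R.card x)) ∧
    (∀ R : Finset (Fin N), R ≠ Finset.univ → ∀ᵐ s ∂(σ.specBid R.card : Measure ℝ), ∀ s' : ℝ,
      σ.specSubgamePayoff (ν R.card) r R s' ≤ σ.specSubgamePayoff (ν R.card) r R s)

end Profile

/-! ### The two-stage speculation game -/

/-- The speculator's offer, and the behaviour after each possible offer. -/
structure SpeculationStrategy (N : ℕ) where
  offer : ℝ
  after : ℝ → Profile N

/-- PBE of the second-price speculation game: an equilibrium follows each offer `p ∈ [0,r]`, and the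
speculator's offer maximizes his expected profit. -/
structure IsSPAEquilibrium {N : ℕ} (μ : Measure ℝ) (r : ℝ) (E : SpeculationStrategy N) : Prop where
  offer_mem : E.offer ∈ Set.Icc 0 r
  continuation : ∀ p ∈ Set.Icc 0 r, (E.after p).IsSPAContinuation μ r p
  optimal : ∀ p ∈ Set.Icc 0 r, (E.after p).speculatorPayoff μ .second r p ≤
    (E.after E.offer).speculatorPayoff μ .second r E.offer

/-- Symmetric PBE (in undominated bids) of the first-price speculation game. -/
structure IsFPAEquilibrium {N : ℕ} (μ : Measure ℝ) (r : ℝ) (E : SpeculationStrategy N) : Prop where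
  offer_mem : E.offer ∈ Set.Icc 0 r
  continuation : ∀ p ∈ Set.Icc 0 r, (E.after p).IsFPAContinuation μ r p
  optimal : ∀ p ∈ Set.Icc 0 r, (E.after p).speculatorPayoff μ .first r p ≤
    (E.after E.offer).speculatorPayoff μ .first r E.offer

/-! ### The profit function `Π⋆` of the first-price game -/

/-- `G(b; v) = (F b - F v) / (1 - F v)`. -/
def truncatedCDF (μ : Measure ℝ) (v b : ℝ) : ℝ := (cdf μ b - cdf μ v) / (1 - cdf μ v)

/-- `max_{v ≤ b ≤ r} b [1 - G(b; v)]^m`. -/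
def lowestBid (μ : Measure ℝ) (r : ℝ) (m : ℕ) (v : ℝ) : ℝ :=
  sSup ((fun b => b * (1 - truncatedCDF μ v b) ^ m) '' Set.Icc v r)

/-- The acquisition price `p⋆(v)` that induces the cutoff `v` in the first-price game. -/
def fpaPrice (N : ℕ) (μ : Measure ℝ) (r v : ℝ) : ℝ :=
  v + (∫ x in v..r, (1 - cdf μ x) ^ (N - 1)) +
    ∑ m ∈ Finset.range (N - 1), ((N - 1).choose m : ℝ) * (1 - cdf μ v) ^ m *
      cdf μ v ^ (N - 1 - m) * (lowestBid μ r (m + 1) v - v)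

/-- The speculator's expected profit `Π⋆(v)` at the cutoff `v` in the first-price game. -/
def fpaProfit (N : ℕ) (μ : Measure ℝ) (r v : ℝ) : ℝ :=
  (∑ m ∈ Finset.Ico 1 N, (N.choose m : ℝ) * (1 - cdf μ v) ^ m * cdf μ v ^ (N - m) *
      lowestBid μ r m v) +
    cdf μ v ^ N * r - N * cdf μ v * fpaPrice N μ r v

end

/-! The comparison rests on two facts: under `hprofit` nobody sells to the speculator in the
first-price game, whereas in the second-price game he always buys with positive probability and
makes a profit.

First-price game. For fixed bids the payoff from rejecting falls in the own value at a rate of at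
most 1, so acceptance has a cutoff `c ≤ p`: types above `c` reject and almost all types below accept
(`IsFPAContinuation.exists_cutoff`). Let `c > 0`. In an auction of the speculator against `m`
sellers with values above `c`, his revenue is at most `lowestBid μ r m c`, and every lower seller
bid wins for sure (`speculator_revenue_le_and_low_bid_wins`). If all sellers reject, the envelope
formula gives the payoff of types near `c` (`payoff_eq_integral_of_optimal`). Types just below `c`
could reject and collect these payoffs, which forces `p` to be at least `fpaPrice`; hence the profit
is at most `fpaProfit`, which is negative (`IsFPAContinuation.speculatorPayoff_neg`). The offer 0
secures profit 0, so in equilibrium `c = 0` and the outcome is that of the auction without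
speculation: the lowest value below `r` wins, and type `x ≤ r` earns `∫ y in x..r, (1 - F y) ^ (N -
1)`.

Second-price game. The bid 0 wins whenever the speculator owns an item, so rejecting pays only if
all the others reject too, and a positive cutoff `c` goes with the price `p = c + ∫ y in c..r, (1 -
F y) ^ (N - 1)` (`IsSPAContinuation.exists_cutoff`). Let `M` be the minimum of `r` and the values of
the other sellers. Since `p - c` is the expectation of `(M - c)⁺`, a purchase from a single seller
resells at an expected loss of only `c * P(M ≤ c)`. These losses total at most `N (N - 1) c F(c)²`.
Two simultaneous acceptances, with the remaining values above a fixed `t`, bring at least `t` with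
probability of order `F(c)²`, which dominates for small `c`
(`IsSPAContinuation.speculatorPayoff_pos`).

Comparison. Types below the second-price cutoff get `p - x`, which beats the standard payoff because
`x + ∫ y in x..r, (1 - F y) ^ (N - 1)` is strictly increasing. Almost surely trade occurs for the
same values in both games, but the speculator wastes every item bought beyond one; so total surplus
is strictly lower in the second-price game, by an amount that does not involve `w`. The auctioneer
receives total surplus minus the payoffs of speculator and sellers, and these payoffs are higher in
the second-price game. -/

noncomputable section

/-! ### Product measures -/

/-- Overwriting one coordinate of an i.i.d. vector by an independent draw leaves its law unchanged.
This allows conditioning on the value of seller `i` while keeping vectors indexed by all sellers, in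
agreement with the dummy coordinate in the interim payoffs. -/
theorem measurePreserving_update {ι : Type*} [Fintype ι] [DecidableEq ι] (μ : Measure ℝ)
    [IsProbabilityMeasure μ] (i : ι) :
    MeasurePreserving (fun q : ℝ × (ι → ℝ) => Function.update q.2 i q.1)
      (μ.prod (Measure.pi fun _ => μ)) (Measure.pi fun _ => μ) := by
  have hmeas : Measurable (fun q : ℝ × (ι → ℝ) => Function.update q.2 i q.1) := by
    rw [measurable_pi_iff]
    intro j
    by_cases hj : j = i
    · subst hj; simpa using measurable_fst
    · simp only [Function.update_of_ne hj]; fun_prop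
  refine ⟨hmeas, (Measure.pi_eq fun s hs => ?_).symm⟩
  rw [Measure.map_apply hmeas (MeasurableSet.univ_pi hs)]
  have : (fun q : ℝ × (ι → ℝ) => Function.update q.2 i q.1) ⁻¹' Set.univ.pi s =
      s i ×ˢ Set.univ.pi (fun j => if j = i then Set.univ else s j) := by
    ext ⟨x, v⟩
    simp only [Set.mem_preimage, Set.mem_pi, Set.mem_univ, true_imp_iff, Set.mem_prod]
    constructor
    · intro h
      refine ⟨by simpa using h i, fun j => ?_⟩
      by_cases hj : j = i
      · simp [hj]
      · simpa [hj] using h j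
    · rintro ⟨h1, h2⟩ j
      by_cases hj : j = i
      · subst hj; simpa using h1
      · simpa [hj] using h2 j
  rw [this, Measure.prod_prod, Measure.pi_pi, ← Finset.mul_prod_erase Finset.univ _ (Finset.mem_univ i),
    ← Finset.mul_prod_erase Finset.univ (fun j => μ (s j)) (Finset.mem_univ i)]
  congr 1
  simp only [if_true, measure_univ, one_mul]
  exact Finset.prod_congr rfl fun j hj => by rw [if_neg (Finset.ne_of_mem_erase hj)]

theorem integral_pi_update {ι : Type*} [Fintype ι] [DecidableEq ι] (μ : Measure ℝ)
    [IsProbabilityMeasure μ] (i : ι) {f : (ι → ℝ) → ℝ} (hf : Integrable f (Measure.pi fun _ => μ)) :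
    ∫ v, f v ∂(Measure.pi fun _ => μ) =
      ∫ x, ∫ v, f (Function.update v i x) ∂(Measure.pi fun _ => μ) ∂μ := by
  have h := measurePreserving_update μ i
  have h1 := integral_map h.measurable.aemeasurable (by rw [h.map_eq]; exact hf.1)
  rw [h.map_eq] at h1
  rw [h1]
  exact integral_prod _ (h.integrable_comp_of_integrable hf)

/-- Both measures agree on boxes, where the product density factorises. Weights in `[0,1]` keep the
factors finite, so that agreement on boxes suffices. -/
theorem pi_withDensity {ι : Type*} [Fintype ι] (μ : Measure ℝ) [IsProbabilityMeasure μ]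
    (w : ι → ℝ → ℝ) (hw : ∀ j, Measurable (w j)) (hw01 : ∀ j x, w j x ∈ Set.Icc (0 : ℝ) 1) :
    (Measure.pi fun _ => μ).withDensity (fun v => ENNReal.ofReal (∏ j, w j (v j))) =
      Measure.pi fun j => μ.withDensity fun x => ENNReal.ofReal (w j x) := by
  have hfin : ∀ j, IsFiniteMeasure (μ.withDensity fun x => ENNReal.ofReal (w j x)) := fun j =>
    isFiniteMeasure_withDensity_ofReal
      (Integrable.of_bound (hw j).aestronglyMeasurable 1
        (ae_of_all _ fun x => by
          rw [Real.norm_eq_abs, abs_of_nonneg (hw01 j x).1]; exact (hw01 j x).2)).2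
  refine (Measure.pi_eq fun s hs => ?_).symm
  have hbox : ∀ (v : ι → ℝ), (Set.univ.pi s).indicator
      (fun v => ENNReal.ofReal (∏ j, w j (v j))) v =
      ENNReal.ofReal (∏ j, (s j).indicator (w j) (v j)) := by
    intro v
    by_cases hv : v ∈ Set.univ.pi s
    · rw [Set.indicator_of_mem hv]
      congr 1
      refine Finset.prod_congr rfl fun j _ => ?_
      rw [Set.indicator_of_mem (hv j (Set.mem_univ j))]
    · rw [Set.indicator_of_notMem hv]
      simp only [Set.mem_pi, Set.mem_univ, true_imp_iff, not_forall] at hv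
      obtain ⟨j, hj⟩ := hv
      rw [Finset.prod_eq_zero (Finset.mem_univ j) (Set.indicator_of_notMem hj _)]
      simp
  have hint : ∀ j, Integrable ((s j).indicator (w j)) μ := fun j =>
    Integrable.of_bound ((hw j).indicator (hs j)).aestronglyMeasurable 1
      (ae_of_all _ fun x => by
        by_cases hx : x ∈ s j
        · rw [Set.indicator_of_mem hx, Real.norm_eq_abs, abs_of_nonneg (hw01 j x).1]
          exact (hw01 j x).2
        · rw [Set.indicator_of_notMem hx]; simp)
  have hnn : ∀ j x, 0 ≤ (s j).indicator (w j) x := fun j x =>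
    Set.indicator_nonneg (fun x _ => (hw01 j x).1) x
  rw [withDensity_apply _ (MeasurableSet.univ_pi hs),
    ← lintegral_indicator (MeasurableSet.univ_pi hs)]
  simp_rw [hbox]
  rw [← ofReal_integral_eq_lintegral_ofReal (Integrable.fintype_prod hint)
    (ae_of_all _ fun v => Finset.prod_nonneg fun j _ => hnn j _),
    integral_fintype_prod_eq_prod, ENNReal.ofReal_prod_of_nonneg
      (fun j _ => integral_nonneg (hnn j))]
  refine Finset.prod_congr rfl fun j _ => ?_
  rw [withDensity_apply _ (hs j), ofReal_integral_eq_lintegral_ofReal (hint j)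
    (ae_of_all _ (hnn j)), ← lintegral_indicator (hs j)]
  refine lintegral_congr fun x => ?_
  by_cases hx : x ∈ s j <;> simp [hx]

/-- Integral of a function of the coordinates in `T` against weights that are a product of functions
of single coordinates. -/
theorem integral_prod_weights_mul {ι : Type*} [Fintype ι] [DecidableEq ι] (μ ν : Measure ℝ)
    [IsProbabilityMeasure μ] [IsProbabilityMeasure ν] (w : ι → ℝ → ℝ) (T : Finset ι)
    (u : ℝ → ℝ) (hu : Measurable u) (hu01 : ∀ x, u x ∈ Set.Icc (0 : ℝ) 1)
    (hwT : ∀ j ∈ T, w j = u) (q : ℝ) (hq : 0 ≤ q)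
    (hν : ENNReal.ofReal q • ν = μ.withDensity fun x => ENNReal.ofReal (u x))
    (f : (ι → ℝ) → ℝ) (hf : ∀ v v', (∀ j ∈ T, v j = v' j) → f v = f v') :
    ∫ v, (∏ j, w j (v j)) * f v ∂(Measure.pi fun _ => μ) =
      q ^ T.card * (∏ j ∈ Tᶜ, ∫ x, w j x ∂μ) * ∫ v, f v ∂(Measure.pi fun _ => ν) := by
  -- `f` read as a function of the coordinates in `T` alone; the filler 0 is immaterial by `hf`.
  let g : ({j // j ∈ T} → ℝ) → ℝ := fun y => f fun j => if h : j ∈ T then y ⟨j, h⟩ else 0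
  have key : ∀ (κ : Measure ℝ) [IsProbabilityMeasure κ] (w' : ι → ℝ → ℝ),
      ∫ v, (∏ j, w' j (v j)) * f v ∂(Measure.pi fun _ => κ) =
      (∫ y : {j // j ∈ T} → ℝ, (∏ j : {j // j ∈ T}, w' j (y j)) * g y ∂(Measure.pi fun _ => κ)) *
        ∏ j ∈ Tᶜ, ∫ x, w' j x ∂κ := by
    intro κ _ w'
    have h1 : ∏ j ∈ Tᶜ, ∫ x, w' j x ∂κ =
        ∫ z : {j // j ∉ T} → ℝ, ∏ j : {j // j ∉ T}, w' j (z j) ∂(Measure.pi fun _ => κ) := by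
      rw [integral_fintype_prod_eq_prod (fun (j : {j // j ∉ T}) x => w' j x)]
      exact (Finset.prod_subtype _ (by simp) fun j => ∫ x, w' j x ∂κ)
    have hmp : MeasurePreserving (MeasurableEquiv.piEquivPiSubtypeProd (fun _ : ι => ℝ)
        (fun j => j ∈ T)) (Measure.pi fun _ => κ)
        ((Measure.pi fun _ : {j // j ∈ T} => κ).prod (Measure.pi fun _ : {j // j ∉ T} => κ)) := by
      convert measurePreserving_piEquivPiSubtypeProd (fun _ : ι => κ) (fun j => j ∈ T)
    rw [h1, ← integral_prod_mul, ← hmp.integral_comp']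
    refine integral_congr_ae (ae_of_all _ fun v => ?_)
    have h2 : f v = g (fun j => v j) := hf _ _ fun j hj => by simp [hj]
    simp only [MeasurableEquiv.piEquivPiSubtypeProd, MeasurableEquiv.coe_mk,
      Equiv.piEquivPiSubtypeProd_apply]
    have h3 : (∏ j : {j // j ∈ T}, w' j (v j)) * ∏ j : {j // j ∉ T}, w' j (v j) =
        ∏ j, w' j (v j) := by
      convert Fintype.prod_subtype_mul_prod_subtype (fun j => j ∈ T) fun j => w' j (v j)
    rw [h2, ← h3]
    ring
  rw [key μ w]
  -- With unit weights, the factorisation expresses the integral of `f` under the law `ν` through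
  -- the coordinates in `T` alone.
  have h3 := key ν (fun _ _ => 1)
  simp only [Finset.prod_const_one, one_mul, integral_const, probReal_univ, smul_eq_mul,
    mul_one] at h3
  rw [h3]
  have h4 : ∫ y : {j // j ∈ T} → ℝ, (∏ j : {j // j ∈ T}, w j (y j)) * g y
      ∂(Measure.pi fun _ => μ) = q ^ T.card * ∫ y, g y ∂(Measure.pi fun _ => ν) := by
    -- Bayes' rule in product form: weighting each coordinate in `T` by `u` turns `μ` into `q • ν`.
    have h5 : (Measure.pi fun _ : {j // j ∈ T} => μ).withDensity
        (fun v => ENNReal.ofReal (∏ j, u (v j))) =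
        ENNReal.ofReal q ^ T.card • Measure.pi fun _ : {j // j ∈ T} => ν := by
      rw [pi_withDensity μ (fun _ => u) (fun _ => hu) (fun _ => hu01), ← hν]
      have : IsFiniteMeasure (ENNReal.ofReal q • ν) := ⟨by simp⟩
      refine Measure.pi_eq fun s _ => ?_
      simp [Finset.prod_mul_distrib]
    have h6 : ∀ y : {j // j ∈ T} → ℝ, 0 ≤ ∏ j, u (y j) :=
      fun y => Finset.prod_nonneg fun j _ => (hu01 _).1
    have h7 := integral_withDensity_eq_integral_toReal_smul
      (μ := Measure.pi fun _ : {j // j ∈ T} => μ)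
      (f := fun v => ENNReal.ofReal (∏ j, u (v j)))
      (by fun_prop) (ae_of_all _ fun _ => ENNReal.ofReal_lt_top) g
    rw [h5, integral_smul_measure] at h7
    simp only [ENNReal.toReal_pow, ENNReal.toReal_ofReal hq, smul_eq_mul] at h7
    rw [h7]
    refine integral_congr_ae (ae_of_all _ fun y => ?_)
    simp only [ENNReal.toReal_ofReal (h6 y)]
    congr 1
    exact Finset.prod_congr rfl fun j _ => by rw [hwT j j.2]
  rw [h4]
  ring

theorem pi_real_box {ι : Type*} [Fintype ι] [DecidableEq ι] (ν : Measure ℝ)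
    [IsProbabilityMeasure ν] (T : Finset ι) (s : ι → Set ℝ) :
    (Measure.pi fun _ : ι => ν).real {v | ∀ j ∈ T, v j ∈ s j} = ∏ j ∈ T, ν.real (s j) := by
  have : {v : ι → ℝ | ∀ j ∈ T, v j ∈ s j} =
      Set.univ.pi fun j => if j ∈ T then s j else Set.univ := by
    ext v
    simp only [Set.mem_ofPred_eq, Set.mem_pi, Set.mem_univ, true_imp_iff]
    refine forall_congr' fun j => ?_
    by_cases hj : j ∈ T <;> simp [hj]
  rw [this, measureReal_def, Measure.pi_pi, ENNReal.toReal_prod]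
  have h : ∀ j, (ν (if j ∈ T then s j else Set.univ)).toReal =
      if j ∈ T then ν.real (s j) else 1 := by
    intro j; split_ifs <;> simp [measureReal_def]
  simp_rw [h]
  rw [Finset.prod_ite_mem, Finset.univ_inter]

theorem pi_ae_of_forall_ae {ι : Type*} [Fintype ι] {μ : Measure ℝ} [IsProbabilityMeasure μ]
    {P : ι → ℝ → Prop} (h : ∀ j, ∀ᵐ x ∂μ, P j x) :
    ∀ᵐ v ∂(Measure.pi fun _ : ι => μ), ∀ j, P j (v j) :=
  ae_all_iff.2 fun j =>
    (Measure.quasiMeasurePreserving_eval (μ := fun _ : ι => μ) j).ae (h j)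

/-! ### Limits of inequalities and null sets -/

/-- Undercutting `b` means bidding slightly less than `b`; the limit turns the gains from all such
deviations into one inequality at `b`. -/
theorem le_of_forall_mem_Ioo_left {F : ℝ → ℝ} {b₀ b P : ℝ} (hF : Continuous F) (h₀ : b₀ < b)
    (h : ∀ b' ∈ Set.Ioo b₀ b, F b' ≤ P) : F b ≤ P :=
  le_of_tendsto ((hF.tendsto b).mono_left (nhdsWithin_le_nhds (s := Set.Iio b)))
    (by filter_upwards [Ioo_mem_nhdsLT h₀] with b' hb' using h b' hb')

theorem le_of_forall_mem_Ioo_right {F : ℝ → ℝ} {b₀ b P : ℝ} (hF : Continuous F) (h₀ : b < b₀)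
    (h : ∀ b' ∈ Set.Ioo b b₀, P ≤ F b') : P ≤ F b :=
  ge_of_tendsto ((hF.tendsto b).mono_left (nhdsWithin_le_nhds (s := Set.Ioi b)))
    (by filter_upwards [Ioo_mem_nhdsGT h₀] with b' hb' using h b' hb')

theorem exists_mem_of_measureReal_pos {α : Type*} [MeasurableSpace α] {ν : Measure α} {s : Set α}
    {p : α → Prop} (hs : 0 < ν.real s) (hp : ∀ᵐ x ∂ν, p x) : ∃ x ∈ s, p x := by
  by_contra! h
  have : ν s = 0 := measure_mono_null (fun x hx => h x hx) hp
  rw [measureReal_def, this] at hs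
  simp at hs

theorem measureReal_mono_of_ae {α : Type*} [MeasurableSpace α] {ν : Measure α}
    [IsFiniteMeasure ν] {s t : Set α} {p : α → Prop} (hp : ∀ᵐ x ∂ν, p x)
    (h : ∀ x, p x → x ∈ s → x ∈ t) : ν.real s ≤ ν.real t :=
  ENNReal.toReal_mono (measure_ne_top _ _)
    (measure_mono_ae (by filter_upwards [hp] with x hx using h x hx))

theorem continuous_cdf_of_noAtoms (ν : Measure ℝ) [IsProbabilityMeasure ν] [NullSingletonClass ν] :
    Continuous (cdf ν) := by
  refine continuous_iff_continuousAt.2 fun x => ?_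
  rw [(monotone_cdf ν).continuousAt_iff_leftLim_eq_rightLim, StieltjesFunction.rightLim_eq]
  have h := (cdf ν).measure_singleton x
  rw [measure_cdf, measure_singleton] at h
  have h1 := ENNReal.ofReal_eq_zero.1 h.symm
  have h2 := (monotone_cdf ν).leftLim_le (le_refl x)
  linarith

theorem measureReal_Ioi_eq (ν : Measure ℝ) [IsProbabilityMeasure ν] (x : ℝ) :
    ν.real (Set.Ioi x) = 1 - cdf ν x := by
  rw [cdf_eq_real, ← Set.compl_Iic, probReal_compl_eq_one_sub measurableSet_Iic]

theorem measureReal_Ici_eq (ν : Measure ℝ) [IsProbabilityMeasure ν] [NullSingletonClass ν] (x : ℝ) :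
    ν.real (Set.Ici x) = ν.real (Set.Ioi x) :=
  measureReal_congr Ioi_ae_eq_Ici.symm

theorem measureReal_ge_eq_add {α : Type*} [MeasurableSpace α] {ν : Measure α} [IsFiniteMeasure ν]
    {β : α → ℝ} (hβ : Measurable β) (b : ℝ) :
    ν.real {x | b ≤ β x} = ν.real {x | b < β x} + ν.real {x | β x = b} := by
  rw [← measureReal_union]
  · congr 1
    ext x
    simp only [Set.mem_ofPred_eq, Set.mem_union, le_iff_lt_or_eq]
    tauto
  · rw [Set.disjoint_left]
    intro x (h1 : b < β x) (h2 : β x = b)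
    exact absurd h2 h1.ne'
  · exact measurableSet_eq_fun hβ measurable_const

/-! ### First-price auction among ex ante identical sellers

`W b` is the probability that a bid `b` wins against `k` sellers who bid `β`. -/

section Symmetric

variable {ν : Measure ℝ} [IsProbabilityMeasure ν] [NullSingletonClass ν] {β W : ℝ → ℝ} {r c : ℝ} {k : ℕ}

/-- Undercutting. As `ν` has no atoms, an atom of bids at `b` contains a type with positive margin.
Slightly below `b` this type beats everyone who bids at least `b`, while at `b` it loses half of the
ties with at least one opponent; this is what the factor `ν {β > b} + ν {β = b} / 2` in `hup`
records. -/
theorem no_bid_atom_of_optimal (hβ : Measurable β)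
    (hsupp : ∀ᵐ x ∂ν, x ∈ Set.Ioc c 1) (hβx : ∀ x ∈ Set.Ioc c 1, x ≤ β x) (hk : 1 ≤ k)
    (hlo : ∀ b ≤ r, ν.real {x | b < β x} ^ k ≤ W b)
    (hup : ∀ b ≤ r, W b ≤ ν.real {x | b ≤ β x} ^ (k - 1) *
      (ν.real {x | b < β x} + ν.real {x | β x = b} / 2))
    (hopt : ∀ x ∈ Set.Ioc c 1, ∀ b, W b * (b - x) ≤ W (β x) * (β x - x))
    {b : ℝ} (hb : b ≤ r) : ν.real {x | β x = b} = 0 := by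
  by_contra hne
  have hpos : 0 < ν.real {x | β x = b} := lt_of_le_of_ne measureReal_nonneg (Ne.symm hne)
  have hsum := measureReal_ge_eq_add (ν := ν) hβ b
  obtain ⟨x, hxb, hx, hxne⟩ := exists_mem_of_measureReal_pos hpos
    (hsupp.and (Measure.ae_ne ν b))
  have hxb' : β x = b := hxb
  have hxlt : x < b := lt_of_le_of_ne (hxb' ▸ hβx x hx) hxne
  have h1 : ν.real {x | b ≤ β x} ^ k * (b - x) ≤ W b * (b - x) := by
    refine le_of_forall_mem_Ioo_left (F := fun b' => ν.real {x | b ≤ β x} ^ k * (b' - x))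
      (by fun_prop) hxlt fun b' hb' => ?_
    have h2 := hopt x hx b'
    rw [hxb'] at h2
    refine le_trans (mul_le_mul_of_nonneg_right ?_ (by linarith [hb'.1])) h2
    refine le_trans ?_ (hlo b' (by linarith [hb'.2]))
    exact pow_le_pow_left₀ measureReal_nonneg (measureReal_mono fun y (hy : b ≤ β y) =>
      show b' < β y from hb'.2.trans_le hy) _
  have h2 := le_of_mul_le_mul_right h1 (by linarith)
  have h3 := h2.trans (hup b hb)
  have hge : 0 < ν.real {x | b ≤ β x} := by
    rw [hsum]; have := measureReal_nonneg (μ := ν) (s := {x | b < β x}); linarith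
  have h4 : ν.real {x | b ≤ β x} ^ k = ν.real {x | b ≤ β x} ^ (k - 1) * ν.real {x | b ≤ β x} := by
    rw [← pow_succ, Nat.sub_add_cancel hk]
  rw [h4] at h3
  have h5 := le_of_mul_le_mul_left h3 (pow_pos hge _)
  linarith

/-- Without atoms, a bid wins exactly against higher bids. Incentive compatibility makes the winning
probability monotone in the value, and among bids with equal positive winning probability only the
highest can be optimal. Hence, up to null sets, the opponents bidding above `β x` are those with
values above `x`. -/
theorem winProb_eq_of_optimal (hβ : Measurable β)
    (hsupp : ∀ᵐ x ∂ν, x ∈ Set.Ioc c 1) (hβx : ∀ x ∈ Set.Ioc c 1, x ≤ β x) (hr : r ≤ 1) (hk : 1 ≤ k)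
    (hout : ∀ b, r < b → W b = 0)
    (hlo : ∀ b ≤ r, ν.real {x | b < β x} ^ k ≤ W b)
    (hup : ∀ b ≤ r, W b ≤ ν.real {x | b ≤ β x} ^ (k - 1) *
      (ν.real {x | b < β x} + ν.real {x | β x = b} / 2))
    (hopt : ∀ x ∈ Set.Ioc c 1, ∀ b, W b * (b - x) ≤ W (β x) * (β x - x))
    (htail : ∀ b < r, 0 < ν.real (Set.Ioi b)) {x : ℝ} (hx : x ∈ Set.Ioo c r) :
    W (β x) = ν.real (Set.Ioi x) ^ k := by
  have hatom : ∀ b ≤ r, ν.real {x | β x = b} = 0 := fun b hb =>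
    no_bid_atom_of_optimal hβ hsupp hβx hk hlo hup hopt hb
  have hW : ∀ b ≤ r, W b = ν.real {x | b < β x} ^ k := by
    intro b hb
    refine le_antisymm ((hup b hb).trans (le_of_eq ?_)) (hlo b hb)
    rw [measureReal_ge_eq_add hβ, hatom b hb, add_zero, zero_div, add_zero, ← pow_succ,
      Nat.sub_add_cancel hk]
  have hanti : ∀ b b', b ≤ b' → b' ≤ r → W b' ≤ W b := by
    intro b b' hbb hb'
    rw [hW b (hbb.trans hb'), hW b' hb']
    exact pow_le_pow_left₀ measureReal_nonneg (measureReal_mono fun y (hy : b' < β y) =>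
      show b < β y from hbb.trans_lt hy) _
  have hx1 : x ∈ Set.Ioc c 1 := ⟨hx.1, hx.2.le.trans hr⟩
  -- The midpoint of `x` and `r` leaves a positive margin and wins whenever all opponents have
  -- higher values, as nobody bids below value.
  have hWpos : 0 < W (β x) := by
    have hb : (x + r) / 2 < r := by linarith [hx.2]
    have h1 : 0 < W ((x + r) / 2) := by
      refine lt_of_lt_of_le (pow_pos (htail _ hb) k) (le_trans ?_ (hlo _ hb.le))
      refine pow_le_pow_left₀ measureReal_nonneg (measureReal_mono_of_ae hsupp ?_) _
      intro y hy hyb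
      exact lt_of_lt_of_le hyb (hβx y hy)
    have h2 := hopt x hx1 ((x + r) / 2)
    have h3 : 0 < W ((x + r) / 2) * ((x + r) / 2 - x) := mul_pos h1 (by linarith [hx.2])
    exact pos_of_mul_pos_left (h3.trans_le h2) (by linarith [hβx x hx1])
  have hβr : β x ≤ r := by
    by_contra h
    exact hWpos.ne' (hout _ (not_le.1 h))
  -- The sum of the two incentive constraints orders the winning probabilities; `β` itself is not
  -- assumed monotone.
  have hmono : ∀ y ∈ Set.Ioc c 1, ∀ z ∈ Set.Ioc c 1, y < z → W (β z) ≤ W (β y) := by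
    intro y hy z hz hyz
    have h1 := hopt y hy (β z)
    have h2 := hopt z hz (β y)
    refine le_of_mul_le_mul_right (a := z - y) ?_ (by linarith)
    linarith
  rw [hW _ hβr]
  congr 1
  refine le_antisymm ?_ ?_
  · rw [← measureReal_Ici_eq]
    refine measureReal_mono_of_ae hsupp fun y hy (hyβ : β x < β y) => ?_
    by_contra hyx
    have hyx' : y < x := not_le.1 hyx
    have h1 := hmono y hy x hx1 hyx'
    have hyr : β y ≤ r := by
      by_contra h
      exact (hWpos.trans_le h1).ne' (hout _ (not_le.1 h))
    have h2 := hanti _ _ hyβ.le hyr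
    have h3 := hopt x hx1 (β y)
    rw [le_antisymm h2 h1] at h3
    have := le_of_mul_le_mul_left h3 hWpos
    linarith
  · have h0 := measureReal_ge_eq_add (ν := ν) hβ (β x)
    rw [hatom _ hβr, add_zero] at h0
    rw [← h0]
    refine measureReal_mono_of_ae hsupp fun y hy (hxy : x < y) => ?_
    change β x ≤ β y
    by_contra hyβ
    have hyβ' := not_le.1 hyβ
    have h1 := hmono x hx1 y hy hxy
    have h2 := hanti _ _ hyβ'.le hβr
    have h4 := le_antisymm h2 h1
    have h3 := hopt y hy (β x)
    rw [h4] at h3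
    have := le_of_mul_le_mul_left h3 (h4 ▸ hWpos)
    linarith

/-- Envelope theorem. A type can mimic another one, which yields the subgradient inequality `hsub`.
Hence the equilibrium payoff is 1-Lipschitz with derivative minus the winning probability, and it
vanishes at `r`. -/
theorem payoff_eq_integral_of_optimal (hβ : Measurable β)
    (hsupp : ∀ᵐ x ∂ν, x ∈ Set.Ioc c 1) (hβx : ∀ x ∈ Set.Ioc c 1, x ≤ β x) (hr : r ≤ 1) (hk : 1 ≤ k)
    (hout : ∀ b, r < b → W b = 0) (h01 : ∀ b, 0 ≤ W b ∧ W b ≤ 1)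
    (hlo : ∀ b ≤ r, ν.real {x | b < β x} ^ k ≤ W b)
    (hup : ∀ b ≤ r, W b ≤ ν.real {x | b ≤ β x} ^ (k - 1) *
      (ν.real {x | b < β x} + ν.real {x | β x = b} / 2))
    (hopt : ∀ x ∈ Set.Ioc c 1, ∀ b, W b * (b - x) ≤ W (β x) * (β x - x))
    (htail : ∀ b < r, 0 < ν.real (Set.Ioi b)) {x : ℝ} (hx : x ∈ Set.Ioc c r) :
    W (β x) * (β x - x) = ∫ y in x..r, ν.real (Set.Ioi y) ^ k := by
  have hWeq := fun x hx => winProb_eq_of_optimal hβ hsupp hβx hr hk hout hlo hup hopt htail (x := x) hx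
  set u : ℝ → ℝ := fun x => W (β x) * (β x - x) with hu
  set g : ℝ → ℝ := fun y => ν.real (Set.Ioi y) ^ k with hg
  have hgc : Continuous g := by
    simp only [hg, measureReal_Ioi_eq]
    have := continuous_cdf_of_noAtoms ν
    fun_prop
  have hmem : ∀ {x}, x ∈ Set.Ioc c r → x ∈ Set.Ioc c 1 := fun h => ⟨h.1, h.2.trans hr⟩
  have hsub : ∀ y ∈ Set.Ioc c 1, ∀ z ∈ Set.Ioc c 1, u y + (y - z) * W (β y) ≤ u z := by
    intro y _ z hz
    have := hopt z hz (β y)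
    simp only [hu]
    linarith
  -- Type `r` bids at least `r`: the bid `r` leaves no margin, and a higher bid never wins.
  have hur : c < r → u r = 0 := by
    intro hcr
    have h1 := hβx r ⟨hcr, hr⟩
    rcases h1.eq_or_lt with h | h
    · simp [hu, ← h]
    · simp [hu, hout _ h]
  have hcr : c < r := hx.1.trans_le hx.2
  have hcont : ContinuousOn u (Set.Icc x r) := by
    have hl : LipschitzOnWith 1 u (Set.Icc x r) := by
      refine LipschitzOnWith.of_dist_le_mul fun y hy z hz => ?_
      have hy' : y ∈ Set.Ioc c 1 := hmem ⟨hx.1.trans_le hy.1, hy.2⟩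
      have hz' : z ∈ Set.Ioc c 1 := hmem ⟨hx.1.trans_le hz.1, hz.2⟩
      have h1 := hsub y hy' z hz'
      have h2 := hsub z hz' y hy'
      have h3 := h01 (β y)
      have h4 := h01 (β z)
      have h5 := abs_nonneg (y - z)
      have h6 := le_abs_self (y - z)
      have h7 := neg_abs_le (y - z)
      rw [Real.dist_eq, Real.dist_eq, NNReal.coe_one, one_mul, abs_le]
      constructor <;> nlinarith
    exact hl.continuousOn
  -- The two mimicking inequalities squeeze the difference quotient between `-g y` and `-g z`, and
  -- `g` is continuous.
  have hderiv : ∀ y ∈ Set.Ioo x r, HasDerivAt u (-g y) y := by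
    intro y hy
    have hyI : y ∈ Set.Ioo c r := ⟨hx.1.trans hy.1, hy.2⟩
    rw [hasDerivAt_iff_isLittleO, Asymptotics.isLittleO_iff]
    intro ε hε
    have h1 := Metric.continuousAt_iff.1 (hgc.continuousAt (x := y)) ε hε
    obtain ⟨δ, hδ, h1⟩ := h1
    filter_upwards [Ioo_mem_nhds hyI.1 hyI.2, Metric.ball_mem_nhds y hδ] with z hz hzδ
    have h2 := (h1 hzδ).le
    rw [Real.dist_eq, abs_le] at h2
    have h3 := hsub y (hmem ⟨hyI.1, hyI.2.le⟩) z (hmem ⟨hz.1, hz.2.le⟩)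
    have h4 := hsub z (hmem ⟨hz.1, hz.2.le⟩) y (hmem ⟨hyI.1, hyI.2.le⟩)
    rw [hWeq y hyI] at h3
    rw [hWeq z hz] at h4
    change u y + (y - z) * g y ≤ u z at h3
    change u z + (z - y) * g z ≤ u y at h4
    rw [Real.norm_eq_abs, Real.norm_eq_abs, smul_eq_mul, abs_le]
    rcases abs_cases (z - y) with ⟨h, h'⟩ | ⟨h, h'⟩ <;> rw [h] <;> constructor <;> nlinarith
  have h := intervalIntegral.integral_eq_sub_of_hasDerivAt_of_le hx.2 hcont hderiv
    (hgc.neg.intervalIntegrable _ _)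
  rw [intervalIntegral.integral_neg, hur hcr] at h
  change u x = ∫ y in x..r, g y
  linarith

end Symmetric

/-! ### First-price auction with the speculator

`W b` is the probability that a seller's bid `b` wins against `k` other sellers, who bid `β`, and
the speculator, whose bid has law `S`; `Ws s` is the probability that the speculator's bid `s` wins
against `k + 1` sellers. -/

/-- Let `P` be the revenue that almost every bid of the speculator earns. Sellers bid at least their
values, so any `b` in `[c,r]` earns at least `b * ν.real (Set.Ioi b) ^ (k + 1)`, and thus `L ≤ P`.
Comparison at the bottom of the support of `S` shows that no seller bids below `P`; the speculator
does not either, so a bid below `P` beats everybody. At the top of the support, sellers of lower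
value do not want to be outbid for sure, so essentially only values above that bid stay behind it,
and `P ≤ L`. -/
theorem speculator_revenue_le_and_low_bid_wins {ν S : Measure ℝ} [IsProbabilityMeasure ν]
    [NullSingletonClass ν] [IsProbabilityMeasure S] {β W Ws : ℝ → ℝ} {r c : ℝ} {k : ℕ} (hc : 0 < c)
    (hcr : c ≤ r) (hβ : Measurable β)
    (hsupp : ∀ᵐ x ∂ν, x ∈ Set.Ioc c 1) (hβx : ∀ x ∈ Set.Ioc c 1, x ≤ β x)
    (htail : ∀ b < r, 0 < ν.real (Set.Ioi b))
    (h01s : ∀ b, 0 ≤ Ws b ∧ Ws b ≤ 1) (houts : ∀ s, r < s → Ws s = 0)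
    (hlos : ∀ b ≤ r, ν.real {x | b < β x} ^ (k + 1) ≤ Ws b)
    (hups : ∀ b ≤ r, Ws b ≤ ν.real {x | b ≤ β x} ^ k *
      (ν.real {x | b < β x} + ν.real {x | β x = b} / 2))
    (hopts : ∀ᵐ s ∂S, ∀ s', Ws s' * s' ≤ Ws s * s)
    (h01 : ∀ b, 0 ≤ W b ∧ W b ≤ 1)
    (hlo : ∀ b ≤ r, ν.real {x | b < β x} ^ k * S.real (Set.Ioi b) ≤ W b)
    (hup : ∀ b, W b ≤ S.real (Set.Ici b))
    (hopt : ∀ x ∈ Set.Ioc c 1, ∀ b, W b * (b - x) ≤ W (β x) * (β x - x)) :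
    (∀ᵐ s ∂S, Ws s * s ≤
      sSup ((fun b => b * ν.real (Set.Ioi b) ^ (k + 1)) '' Set.Icc c r)) ∧
    ∀ b < sSup ((fun b => b * ν.real (Set.Ioi b) ^ (k + 1)) '' Set.Icc c r), W b = 1 := by
  set L := sSup ((fun b => b * ν.real (Set.Ioi b) ^ (k + 1)) '' Set.Icc c r) with hL
  obtain ⟨s₀, hs₀⟩ := hopts.exists
  obtain ⟨P, hP⟩ : ∃ P, Ws s₀ * s₀ = P := ⟨_, rfl⟩
  rw [hP] at hs₀
  have hgood : ∀ᵐ s ∂S, Ws s * s = P := by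
    filter_upwards [hopts] with s hs
    exact le_antisymm (hs₀ s) (hP ▸ hs s₀)
  have hge1 : ∀ b, ν.real {x | b ≤ β x} ≤ 1 := fun b => measureReal_le_one
  have hup' : ∀ b ≤ r, Ws b ≤ ν.real {x | b ≤ β x} ^ (k + 1) := by
    intro b hb
    refine (hups b hb).trans ?_
    rw [pow_succ, measureReal_ge_eq_add hβ]
    have h1 := measureReal_nonneg (μ := ν) (s := {x | β x = b})
    have h2 := measureReal_nonneg (μ := ν) (s := {x | b < β x})
    gcongr
    linarith
  have hval : ∀ b, ν.real (Set.Ioi b) ≤ ν.real {x | b < β x} := fun b =>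
    measureReal_mono_of_ae hsupp fun y hy hyb => lt_of_lt_of_le hyb (hβx y hy)
  have hnuc : ν.real (Set.Ioi c) = 1 := by
    refine le_antisymm measureReal_le_one ?_
    rw [← probReal_univ (μ := ν)]
    exact measureReal_mono_of_ae hsupp fun x hx _ => hx.1
  have hbdd : BddAbove ((fun b => b * ν.real (Set.Ioi b) ^ (k + 1)) '' Set.Icc c r) := by
    refine ⟨r, ?_⟩
    rintro _ ⟨b, hb, rfl⟩
    have : ν.real (Set.Ioi b) ^ (k + 1) ≤ 1 := pow_le_one₀ measureReal_nonneg measureReal_le_one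
    exact (mul_le_of_le_one_right (hc.le.trans hb.1) this).trans hb.2
  have hcL : c ≤ L := by
    refine le_csSup_of_le hbdd ⟨c, ⟨le_rfl, hcr⟩, rfl⟩ ?_
    simp [hnuc]
  have hLP : L ≤ P := by
    refine csSup_le ⟨_, ⟨c, ⟨le_rfl, hcr⟩, rfl⟩⟩ ?_
    rintro _ ⟨b, hb, rfl⟩
    refine le_trans ?_ (hs₀ b)
    rw [mul_comm (Ws b)]
    change b * _ ≤ _
    rw [mul_comm b, mul_comm b]
    refine mul_le_mul_of_nonneg_right ?_ (hc.le.trans hb.1)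
    exact (pow_le_pow_left₀ measureReal_nonneg (hval b) _).trans (hlos b hb.2)
  have hPpos : 0 < P := hc.trans_le (hcL.trans hLP)
  have hgood' : ∀ s, Ws s * s = P → P ≤ s ∧ s ≤ r := by
    intro s hs
    have hs0 : 0 < s := by
      by_contra h
      have := mul_nonpos_of_nonneg_of_nonpos (h01s s).1 (not_lt.1 h)
      linarith
    refine ⟨?_, ?_⟩
    · rw [← hs]; exact mul_le_of_le_one_left hs0.le (h01s s).2
    · by_contra h
      rw [houts s (not_le.1 h), zero_mul] at hs
      linarith
  have hPr : P ≤ r := by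
    obtain ⟨s, hs⟩ := hgood.exists
    exact (hgood' s hs).1.trans (hgood' s hs).2
  have hSP : ∀ t < P, S.real (Set.Ioi t) = 1 := by
    intro t ht
    refine le_antisymm measureReal_le_one ?_
    rw [← probReal_univ (μ := S)]
    exact measureReal_mono_of_ae hgood fun s hs _ => ht.trans_le (hgood' s hs).1
  -- no seller bids less than the speculator's revenue
  have hβP : ∀ x ∈ Set.Ioc c 1, P ≤ β x := by
    intro x hx
    by_contra hlt
    rw [not_le] at hlt
    -- The supremum `t₀` of `Z` is the bottom of the support of the speculator's bid.
    set Z : Set ℝ := {t | S (Set.Iio t) = 0} with hZ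
    have hZP : P ∈ Z := by
      refine measure_mono_null ?_ hgood
      intro s hs
      exact fun h => absurd (hgood' s h).1 (not_le.2 hs)
    have hZbdd : BddAbove Z := by
      refine ⟨r, fun t ht => ?_⟩
      by_contra hrt
      have h1 : ∀ᵐ s ∂S, ¬ s < t := by
        rw [ae_iff]; simp only [not_not]; exact ht
      obtain ⟨s, hs1, hs2⟩ := (h1.and hgood).exists
      exact hs1 ((hgood' s hs2).2.trans_lt (not_le.1 hrt))
    set t₀ := sSup Z with ht₀
    have hPt : P ≤ t₀ := le_csSup hZbdd hZP
    have hbelow : ∀ t < t₀, S.real (Set.Ioi t) = 1 := by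
      intro t ht
      obtain ⟨z, hz, htz⟩ := exists_lt_of_lt_csSup ⟨P, hZP⟩ ht
      refine le_antisymm measureReal_le_one ?_
      have : S.real (Set.Iio z)ᶜ = 1 := by
        rw [probReal_compl_eq_one_sub measurableSet_Iio, measureReal_def, hz]; simp
      rw [← this]
      refine measureReal_mono fun s hs => ?_
      exact htz.trans_le (not_lt.1 hs)
    have ht₀r : t₀ ≤ r := csSup_le ⟨P, hZP⟩ (by
      intro t ht
      by_contra hrt
      have h1 : ∀ᵐ s ∂S, ¬ s < t := by
        rw [ae_iff]; simp only [not_not]; exact ht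
      obtain ⟨s, hs1, hs2⟩ := (h1.and hgood).exists
      exact hs1 ((hgood' s hs2).2.trans_lt (not_le.1 hrt)))
    set h := ν.real {x | t₀ ≤ β x} with hh
    have hh0 : 0 ≤ h := measureReal_nonneg
    have hh1 : h ≤ 1 := measureReal_le_one
    -- Slightly below `t₀`, type `x` beats the speculator for sure and all sellers who bid at least
    -- `t₀`; his present payoff is at most his margin.
    have h1 : h ^ k * (t₀ - x) ≤ β x - x := by
      refine le_of_forall_mem_Ioo_left (F := fun t => h ^ k * (t - x)) (by fun_prop)
        (hlt.trans_le hPt) fun t ht => ?_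
      have h2 := hopt x hx t
      have h3 : W (β x) * (β x - x) ≤ β x - x :=
        mul_le_of_le_one_left (by linarith [hβx x hx]) (h01 _).2
      refine le_trans (mul_le_mul_of_nonneg_right ?_ (by linarith [ht.1, hβx x hx])) (h2.trans h3)
      refine le_trans ?_ (hlo t (ht.2.le.trans ht₀r))
      rw [hbelow t ht.2, mul_one]
      refine pow_le_pow_left₀ hh0 (measureReal_mono ?_) _
      intro y hy
      exact ht.2.trans_le hy
    -- Optimal bids of the speculator come arbitrarily close to `t₀` from above, and they win only
    -- against sellers who bid at least `t₀`.
    have h2 : P ≤ h ^ (k + 1) * t₀ := by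
      refine le_of_forall_mem_Ioo_right (F := fun t => h ^ (k + 1) * t) (by fun_prop)
        (lt_add_one t₀) fun t ht => ?_
      have h3 : ¬ t ∈ Z := fun h => absurd (le_csSup hZbdd h) (not_le.2 ht.1)
      have h4 : 0 < S.real (Set.Iio t) :=
        ENNReal.toReal_pos h3 (measure_ne_top _ _)
      have hae : ∀ᵐ s ∂S, Ws s * s = P ∧ t₀ ≤ s := by
        filter_upwards [hgood, (ae_all_iff.2 fun n : ℕ => show ∀ᵐ s ∂S, t₀ - 1 / ((n : ℝ) + 1) < s from by
          have h5 := hbelow (t₀ - 1 / ((n : ℝ) + 1)) (by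
            have : 0 < 1 / ((n : ℝ) + 1) := by positivity
            linarith)
          exact mem_ae_iff_prob_eq_one measurableSet_Ioi |>.2 (by
            rw [measureReal_def] at h5
            rw [← ENNReal.ofReal_toReal (measure_ne_top S _), h5]; simp))] with s hs1 hs2
        refine ⟨hs1, le_of_forall_pos_le_add fun ε hε => ?_⟩
        obtain ⟨n, hn⟩ := exists_nat_one_div_lt hε
        linarith [hs2 n]
      obtain ⟨s, hst, hsP, hs⟩ := exists_mem_of_measureReal_pos h4 hae
      have hsr := (hgood' s hsP).2
      have h6 := hup' s hsr
      have h7 : ν.real {x | s ≤ β x} ^ (k + 1) ≤ h ^ (k + 1) := by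
        refine pow_le_pow_left₀ measureReal_nonneg (measureReal_mono ?_) _
        intro y hy
        exact hs.trans hy
      have h8 : 0 ≤ s := hPpos.le.trans (hgood' s hsP).1
      calc P = Ws s * s := hsP.symm
        _ ≤ h ^ (k + 1) * s := mul_le_mul_of_nonneg_right (h6.trans h7) h8
        _ ≤ h ^ (k + 1) * t := mul_le_mul_of_nonneg_left (le_of_lt hst) (by positivity)
    have h3 : h ^ (k + 1) ≤ h ^ k := by
      rw [pow_succ]; exact mul_le_of_le_one_right (by positivity) hh1
    have h4 : h ^ k ≤ 1 := pow_le_one₀ hh0 hh1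
    have h5 : 0 ≤ h ^ k := by positivity
    have h6 : 0 < x := hc.trans hx.1
    have h7 : 0 ≤ t₀ := hPpos.le.trans hPt
    -- Together: `h ^ k * (t₀ - x) < P - x ≤ h ^ k * t₀ - x`, so `x < h ^ k * x`, which is
    -- impossible for `h ≤ 1` and `x > 0`.
    nlinarith
  have hPL : P ≤ L := by
    -- The infimum `t₁` of this set is the top of the support of the speculator's bid.
    set Z : Set ℝ := {t | S (Set.Ioi t) = 0} with hZ
    have hZr : r ∈ Z := by
      refine measure_mono_null ?_ hgood
      intro s hs
      exact fun h => absurd (hgood' s h).2 (not_le.2 hs)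
    have hPZ : ∀ t ∈ Z, P ≤ t := by
      intro t ht
      have h1 : ∀ᵐ s ∂S, ¬ t < s := by
        rw [ae_iff]; simp only [not_not]; exact ht
      obtain ⟨s, hs1, hs2⟩ := (h1.and hgood).exists
      exact (hgood' s hs2).1.trans (not_lt.1 hs1)
    have hZbdd : BddBelow Z := ⟨P, hPZ⟩
    set t₁ := sInf Z with ht₁
    have hPt : P ≤ t₁ := le_csInf ⟨r, hZr⟩ hPZ
    have ht₁r : t₁ ≤ r := csInf_le hZbdd hZr
    have ht₁0 : 0 < t₁ := hPpos.trans_le hPt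
    have hbelow : ∀ t < t₁, 0 < S.real (Set.Ioi t) := fun t ht =>
      ENNReal.toReal_pos (fun h => absurd (csInf_le hZbdd h) (not_le.2 ht)) (measure_ne_top _ _)
    have habove : ∀ t, t₁ < t → S.real (Set.Ici t) = 0 := by
      intro t ht
      obtain ⟨z, hz, hzt⟩ := exists_lt_of_csInf_lt ⟨r, hZr⟩ ht
      have : S (Set.Ici t) = 0 := measure_mono_null (fun s hs => hzt.trans_le hs) hz
      rw [measureReal_def, this]; simp
    -- A type below `t₁` can bid midway to `t₁`: with positive probability both the speculator and
    -- all other sellers bid more.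
    have hpay : ∀ x ∈ Set.Ioc c 1, x < t₁ → 0 < W (β x) := by
      intro x hx hxt
      have hmid : (x + t₁) / 2 < t₁ := by linarith
      have h1 : 0 < W ((x + t₁) / 2) := by
        refine lt_of_lt_of_le ?_ (hlo _ (hmid.le.trans ht₁r))
        exact mul_pos (pow_pos ((htail _ (hmid.trans_le ht₁r)).trans_le (hval _)) _)
          (hbelow _ hmid)
      have h2 := hopt x hx ((x + t₁) / 2)
      have h3 : 0 < W ((x + t₁) / 2) * ((x + t₁) / 2 - x) := mul_pos h1 (by linarith)
      exact pos_of_mul_pos_left (h3.trans_le h2) (by linarith [hβx x hx])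
    have h1 : ν.real {x | t₁ < β x} ≤ ν.real (Set.Ioi t₁) := by
      rw [← measureReal_Ici_eq]
      refine measureReal_mono_of_ae hsupp fun x hx (hxβ : t₁ < β x) => ?_
      by_contra hxt
      have h2 := hpay x hx (not_le.1 hxt)
      have h3 := hup (β x)
      rw [habove _ hxβ] at h3
      linarith
    -- An atom of seller bids at `t₁` includes a type below `t₁`, which wins with positive
    -- probability. Then the speculator bids `t₁` with positive probability, so `t₁` earns `P`; but
    -- undercutting the tie would earn him more.
    have h2 : ν.real {x | β x = t₁} = 0 := by
      by_contra hne
      have hpos : 0 < ν.real {x | β x = t₁} := lt_of_le_of_ne measureReal_nonneg (Ne.symm hne)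
      obtain ⟨x, hxb, hx, hxne⟩ := exists_mem_of_measureReal_pos hpos
        (hsupp.and (Measure.ae_ne ν t₁))
      have hxb' : β x = t₁ := hxb
      have hxlt : x < t₁ := lt_of_le_of_ne (hxb' ▸ hβx x hx) hxne
      have h3 := (hpay x hx hxlt).trans_le (hup (β x))
      rw [hxb'] at h3
      have hae : ∀ᵐ s ∂S, Ws s * s = P ∧ s ≤ t₁ := by
        filter_upwards [hgood, (ae_all_iff.2 fun n : ℕ => show ∀ᵐ s ∂S, s < t₁ + 1 / ((n : ℝ) + 1) from by
          have h5 := habove (t₁ + 1 / ((n : ℝ) + 1)) (by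
            have : 0 < 1 / ((n : ℝ) + 1) := by positivity
            linarith)
          rw [ae_iff]
          simp only [not_lt]
          exact (measureReal_eq_zero_iff (by finiteness)).1 h5)] with s hs1 hs2
        refine ⟨hs1, le_of_forall_pos_le_add fun ε hε => ?_⟩
        obtain ⟨n, hn⟩ := exists_nat_one_div_lt hε
        linarith [hs2 n]
      obtain ⟨s, hst, hsP, hs⟩ := exists_mem_of_measureReal_pos h3 hae
      have hseq : s = t₁ := le_antisymm hs hst
      rw [hseq] at hsP
      have hsum := measureReal_ge_eq_add (ν := ν) hβ t₁
      have h4 : ν.real {x | t₁ ≤ β x} ^ (k + 1) * t₁ ≤ P := by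
        refine le_of_forall_mem_Ioo_left (F := fun b' => ν.real {x | t₁ ≤ β x} ^ (k + 1) * b')
          (by fun_prop) ht₁0 fun b' hb' => ?_
        refine le_trans (mul_le_mul_of_nonneg_right ?_ hb'.1.le) (hs₀ b')
        refine le_trans ?_ (hlos b' (hb'.2.le.trans ht₁r))
        exact pow_le_pow_left₀ measureReal_nonneg (measureReal_mono fun y (hy : t₁ ≤ β y) =>
          show b' < β y from hb'.2.trans_le hy) _
      rw [← hsP] at h4
      have h5 := (le_of_mul_le_mul_right h4 ht₁0).trans (hups t₁ ht₁r)
      have hge : 0 < ν.real {x | t₁ ≤ β x} := by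
        rw [hsum]; have := measureReal_nonneg (μ := ν) (s := {x | t₁ < β x}); linarith
      rw [pow_succ] at h5
      have h6 := le_of_mul_le_mul_left h5 (pow_pos hge _)
      linarith
    -- The speculator's optimal bids approach `t₁` from below; continuity from above of the measure
    -- of `{t ≤ β}` passes to the limit.
    have h3 : P ≤ t₁ * ν.real {x | t₁ ≤ β x} ^ (k + 1) := by
      have hlim : Filter.Tendsto (fun n : ℕ => ν.real {x | t₁ - 1 / ((n : ℝ) + 1) ≤ β x})
          Filter.atTop (nhds (ν.real {x | t₁ ≤ β x})) := by
        have hI : {x | t₁ ≤ β x} = ⋂ n : ℕ, {x | t₁ - 1 / ((n : ℝ) + 1) ≤ β x} := by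
          ext x
          simp only [Set.mem_ofPred_eq, Set.mem_iInter]
          constructor
          · intro h n
            have : 0 < 1 / ((n : ℝ) + 1) := by positivity
            linarith
          · intro h
            refine le_of_forall_pos_le_add fun ε hε => ?_
            obtain ⟨n, hn⟩ := exists_nat_one_div_lt hε
            linarith [h n]
        rw [hI]
        refine (ENNReal.tendsto_toReal (measure_ne_top _ _)).comp
          (tendsto_measure_iInter_atTop
            (fun n => (measurableSet_le measurable_const hβ).nullMeasurableSet) ?_
            ⟨0, measure_ne_top _ _⟩)
        intro n n' hn x hx
        have : 1 / ((n' : ℝ) + 1) ≤ 1 / ((n : ℝ) + 1) := by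
          have : (n : ℝ) ≤ n' := by exact_mod_cast hn
          gcongr
        have hx' : t₁ - 1 / ((n' : ℝ) + 1) ≤ β x := hx
        change t₁ - 1 / ((n : ℝ) + 1) ≤ β x
        linarith
      refine ge_of_tendsto' ((hlim.pow (k + 1)).const_mul t₁) fun n => ?_
      have hn : 0 < 1 / ((n : ℝ) + 1) := by positivity
      have hae : ∀ᵐ s ∂S, Ws s * s = P ∧ s ≤ t₁ := by
        filter_upwards [hgood, (ae_all_iff.2 fun n : ℕ => show ∀ᵐ s ∂S, s < t₁ + 1 / ((n : ℝ) + 1) from by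
          have h5 := habove (t₁ + 1 / ((n : ℝ) + 1)) (by
            have : 0 < 1 / ((n : ℝ) + 1) := by positivity
            linarith)
          rw [ae_iff]
          simp only [not_lt]
          exact (measureReal_eq_zero_iff (by finiteness)).1 h5)] with s hs1 hs2
        refine ⟨hs1, le_of_forall_pos_le_add fun ε hε => ?_⟩
        obtain ⟨n, hn⟩ := exists_nat_one_div_lt hε
        linarith [hs2 n]
      obtain ⟨s, hst, hsP, hs⟩ := exists_mem_of_measureReal_pos
        (hbelow (t₁ - 1 / ((n : ℝ) + 1)) (by linarith)) hae
      have h4 := hup' s (hs.trans ht₁r)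
      have h5 : ν.real {x | s ≤ β x} ^ (k + 1) ≤
          ν.real {x | t₁ - 1 / ((n : ℝ) + 1) ≤ β x} ^ (k + 1) := by
        refine pow_le_pow_left₀ measureReal_nonneg (measureReal_mono ?_) _
        intro y (hy : s ≤ β y)
        exact (le_of_lt (show t₁ - 1 / ((n : ℝ) + 1) < s from hst)).trans hy
      have h8 : 0 ≤ s := hPpos.le.trans (hgood' s hsP).1
      calc P = Ws s * s := hsP.symm
        _ = s * Ws s := mul_comm _ _
        _ ≤ t₁ * _ := mul_le_mul hs (h4.trans h5) (h01s s).1 ht₁0.le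
    refine h3.trans (le_trans ?_ (le_csSup hbdd ⟨t₁, ⟨hcL.trans (hLP.trans hPt), ht₁r⟩, rfl⟩))
    rw [measureReal_ge_eq_add hβ, h2, add_zero]
    exact mul_le_mul_of_nonneg_left (pow_le_pow_left₀ measureReal_nonneg h1 _) ht₁0.le
  refine ⟨?_, fun b hb => ?_⟩
  · filter_upwards [hgood] with s hs
    rw [hs]; exact hPL
  · have hbP := hb.trans_le hLP
    refine le_antisymm (h01 b).2 (le_trans (le_of_eq ?_) (hlo b (hbP.le.trans hPr)))
    have : ν.real {x | b < β x} = 1 := by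
      refine le_antisymm measureReal_le_one ?_
      rw [← probReal_univ (μ := ν)]
      exact measureReal_mono_of_ae hsupp fun x hx _ => hbP.trans_le (hβP x hx)
    rw [this, hSP b hbP]; simp

/-! ### Winning shares and prices -/

section WinShare

variable {κ : Type} {r : ℝ} {B : Finset κ} {b : κ → ℝ} {i : κ}

theorem winShare_nonneg : 0 ≤ winShare r B b i := by
  unfold winShare; split_ifs <;> positivity

theorem winShare_le_one : winShare r B b i ≤ 1 := by
  classical
  unfold winShare
  split_ifs with h
  · have : 1 ≤ (B.filter fun j => b j = b i).card :=
      Finset.card_pos.2 ⟨i, by simp [h.1]⟩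
    rw [div_le_one (by exact_mod_cast this)]
    exact_mod_cast this
  · exact zero_le_one

theorem winShare_eq_zero_of_notMem (h : i ∉ B) : winShare r B b i = 0 :=
  if_neg fun h' => h h'.1

theorem winShare_eq_zero_of_lt (h : r < b i) : winShare r B b i = 0 :=
  if_neg fun h' => absurd h'.2.1 (not_le.2 h)

theorem winShare_eq_zero_of_mem {j : κ} (hj : j ∈ B) (h : b j < b i) : winShare r B b i = 0 :=
  if_neg fun h' => absurd (h'.2.2 j hj) (not_le.2 h)

theorem winShare_eq_one (hi : i ∈ B) (hr : b i ≤ r) (h : ∀ j ∈ B, j ≠ i → b i < b j) :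
    winShare r B b i = 1 := by
  classical
  unfold winShare
  have h1 : ∀ j ∈ B, b i ≤ b j := fun j hj => by
    by_cases hji : j = i
    · rw [hji]
    · exact (h j hj hji).le
  rw [if_pos ⟨hi, hr, h1⟩]
  have : (B.filter fun j => b j = b i) = {i} := by
    ext j
    simp only [Finset.mem_filter, Finset.mem_singleton]
    constructor
    · rintro ⟨hj, hji⟩
      by_contra hne
      exact (h j hj hne).ne' hji
    · rintro rfl; exact ⟨hi, rfl⟩
  convert (by simp : (1 : ℝ) / (({i} : Finset κ).card : ℝ) = 1)

theorem winShare_le_half {j : κ} (hj : j ∈ B) (hji : j ≠ i) (h : b j = b i) :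
    winShare r B b i ≤ 1 / 2 := by
  classical
  unfold winShare
  split_ifs with h'
  · have h2 : 2 ≤ (B.filter fun j => b j = b i).card := by
      rw [← Finset.card_pair hji]
      refine Finset.card_le_card fun k hk => ?_
      rcases Finset.mem_insert.1 hk with rfl | hk
      · simp [hj, h]
      · rw [Finset.mem_singleton] at hk; subst hk; simp [h'.1]
    have h2' : (2 : ℝ) ≤ (B.filter fun j => b j = b i).card := by exact_mod_cast h2
    exact one_div_le_one_div_of_le two_pos h2'
  · norm_num

theorem winShare_congr {b' : κ → ℝ} (h : ∀ j ∈ B, b j = b' j) :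
    winShare r B b i = winShare r B b' i := by
  classical
  by_cases hi : i ∈ B
  · unfold winShare
    have h1 : (B.filter fun j => b j = b i) = B.filter fun j => b' j = b' i :=
      Finset.filter_congr fun j hj => by rw [h j hj, h i hi]
    have h2 : (i ∈ B ∧ b i ≤ r ∧ ∀ j ∈ B, b i ≤ b j) ↔
        (i ∈ B ∧ b' i ≤ r ∧ ∀ j ∈ B, b' i ≤ b' j) := by
      rw [h i hi]
      refine and_congr_right fun _ => and_congr_right fun _ => forall₂_congr fun j hj => ?_
      rw [h j hj]
    simp only [h2]
    split_ifs
    · congr 2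
      convert congrArg Finset.card h1
    · rfl
  · rw [winShare_eq_zero_of_notMem hi, winShare_eq_zero_of_notMem hi]

theorem measurable_winShare [Finite κ] (r : ℝ) (B : Finset κ) (i : κ) :
    Measurable fun b : κ → ℝ => winShare r B b i := by
  classical
  have h : (fun b : κ → ℝ => winShare r B b i) = fun b =>
      if i ∈ B ∧ b i ≤ r ∧ ∀ j ∈ B, b i ≤ b j then
        1 / (∑ j ∈ B, if b j = b i then (1 : ℝ) else 0) else 0 := by
    funext b
    unfold winShare
    rw [Finset.sum_boole]
  rw [h]
  refine Measurable.ite ?_ ?_ measurable_const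
  · refine (MeasurableSet.const _).inter
      ((measurableSet_le (measurable_pi_apply i) measurable_const).inter ?_)
    have : {b : κ → ℝ | ∀ j ∈ B, b i ≤ b j} = ⋂ j ∈ B, {b | b i ≤ b j} := by ext; simp
    change MeasurableSet {b : κ → ℝ | ∀ j ∈ B, b i ≤ b j}
    rw [this]
    exact B.measurableSet_biInter fun j _ =>
      measurableSet_le (measurable_pi_apply i) (measurable_pi_apply j)
  · refine measurable_const.div (Finset.measurable_sum _ fun j _ => ?_)
    exact Measurable.ite (measurableSet_eq_fun (by fun_prop) (by fun_prop)) measurable_const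
      measurable_const

theorem measurable_fold_min [Finite κ] (r : ℝ) (B : Finset κ) :
    Measurable fun b : κ → ℝ => B.fold min r b := by
  classical
  induction B using Finset.induction_on with
  | empty => simp
  | insert j B hj ih =>
    simp only [Finset.fold_insert hj]
    exact (measurable_pi_apply j).min ih

theorem measurable_winPrice [Finite κ] (fmt : AuctionFormat) (r : ℝ) (B : Finset κ) (i : κ) :
    Measurable fun b : κ → ℝ => winPrice fmt r B b i := by
  classical
  cases fmt with
  | first => exact measurable_pi_apply i
  | second => exact measurable_fold_min r _

end WinShare

section Bidders

variable {N : ℕ} {R : Finset (Fin N)}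

theorem some_mem_bidders {i : Fin N} : some i ∈ bidders R ↔ i ∈ R := by
  unfold bidders
  split_ifs with h
  · simp [h]
  · simp

theorem none_mem_bidders : none ∈ bidders R ↔ R ≠ Finset.univ := by
  unfold bidders
  split_ifs with h
  · simp [h]
  · simp [h]

theorem measurable_allBids {β : ℝ → ℝ} (hβ : Measurable β) :
    Measurable fun p : (Fin N → ℝ) × ℝ => (allBids β p.2 p.1 : Option (Fin N) → ℝ) := by
  rw [measurable_pi_iff]
  rintro (_ | j)
  · exact measurable_snd
  · exact hβ.comp ((measurable_pi_apply j).comp measurable_fst)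

theorem measurable_deviationBids {β : ℝ → ℝ} (hβ : Measurable β) (i : Fin N) (x : ℝ) :
    Measurable fun p : (Fin N → ℝ) × ℝ => deviationBids β p.2 p.1 i x := by
  rw [measurable_pi_iff]
  intro o
  by_cases ho : o = some i
  · subst ho; simp [deviationBids]
  · simp only [deviationBids, Function.update_of_ne ho]
    exact (measurable_pi_apply o).comp (measurable_allBids hβ)

/-- Links ex ante and interim payoffs: fixing the value of seller `i` at `x` amounts to his bidding
`β x` against random opponents. -/
theorem allBids_update (β : ℝ → ℝ) (s : ℝ) (v : Fin N → ℝ) (i : Fin N) (x : ℝ) :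
    allBids β s (Function.update v i x) = deviationBids β s v i (β x) := by
  funext o
  rcases o with _ | j
  · simp [deviationBids, allBids]
  · by_cases hj : j = i
    · subst hj; simp [deviationBids, allBids]
    · simp [deviationBids, allBids, hj]

theorem deviationBids_self (β : ℝ → ℝ) (s : ℝ) (v : Fin N → ℝ) (i : Fin N) (x : ℝ) :
    deviationBids β s v i x (some i) = x := by
  simp [deviationBids]

theorem deviationBids_none (β : ℝ → ℝ) (s : ℝ) (v : Fin N → ℝ) (i : Fin N) (x : ℝ) :
    deviationBids β s v i x none = s := by
  simp [deviationBids, allBids]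

theorem deviationBids_of_ne (β : ℝ → ℝ) (s : ℝ) (v : Fin N → ℝ) {i j : Fin N} (x : ℝ)
    (h : j ≠ i) : deviationBids β s v i x (some j) = β (v j) := by
  simp [deviationBids, allBids, h]

end Bidders

/-! ### Integrals of bounded functions -/

theorem integrable_of_mem_Icc {α : Type*} [MeasurableSpace α] {ν : Measure α} [IsFiniteMeasure ν]
    {f : α → ℝ} (hf : Measurable f) {a b : ℝ} (h : ∀ᵐ x ∂ν, f x ∈ Set.Icc a b) :
    Integrable f ν :=
  Integrable.of_bound hf.aestronglyMeasurable (max |a| |b|)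
    (by filter_upwards [h] with x hx using abs_le_max_abs_abs hx.1 hx.2)

theorem measurable_integral_right {α : Type*} [MeasurableSpace α] {S : Measure ℝ} [SFinite S]
    {f : α × ℝ → ℝ} (hf : Measurable f) : Measurable fun v => ∫ s, f (v, s) ∂S :=
  (hf.stronglyMeasurable.integral_prod_right').measurable

theorem integral_mem_Icc {α : Type*} [MeasurableSpace α] {ν : Measure α} [IsProbabilityMeasure ν]
    {f : α → ℝ} (hf : Measurable f) {a b : ℝ} (h : ∀ᵐ x ∂ν, f x ∈ Set.Icc a b) :
    ∫ x, f x ∂ν ∈ Set.Icc a b := by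
  have hint := integrable_of_mem_Icc hf h
  constructor
  · have := integral_mono_ae (integrable_const a) hint (by filter_upwards [h] with x hx using hx.1)
    simpa using this
  · have := integral_mono_ae hint (integrable_const b) (by filter_upwards [h] with x hx using hx.2)
    simpa using this

/-! ### Bounds for winning probabilities -/

section Opponents

variable {N : ℕ} {ν : Measure ℝ} [IsProbabilityMeasure ν] {β : ℝ → ℝ} {T : Finset (Fin N)}
  {f : (Fin N → ℝ) → ℝ} {b : ℝ}

/-- The constant `a` leaves room for the speculator: it is 1 when his bid plays no role, and
otherwise the probability that he bids above `b`. -/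
theorem pow_le_integral_of_box (hβ : Measurable β) (hf : Measurable f)
    (h01 : ∀ v, f v ∈ Set.Icc (0 : ℝ) 1) {a : ℝ}
    (hbox : ∀ v, (∀ j ∈ T, b < β (v j)) → a ≤ f v) :
    ν.real {x | b < β x} ^ T.card * a ≤ ∫ v, f v ∂(Measure.pi fun _ => ν) := by
  classical
  have h1 := pi_real_box ν T fun _ => {x | b < β x}
  rw [Finset.prod_const] at h1
  rw [← h1, ← smul_eq_mul, ← setIntegral_const]
  have hm : MeasurableSet {v : Fin N → ℝ | ∀ j ∈ T, v j ∈ {x | b < β x}} := by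
    have : {v : Fin N → ℝ | ∀ j ∈ T, v j ∈ {x | b < β x}} = ⋂ j ∈ T, {v | b < β (v j)} := by
      ext; simp
    rw [this]
    exact T.measurableSet_biInter fun j _ => measurableSet_lt (by fun_prop) (by fun_prop)
  have hint : Integrable f (Measure.pi fun _ => ν) := integrable_of_mem_Icc hf (ae_of_all _ h01)
  refine (setIntegral_mono_on (integrable_const a).integrableOn hint.integrableOn hm
    fun v hv => hbox v hv).trans ?_
  exact setIntegral_le_integral hint (ae_of_all _ fun v => (h01 v).1)

/-- One opponent `j₀` is singled out. Then `f` is at most half the indicator of "all opponents bid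
at least `b`" plus half that of "moreover `j₀` bids more than `b`". This coarse treatment of ties is
enough for the undercutting arguments. -/
theorem integral_le_of_box (hβ : Measurable β) (hT : 1 ≤ T.card) (hf : Measurable f)
    (h01 : ∀ v, f v ∈ Set.Icc (0 : ℝ) 1)
    (hlose : ∀ v, ∀ j ∈ T, β (v j) < b → f v = 0)
    (htie : ∀ v, ∀ j ∈ T, β (v j) = b → f v ≤ 1 / 2) :
    ∫ v, f v ∂(Measure.pi fun _ => ν) ≤ ν.real {x | b ≤ β x} ^ (T.card - 1) *
      (ν.real {x | b < β x} + ν.real {x | β x = b} / 2) := by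
  classical
  obtain ⟨j₀, hj₀⟩ := Finset.card_pos.1 hT
  set A : Set (Fin N → ℝ) := {v | ∀ j ∈ T, v j ∈ {x | b ≤ β x}} with hA
  set A' : Set (Fin N → ℝ) :=
    {v | ∀ j ∈ T, v j ∈ if j = j₀ then {x | b < β x} else {x | b ≤ β x}} with hA'
  have hmA : MeasurableSet A := by
    have : A = ⋂ j ∈ T, {v | b ≤ β (v j)} := by ext; simp [hA]
    rw [this]
    exact T.measurableSet_biInter fun j _ => measurableSet_le (by fun_prop) (by fun_prop)
  have hmA' : MeasurableSet A' := by
    have : A' = ⋂ j ∈ T, {v | v j ∈ if j = j₀ then {x | b < β x} else {x | b ≤ β x}} := by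
      ext; simp [hA']
    rw [this]
    refine T.measurableSet_biInter fun j _ => ?_
    split_ifs
    · exact measurableSet_lt measurable_const (hβ.comp (measurable_pi_apply j))
    · exact measurableSet_le measurable_const (hβ.comp (measurable_pi_apply j))
  have h1 := pi_real_box ν T fun _ => {x | b ≤ β x}
  have h2 := pi_real_box ν T fun j => if j = j₀ then {x | b < β x} else {x | b ≤ β x}
  rw [← Finset.mul_prod_erase _ _ hj₀] at h1 h2
  rw [Finset.prod_const, Finset.card_erase_of_mem hj₀, measureReal_ge_eq_add hβ] at h1
  rw [if_pos rfl, Finset.prod_congr rfl (g := fun _ => ν.real {x | b ≤ β x})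
    (fun j hj => by rw [if_neg (Finset.ne_of_mem_erase hj)]), Finset.prod_const,
    Finset.card_erase_of_mem hj₀] at h2
  rw [measureReal_ge_eq_add hβ] at h2 ⊢
  have h3 : ∫ v, f v ∂(Measure.pi fun _ => ν) ≤
      ∫ v, (A.indicator (fun _ => (1 / 2 : ℝ)) v + A'.indicator (fun _ => (1 / 2 : ℝ)) v)
        ∂(Measure.pi fun _ => ν) := by
    refine integral_mono (integrable_of_mem_Icc hf (ae_of_all _ h01))
      (((integrable_const _).indicator hmA).add ((integrable_const _).indicator hmA'))
      fun v => ?_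
    change f v ≤ A.indicator (fun _ => (1 / 2 : ℝ)) v + A'.indicator (fun _ => (1 / 2 : ℝ)) v
    by_cases hv : ∀ j ∈ T, b ≤ β (v j)
    · have hvA : v ∈ A := hv
      rw [Set.indicator_of_mem hvA]
      by_cases h0 : β (v j₀) = b
      · have hn : 0 ≤ A'.indicator (fun _ => (1 / 2 : ℝ)) v :=
          Set.indicator_nonneg (fun _ _ => by norm_num) v
        linarith [htie v j₀ hj₀ h0]
      · have hvA' : v ∈ A' := by
          intro j hj
          split_ifs with hjj
          · subst hjj; exact lt_of_le_of_ne (hv _ hj) (Ne.symm h0)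
          · exact hv j hj
        rw [Set.indicator_of_mem hvA']
        linarith [(h01 v).2]
    · push Not at hv
      obtain ⟨j, hj, hjb⟩ := hv
      rw [hlose v j hj hjb]
      exact add_nonneg (Set.indicator_nonneg (fun _ _ => by norm_num) v)
        (Set.indicator_nonneg (fun _ _ => by norm_num) v)
  rw [integral_add ((integrable_const _).indicator hmA) ((integrable_const _).indicator hmA'),
    integral_indicator hmA, integral_indicator hmA', setIntegral_const, setIntegral_const,
    smul_eq_mul, smul_eq_mul, h1, h2] at h3
  linarith

end Opponents

/-! ### Winning probabilities in the first-price auctions -/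

namespace Profile

variable {N : ℕ} (σ : Profile N) (ν : Measure ℝ) (r : ℝ) (R : Finset (Fin N))

/-- Probability that seller `i` wins if he bids `b` and the other sellers' values have law `ν`. -/
def sellerWinProb (i : Fin N) (b : ℝ) : ℝ :=
  ∫ v, ∫ s, winShare r (bidders R) (deviationBids (σ.bid R.card) s v i b) (some i)
    ∂(σ.specBid R.card : Measure ℝ) ∂(Measure.pi fun _ => ν)

/-- Probability that the speculator wins if he bids `s` and the sellers' values have law `ν`. -/
def specWinProb (s : ℝ) : ℝ :=
  ∫ v, winShare r (bidders R) (allBids (σ.bid R.card) s v) none ∂(Measure.pi fun _ => ν)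

theorem sellerSubgamePayoff_eq (i : Fin N) (x b : ℝ) :
    σ.sellerSubgamePayoff ν r R i x b = σ.sellerWinProb ν r R i b * (b - x) := by
  simp only [sellerSubgamePayoff, sellerWinProb, integral_mul_const]

theorem specSubgamePayoff_eq (s : ℝ) :
    σ.specSubgamePayoff ν r R s = σ.specWinProb ν r R s * s := by
  simp only [specSubgamePayoff, specWinProb, integral_mul_const]

theorem measurable_share_deviation (i : Fin N) (b : ℝ) (o : Option (Fin N)) :
    Measurable fun p : (Fin N → ℝ) × ℝ =>
      winShare r (bidders R) (deviationBids (σ.bid R.card) p.2 p.1 i b) o :=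
  (measurable_winShare r (bidders R) o).comp
    (measurable_deviationBids (σ.bid_measurable _) i b)

theorem measurable_share (o : Option (Fin N)) :
    Measurable fun p : (Fin N → ℝ) × ℝ =>
      winShare r (bidders R) (allBids (σ.bid R.card) p.2 p.1) o :=
  (measurable_winShare r (bidders R) o).comp (measurable_allBids (σ.bid_measurable _))

theorem measurable_sellerShare (i : Fin N) (b : ℝ) : Measurable fun v : Fin N → ℝ =>
    ∫ s, winShare r (bidders R) (deviationBids (σ.bid R.card) s v i b) (some i)
      ∂(σ.specBid R.card : Measure ℝ) :=
  measurable_integral_right (σ.measurable_share_deviation r R i b (some i))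

theorem sellerShare_mem (i : Fin N) (b : ℝ) (v : Fin N → ℝ) :
    ∫ s, winShare r (bidders R) (deviationBids (σ.bid R.card) s v i b) (some i)
      ∂(σ.specBid R.card : Measure ℝ) ∈ Set.Icc (0 : ℝ) 1 :=
  integral_mem_Icc ((σ.measurable_share_deviation r R i b (some i)).comp
    (measurable_const.prodMk measurable_id)) (ae_of_all _ fun _ => ⟨winShare_nonneg, winShare_le_one⟩)

theorem sellerWinProb_of_lt (i : Fin N) {b : ℝ} (h : r < b) : σ.sellerWinProb ν r R i b = 0 := by
  unfold sellerWinProb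
  have : ∀ v s, winShare r (bidders R) (deviationBids (σ.bid R.card) s v i b) (some i) = 0 :=
    fun v s => winShare_eq_zero_of_lt (by rwa [deviationBids_self])
  simp [this]

theorem specWinProb_of_lt {s : ℝ} (h : r < s) : σ.specWinProb ν r R s = 0 := by
  unfold specWinProb
  have : ∀ v, winShare r (bidders R) (allBids (σ.bid R.card) s v) none = 0 :=
    fun v => winShare_eq_zero_of_lt h
  simp [this]

variable [IsProbabilityMeasure ν]

theorem sellerWinProb_mem (i : Fin N) (b : ℝ) : σ.sellerWinProb ν r R i b ∈ Set.Icc (0 : ℝ) 1 :=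
  integral_mem_Icc (σ.measurable_sellerShare r R i b) (ae_of_all _ (σ.sellerShare_mem r R i b))

theorem specWinProb_mem (s : ℝ) : σ.specWinProb ν r R s ∈ Set.Icc (0 : ℝ) 1 :=
  integral_mem_Icc ((σ.measurable_share r R none).comp (measurable_id.prodMk measurable_const))
    (ae_of_all _ fun _ => ⟨winShare_nonneg, winShare_le_one⟩)

variable {σ r R}

theorem le_sellerWinProb_univ {i : Fin N} {b : ℝ} (hb : b ≤ r) :
    ν.real {x | b < σ.bid (Finset.univ : Finset (Fin N)).card x} ^ (N - 1) ≤
      σ.sellerWinProb ν r Finset.univ i b := by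
  have h := pow_le_integral_of_box (ν := ν) (T := Finset.univ.erase i) (b := b) (a := 1)
    (σ.bid_measurable (Finset.univ : Finset (Fin N)).card)
    (σ.measurable_sellerShare r Finset.univ i b) (σ.sellerShare_mem r Finset.univ i b) ?_
  · simpa [sellerWinProb] using h
  · intro v hv
    have : ∀ s, winShare r (bidders Finset.univ)
        (deviationBids (σ.bid (Finset.univ : Finset (Fin N)).card) s v i b) (some i) = 1 := by
      intro s
      refine winShare_eq_one (some_mem_bidders.2 (Finset.mem_univ i))
        (by rwa [deviationBids_self]) ?_
      rintro (_ | j) hj hji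
      · exact absurd rfl (none_mem_bidders.1 hj)
      · have hji' : j ≠ i := fun h => hji (by rw [h])
        rw [deviationBids_self, deviationBids_of_ne _ _ _ _ hji']
        exact hv j (Finset.mem_erase.2 ⟨hji', Finset.mem_univ j⟩)
    simp only [this]; simp

theorem sellerWinProb_univ_le (hN : 2 ≤ N) {i : Fin N} {b : ℝ} :
    σ.sellerWinProb ν r Finset.univ i b ≤
      ν.real {x | b ≤ σ.bid (Finset.univ : Finset (Fin N)).card x} ^ (N - 1 - 1) *
      (ν.real {x | b < σ.bid (Finset.univ : Finset (Fin N)).card x} +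
        ν.real {x | σ.bid (Finset.univ : Finset (Fin N)).card x = b} / 2) := by
  have hcard : (Finset.univ.erase i).card = N - 1 := by simp
  rw [← hcard]
  refine integral_le_of_box (σ.bid_measurable (Finset.univ : Finset (Fin N)).card)
    (by rw [hcard]; omega) (σ.measurable_sellerShare r Finset.univ i b)
    (σ.sellerShare_mem r Finset.univ i b) ?_ ?_
  · intro v j hj hjb
    have hji := Finset.ne_of_mem_erase hj
    have : ∀ s, winShare r (bidders Finset.univ)
        (deviationBids (σ.bid (Finset.univ : Finset (Fin N)).card) s v i b) (some i) = 0 :=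
      fun s => winShare_eq_zero_of_mem (j := some j) (some_mem_bidders.2 (Finset.mem_univ j))
        (by rwa [deviationBids_self, deviationBids_of_ne _ _ _ _ hji])
    simp only [this]; simp
  · intro v j hj hjb
    have hji := Finset.ne_of_mem_erase hj
    refine (integral_mem_Icc (a := 0) ((σ.measurable_share_deviation r Finset.univ i b (some i)).comp
      (measurable_const.prodMk measurable_id)) (ae_of_all _ fun s => ⟨winShare_nonneg, ?_⟩)).2
    exact winShare_le_half (j := some j) (some_mem_bidders.2 (Finset.mem_univ j))
      (fun h => hji (Option.some.inj h))
      (by rw [deviationBids_self, deviationBids_of_ne _ _ _ _ hji, hjb])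

theorem le_sellerWinProb {i : Fin N} (hi : i ∈ R) {b : ℝ} (hb : b ≤ r) :
    ν.real {x | b < σ.bid R.card x} ^ (R.card - 1) *
      (σ.specBid R.card : Measure ℝ).real (Set.Ioi b) ≤ σ.sellerWinProb ν r R i b := by
  rw [← Finset.card_erase_of_mem hi]
  refine pow_le_integral_of_box (σ.bid_measurable R.card) (σ.measurable_sellerShare r R i b)
    (σ.sellerShare_mem r R i b) ?_
  intro v hv
  rw [← integral_indicator_one measurableSet_Ioi]
  refine integral_mono ((integrable_const _).indicator measurableSet_Ioi)
    (integrable_of_mem_Icc ((σ.measurable_share_deviation r R i b (some i)).comp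
      (measurable_const.prodMk measurable_id))
      (ae_of_all _ fun _ => ⟨winShare_nonneg, winShare_le_one⟩)) fun s => ?_
  change (Set.Ioi b).indicator 1 s ≤ _
  by_cases hs : s ∈ Set.Ioi b
  · rw [Set.indicator_of_mem hs]
    refine (winShare_eq_one (some_mem_bidders.2 hi) (by simpa [deviationBids_self] using hb) ?_).ge
    rintro (_ | j) hj hji
    · rw [deviationBids_self, deviationBids_none]; exact hs
    · have hji' : j ≠ i := fun h => hji (by rw [h])
      rw [deviationBids_self, deviationBids_of_ne _ _ _ _ hji']
      exact hv j (Finset.mem_erase.2 ⟨hji', some_mem_bidders.1 hj⟩)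
  · rw [Set.indicator_of_notMem hs]; exact winShare_nonneg

theorem sellerWinProb_le (hR : R ≠ Finset.univ) {i : Fin N} {b : ℝ} :
    σ.sellerWinProb ν r R i b ≤ (σ.specBid R.card : Measure ℝ).real (Set.Ici b) := by
  refine (integral_mem_Icc (σ.measurable_sellerShare r R i b) (a := 0) (ae_of_all _ fun v => ?_)).2
  refine ⟨(σ.sellerShare_mem r R i b v).1, ?_⟩
  rw [← integral_indicator_one measurableSet_Ici]
  refine integral_mono (integrable_of_mem_Icc ((σ.measurable_share_deviation r R i b (some i)).comp
      (measurable_const.prodMk measurable_id))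
      (ae_of_all _ fun _ => ⟨winShare_nonneg, winShare_le_one⟩))
      ((integrable_const _).indicator measurableSet_Ici) fun s => ?_
  change _ ≤ (Set.Ici b).indicator 1 s
  by_cases hs : s ∈ Set.Ici b
  · rw [Set.indicator_of_mem hs]; exact winShare_le_one
  · rw [Set.indicator_of_notMem hs]
    refine (winShare_eq_zero_of_mem (j := none) (none_mem_bidders.2 hR) ?_).le
    rw [deviationBids_self, deviationBids_none]
    exact not_le.1 hs

theorem le_specWinProb (hR : R ≠ Finset.univ) {s : ℝ} (hs : s ≤ r) :
    ν.real {x | s < σ.bid R.card x} ^ R.card ≤ σ.specWinProb ν r R s := by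
  have h := pow_le_integral_of_box (ν := ν) (T := R) (b := s) (a := 1)
    (σ.bid_measurable R.card)
    ((σ.measurable_share r R none).comp (measurable_id.prodMk (measurable_const (a := s))))
    (fun v => ⟨winShare_nonneg, winShare_le_one⟩) ?_
  · simpa [specWinProb] using h
  · intro v hv
    refine (winShare_eq_one (none_mem_bidders.2 hR) hs ?_).ge
    rintro (_ | j) hj hji
    · exact absurd rfl hji
    · exact hv j (some_mem_bidders.1 hj)

theorem specWinProb_le (hR1 : 1 ≤ R.card) {s : ℝ} :
    σ.specWinProb ν r R s ≤ ν.real {x | s ≤ σ.bid R.card x} ^ (R.card - 1) *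
      (ν.real {x | s < σ.bid R.card x} + ν.real {x | σ.bid R.card x = s} / 2) := by
  refine integral_le_of_box (σ.bid_measurable R.card) hR1
    ((σ.measurable_share r R none).comp (measurable_id.prodMk (measurable_const (a := s))))
    (fun v => ⟨winShare_nonneg, winShare_le_one⟩) ?_ ?_
  · intro v j hj hjb
    exact winShare_eq_zero_of_mem (j := some j) (some_mem_bidders.2 hj) hjb
  · intro v j hj hjb
    exact winShare_le_half (j := some j) (some_mem_bidders.2 hj) (by simp) hjb

end Profile

/-! ### Random sets of rejecting sellers -/

theorem sum_prod_ite_eq_one {ι : Type*} [Fintype ι] [DecidableEq ι] (a : ι → ℝ) (U : Finset ι) :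
    ∑ R ∈ U.powerset, ∏ j ∈ U, (if j ∈ R then 1 - a j else a j) = 1 := by
  have h := Finset.prod_add (fun j => 1 - a j) a U
  simp only [sub_add_cancel, Finset.prod_const_one] at h
  refine Eq.trans ?_ h.symm
  refine Finset.sum_congr rfl fun R hR => ?_
  rw [Finset.prod_ite]
  have hR' := Finset.mem_powerset.1 hR
  congr 1
  · rw [Finset.filter_mem_eq_inter, Finset.inter_eq_right.2 hR']
  · rw [Finset.filter_notMem_eq_sdiff]

theorem sum_filter_mem {ι : Type*} [Fintype ι] [DecidableEq ι] (i : ι) (X : Finset ι → ℝ) :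
    ∑ R ∈ Finset.univ.filter (fun R => i ∈ R), X R =
      ∑ R ∈ (Finset.univ.erase i).powerset, X (insert i R) := by
  refine Finset.sum_nbij' (fun R => R.erase i) (fun R => insert i R) ?_ ?_ ?_ ?_ ?_
  · intro R hR
    exact Finset.mem_powerset.2 (Finset.erase_subset_erase i (Finset.subset_univ R))
  · intro R hR; simp
  · intro R hR
    exact Finset.insert_erase (Finset.mem_filter.1 hR).2
  · intro R hR
    refine Finset.erase_insert fun h => ?_
    simpa using Finset.mem_powerset.1 hR h
  · intro R hR
    rw [Finset.insert_erase (Finset.mem_filter.1 hR).2]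

theorem sum_filter_notMem {ι : Type*} [Fintype ι] [DecidableEq ι] (i : ι) (X : Finset ι → ℝ) :
    ∑ R ∈ Finset.univ.filter (fun R => i ∉ R), X R =
      ∑ R ∈ (Finset.univ.erase i).powerset, X R := by
  refine Finset.sum_congr ?_ fun _ _ => rfl
  ext R
  simp only [Finset.mem_filter, Finset.mem_univ, true_and, Finset.mem_powerset]
  constructor
  · intro h j hj
    exact Finset.mem_erase.2 ⟨fun hji => h (hji ▸ hj), Finset.mem_univ j⟩
  · intro h hi
    simpa using h hi

theorem sum_filter_mem_prod_erase {ι : Type*} [Fintype ι] [DecidableEq ι] (a : ι → ℝ) (i : ι) :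
    ∑ R ∈ Finset.univ.filter (fun R : Finset ι => i ∈ R),
      ∏ j ∈ Finset.univ.erase i, (if j ∈ R then 1 - a j else a j) = 1 := by
  rw [sum_filter_mem]
  refine Eq.trans ?_ (sum_prod_ite_eq_one a (Finset.univ.erase i))
  refine Finset.sum_congr rfl fun R _ => Finset.prod_congr rfl fun j hj => ?_
  simp [Finset.ne_of_mem_erase hj]

theorem sum_filter_notMem_prod_erase {ι : Type*} [Fintype ι] [DecidableEq ι] (a : ι → ℝ) (i : ι) :
    ∑ R ∈ Finset.univ.filter (fun R : Finset ι => i ∉ R),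
      ∏ j ∈ Finset.univ.erase i, (if j ∈ R then 1 - a j else a j) = 1 := by
  rw [sum_filter_notMem, sum_prod_ite_eq_one]

/-- The expected number of acceptances, by linearity of expectation. -/
theorem sum_prod_ite_mul_card_compl {ι : Type*} [Fintype ι] [DecidableEq ι] (a : ι → ℝ) :
    ∑ R : Finset ι, (∏ j, if j ∈ R then 1 - a j else a j) * ((Rᶜ).card : ℝ) = ∑ j, a j := by
  have h : ∀ R : Finset ι, ((Rᶜ).card : ℝ) = ∑ i, if i ∉ R then 1 else 0 := by
    intro R
    rw [Finset.sum_boole]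
    congr 2
    ext; simp
  simp_rw [h, Finset.mul_sum]
  rw [Finset.sum_comm]
  refine Finset.sum_congr rfl fun i _ => ?_
  simp_rw [mul_ite, mul_one, mul_zero]
  rw [← Finset.sum_filter]
  have : ∀ R ∈ (Finset.univ : Finset (Finset ι)).filter (fun R => i ∉ R),
      ∏ j, (if j ∈ R then 1 - a j else a j) =
      a i * ∏ j ∈ Finset.univ.erase i, (if j ∈ R then 1 - a j else a j) := by
    intro R hR
    rw [← Finset.mul_prod_erase _ _ (Finset.mem_univ i), if_neg (Finset.mem_filter.1 hR).2]
  rw [Finset.sum_congr rfl this, ← Finset.mul_sum, sum_filter_notMem_prod_erase, mul_one]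

/-! ### Payoffs in the first-price speculation game -/

section Weights

variable {N : ℕ} {μ ν : Measure ℝ} [IsProbabilityMeasure μ] [IsProbabilityMeasure ν] {a : ℝ → ℝ}
  {q : ℝ}

theorem integral_compl_eq (ham : Measurable a) (ha01 : ∀ x, a x ∈ Set.Icc (0 : ℝ) 1)
    (hq : q = ∫ x, (1 - a x) ∂μ) : ∫ x, a x ∂μ = 1 - q := by
  have hint : Integrable a μ := integrable_of_mem_Icc ham (ae_of_all _ ha01)
  rw [hq, integral_sub (integrable_const 1) hint]
  simp

theorem integral_compl_mem (ham : Measurable a) (ha01 : ∀ x, a x ∈ Set.Icc (0 : ℝ) 1)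
    (hq : q = ∫ x, (1 - a x) ∂μ) : q ∈ Set.Icc (0 : ℝ) 1 := by
  rw [hq]
  exact integral_mem_Icc (by fun_prop) (ae_of_all _ fun x => by
    have := ha01 x
    constructor <;> linarith [this.1, this.2])

/-- Bayes' rule for a rejecting seller `i`: given that `R` is the set of rejecting sellers, the
values of the others in `R` are i.i.d. with the belief law `ν`. Seller `i` carries no weight since
his own rejection is taken for granted. The identity also covers `q = 0`, where `ν` is arbitrary. -/
theorem integral_reject_weights_erase (ham : Measurable a)
    (ha01 : ∀ x, a x ∈ Set.Icc (0 : ℝ) 1) (hq : q = ∫ x, (1 - a x) ∂μ)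
    (hν : ENNReal.ofReal q • ν = μ.withDensity fun x => ENNReal.ofReal (1 - a x))
    (R : Finset (Fin N)) {i : Fin N} (hi : i ∈ R) (f : (Fin N → ℝ) → ℝ)
    (hf : ∀ v v', (∀ j ∈ R.erase i, v j = v' j) → f v = f v') :
    ∫ v, (∏ j ∈ Finset.univ.erase i, if j ∈ R then 1 - a (v j) else a (v j)) * f v
      ∂(Measure.pi fun _ => μ) =
      q ^ (R.card - 1) * (1 - q) ^ (N - R.card) * ∫ v, f v ∂(Measure.pi fun _ => ν) := by
  have h := integral_prod_weights_mul μ ν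
    (fun j x => if j = i then 1 else if j ∈ R then 1 - a x else a x) (R.erase i)
    (fun x => 1 - a x) (by fun_prop)
    (fun x => by have := ha01 x; constructor <;> linarith [this.1, this.2]) (fun j hj => by
      funext x
      rw [if_neg (Finset.ne_of_mem_erase hj), if_pos (Finset.mem_of_mem_erase hj)])
    q (integral_compl_mem ham ha01 hq).1 hν f hf
  have hcompl : (R.erase i)ᶜ = insert i Rᶜ := by
    ext j
    simp only [Finset.mem_compl, Finset.mem_erase, Finset.mem_insert]
    tauto
  rw [hcompl, Finset.prod_insert (by simpa using hi), Finset.prod_congr rfl (g := fun _ => 1 - q)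
    (s₂ := Rᶜ) ?_, Finset.prod_const, Finset.card_compl, Fintype.card_fin,
    Finset.card_erase_of_mem hi] at h
  · simp only [if_true, integral_const, probReal_univ, smul_eq_mul, mul_one, one_mul] at h
    rw [← h]
    refine integral_congr_ae (ae_of_all _ fun v => ?_)
    simp only
    congr 1
    rw [← Finset.mul_prod_erase Finset.univ _ (Finset.mem_univ i), if_pos rfl, one_mul]
    exact Finset.prod_congr rfl fun j hj => by rw [if_neg (Finset.ne_of_mem_erase hj)]
  · intro j hj
    have hj' : j ∉ R := Finset.mem_compl.1 hj
    have hji : j ≠ i := fun h => hj' (h ▸ hi)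
    simp only [if_neg hji, if_neg hj']
    exact integral_compl_eq ham ha01 hq

theorem integral_reject_weights (ham : Measurable a)
    (ha01 : ∀ x, a x ∈ Set.Icc (0 : ℝ) 1) (hq : q = ∫ x, (1 - a x) ∂μ)
    (hν : ENNReal.ofReal q • ν = μ.withDensity fun x => ENNReal.ofReal (1 - a x))
    (R : Finset (Fin N)) (f : (Fin N → ℝ) → ℝ)
    (hf : ∀ v v', (∀ j ∈ R, v j = v' j) → f v = f v') :
    ∫ v, (∏ j, if j ∈ R then 1 - a (v j) else a (v j)) * f v ∂(Measure.pi fun _ => μ) =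
      q ^ R.card * (1 - q) ^ (N - R.card) * ∫ v, f v ∂(Measure.pi fun _ => ν) := by
  have h := integral_prod_weights_mul μ ν
    (fun j x => if j ∈ R then 1 - a x else a x) R
    (fun x => 1 - a x) (by fun_prop)
    (fun x => by have := ha01 x; constructor <;> linarith [this.1, this.2]) (fun j hj => by
      funext x
      rw [if_pos hj])
    q (integral_compl_mem ham ha01 hq).1 hν f hf
  rw [Finset.prod_congr rfl (g := fun _ => 1 - q) (s₂ := Rᶜ) ?_, Finset.prod_const,
    Finset.card_compl, Fintype.card_fin] at h
  · exact h
  · intro j hj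
    simp only [if_neg (Finset.mem_compl.1 hj)]
    exact integral_compl_eq ham ha01 hq

theorem prod_weights_mem (ha01 : ∀ x, a x ∈ Set.Icc (0 : ℝ) 1) (R U : Finset (Fin N))
    (v : Fin N → ℝ) :
    (∏ j ∈ U, if j ∈ R then 1 - a (v j) else a (v j)) ∈ Set.Icc (0 : ℝ) 1 := by
  have h : ∀ j, (if j ∈ R then 1 - a (v j) else a (v j)) ∈ Set.Icc (0 : ℝ) 1 := by
    intro j
    have := ha01 (v j)
    split_ifs
    · constructor <;> linarith [this.1, this.2]
    · exact this
  exact ⟨Finset.prod_nonneg fun j _ => (h j).1,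
    Finset.prod_le_one (fun j _ => (h j).1) fun j _ => (h j).2⟩

theorem measurable_prod_weights (ham : Measurable a) (R U : Finset (Fin N)) :
    Measurable fun v : Fin N → ℝ => ∏ j ∈ U, if j ∈ R then 1 - a (v j) else a (v j) := by
  refine Finset.measurable_prod _ fun j _ => ?_
  split_ifs
  · exact measurable_const.sub (ham.comp (measurable_pi_apply j))
  · exact ham.comp (measurable_pi_apply j)

end Weights

namespace Profile

variable {N : ℕ} {σ : Profile N} {μ : Measure ℝ} [IsProbabilityMeasure μ] {r p q : ℝ} {a : ℝ → ℝ}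
  {ν : ℕ → ProbabilityMeasure ℝ}

/-- Separates the payoff from rejecting into the auctions that may follow, so that optimality in the
subgames becomes available for the acceptance decision. -/
theorem rejectPayoff_first (ha : ∀ i, σ.accept i = a) (hq : q = ∫ x, (1 - a x) ∂μ)
    (ham : Measurable a) (ha01 : ∀ x, a x ∈ Set.Icc (0 : ℝ) 1)
    (hν : ∀ m, ENNReal.ofReal q • (ν m : Measure ℝ) =
      μ.withDensity fun x => ENNReal.ofReal (1 - a x)) (i : Fin N) (x : ℝ) (c : ℕ → ℝ) :
    σ.rejectPayoff μ .first r i x c = ∑ R ∈ Finset.univ.filter (fun R : Finset (Fin N) => i ∈ R),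
      q ^ (R.card - 1) * (1 - q) ^ (N - R.card) *
        (σ.sellerWinProb (ν R.card) r R i (c R.card) * (c R.card - x)) := by
  unfold rejectPayoff
  simp only [ha, winPrice, deviationBids_self, integral_mul_const]
  rw [integral_finsetSum]
  · refine Finset.sum_congr rfl fun R hR => ?_
    have hi := (Finset.mem_filter.1 hR).2
    rw [integral_reject_weights_erase ham ha01 hq (hν R.card) R hi, integral_mul_const]
    · rfl
    · intro v v' hv
      congr 1
      refine integral_congr_ae (ae_of_all _ fun s => winShare_congr ?_)
      rintro (_ | j) hj
      · rw [deviationBids_none, deviationBids_none]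
      · by_cases hji : j = i
        · subst hji; rw [deviationBids_self, deviationBids_self]
        · rw [deviationBids_of_ne _ _ _ _ hji, deviationBids_of_ne _ _ _ _ hji,
            hv j (Finset.mem_erase.2 ⟨hji, some_mem_bidders.1 hj⟩)]
  · intro R _
    have h1 := σ.sellerShare_mem r R i (c R.card)
    have h2 := fun v => prod_weights_mem ha01 R (Finset.univ.erase i) v
    simp_rw [← mul_assoc]
    refine Integrable.mul_const (integrable_of_mem_Icc (a := 0) (b := 1)
      ((measurable_prod_weights ham R _).mul (σ.measurable_sellerShare r R i _))
      (ae_of_all _ fun v => ⟨mul_nonneg (h2 v).1 (h1 v).1, mul_le_one₀ (h2 v).2 (h1 v).1 (h1 v).2⟩)) _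

theorem speculatorPayoff_first_le (ha : ∀ i, σ.accept i = a) (hq : q = ∫ x, (1 - a x) ∂μ)
    (ham : Measurable a) (ha01 : ∀ x, a x ∈ Set.Icc (0 : ℝ) 1)
    (hν : ∀ m, ENNReal.ofReal q • (ν m : Measure ℝ) =
      μ.withDensity fun x => ENNReal.ofReal (1 - a x))
    (hspec : ∀ m, (σ.specBid m : Measure ℝ) (Set.Iio 0) = 0) (hr : 0 ≤ r) (L : ℕ → ℝ)
    (hL : ∀ R : Finset (Fin N), R ≠ Finset.univ → ∀ᵐ s ∂(σ.specBid R.card : Measure ℝ),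
      σ.specWinProb (ν R.card) r R s * s ≤ L R.card) :
    σ.speculatorPayoff μ .first r p ≤
      ∑ m ∈ Finset.range N, (N.choose m : ℝ) * (q ^ m * (1 - q) ^ (N - m) * L m) -
        p * (N * (1 - q)) := by
  have hq01 := integral_compl_mem ham ha01 hq
  have hmem : ∀ (R : Finset (Fin N)) v, ∀ᵐ s ∂(σ.specBid R.card : Measure ℝ),
      winShare r (bidders R) (allBids (σ.bid R.card) s v) none * s ∈ Set.Icc 0 r := by
    intro R v
    have h0 : ∀ᵐ s ∂(σ.specBid R.card : Measure ℝ), 0 ≤ s := by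
      rw [ae_iff]; simp only [not_le]; exact hspec _
    filter_upwards [h0] with s hs
    refine ⟨mul_nonneg winShare_nonneg hs, ?_⟩
    rcases le_or_gt s r with h | h
    · exact (mul_le_of_le_one_left hs winShare_le_one).trans h
    · rw [winShare_eq_zero_of_lt (i := none) (by exact h), zero_mul]; exact hr
  have hmeas : ∀ R : Finset (Fin N), Measurable fun p : (Fin N → ℝ) × ℝ =>
      winShare r (bidders R) (allBids (σ.bid R.card) p.2 p.1) none * p.2 := fun R =>
    (σ.measurable_share r R none).mul measurable_snd
  set g : Finset (Fin N) → (Fin N → ℝ) → ℝ := fun R v =>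
    ∫ s, winShare r (bidders R) (allBids (σ.bid R.card) s v) none * s
      ∂(σ.specBid R.card : Measure ℝ) with hg
  have hgm : ∀ R, Measurable (g R) := fun R => measurable_integral_right (hmeas R)
  have hg01 : ∀ R v, g R v ∈ Set.Icc 0 r := fun R v =>
    integral_mem_Icc ((hmeas R).comp (measurable_const.prodMk measurable_id)) (hmem R v)
  have hinner : ∀ (R : Finset (Fin N)) v, ∫ s, (winShare r (bidders R)
      (allBids (σ.bid R.card) s v) none * s - p * ((Rᶜ).card : ℝ))
      ∂(σ.specBid R.card : Measure ℝ) = g R v - p * ((Rᶜ).card : ℝ) := by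
    intro R v
    have h1 : Integrable (fun s => winShare r (bidders R) (allBids (σ.bid R.card) s v) none * s)
        (σ.specBid R.card : Measure ℝ) := integrable_of_mem_Icc ((hmeas R).comp
      (measurable_const.prodMk measurable_id)) (hmem R v)
    rw [integral_sub h1 (integrable_const _)]
    simp [hg]
  have hw := fun (R : Finset (Fin N)) v => prod_weights_mem ha01 R Finset.univ v
  have hwint : ∀ R, Integrable (fun v : Fin N → ℝ =>
      (∏ j, if j ∈ R then 1 - a (v j) else a (v j)) * g R v) (Measure.pi fun _ => μ) := fun R =>
    integrable_of_mem_Icc (a := 0) (b := r) ((measurable_prod_weights ham R _).mul (hgm R))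
      (ae_of_all _ fun v => ⟨mul_nonneg (hw R v).1 (hg01 R v).1,
        (mul_le_of_le_one_left (hg01 R v).1 (hw R v).2).trans (hg01 R v).2⟩)
  have hexp : σ.speculatorPayoff μ .first r p =
      ∫ v, ((∑ R, (∏ j, if j ∈ R then 1 - a (v j) else a (v j)) * g R v) -
        p * ∑ j, a (v j)) ∂(Measure.pi fun _ => μ) := by
    unfold speculatorPayoff expect share price
    refine integral_congr_ae (ae_of_all _ fun v => ?_)
    simp only [ha, winPrice, allBids]
    simp_rw [← sum_prod_ite_mul_card_compl (fun j => a (v j)), Finset.mul_sum,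
      ← Finset.sum_sub_distrib]
    refine Finset.sum_congr rfl fun R _ => ?_
    rw [hinner R v]
    ring
  have hga : ∀ j : Fin N, Integrable (fun v : Fin N → ℝ => a (v j)) (Measure.pi fun _ => μ) :=
    fun j => integrable_of_mem_Icc (ham.comp (measurable_pi_apply j))
      (ae_of_all _ fun v => ha01 (v j))
  have hea : ∀ j : Fin N, ∫ v, a (v j) ∂(Measure.pi fun _ : Fin N => μ) = 1 - q := by
    intro j
    rw [← integral_compl_eq ham ha01 hq]
    exact integral_comp_eval (μ := fun _ : Fin N => μ) (i := j) ham.aestronglyMeasurable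
  rw [hexp, integral_sub (integrable_finsetSum _ fun R _ => hwint R)
    ((integrable_finsetSum _ fun j _ => hga j).const_mul p), integral_const_mul,
    integral_finsetSum _ (fun j _ => hga j), integral_finsetSum _ (fun R _ => hwint R)]
  simp only [hea, Finset.sum_const, Finset.card_univ, Fintype.card_fin, nsmul_eq_mul]
  refine sub_le_sub_right ?_ _
  -- When all `N` sellers reject, the speculator is absent and earns nothing.
  set L' : ℕ → ℝ := fun m => if m = N then 0 else L m with hL'
  have hterm : ∀ R : Finset (Fin N), ∫ v, (∏ j, if j ∈ R then 1 - a (v j) else a (v j)) * g R v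
      ∂(Measure.pi fun _ => μ) ≤ q ^ R.card * (1 - q) ^ (N - R.card) * L' R.card := by
    intro R
    rw [integral_reject_weights ham ha01 hq (hν R.card) R]
    · refine mul_le_mul_of_nonneg_left ?_
        (mul_nonneg (pow_nonneg hq01.1 _) (pow_nonneg (by linarith [hq01.2]) _))
      by_cases hR : R = Finset.univ
      · have : ∀ v, g R v = 0 := by
          intro v
          have hn : none ∉ bidders R := fun h => none_mem_bidders.1 h hR
          simp [hg, winShare_eq_zero_of_notMem hn]
        simp only [this]; simp [hL', hR]
      · have hcard : R.card ≠ N := by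
          intro h
          exact hR (Finset.eq_univ_of_card R (by simpa using h))
        simp only [hL', if_neg hcard]
        have hint : Integrable (fun p : (Fin N → ℝ) × ℝ =>
            winShare r (bidders R) (allBids (σ.bid R.card) p.2 p.1) none * p.2)
            ((Measure.pi fun _ => (ν R.card : Measure ℝ)).prod (σ.specBid R.card : Measure ℝ)) := by
          refine integrable_of_mem_Icc (a := 0) (b := r) (hmeas R) ?_
          refine Measure.ae_prod_mem_iff_ae_ae_mem ?_ |>.2 ?_
          · exact (hmeas R) measurableSet_Icc
          · exact ae_of_all _ fun v => hmem R v
        rw [hg]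
        -- The speculator's bid has to be the outer variable, because `hL` holds for almost every
        -- bid and concerns the average over values.
        rw [integral_integral_swap hint]
        have h1 : ∀ s, ∫ v, winShare r (bidders R) (allBids (σ.bid R.card) s v) none * s
            ∂(Measure.pi fun _ => (ν R.card : Measure ℝ)) =
            σ.specWinProb (ν R.card) r R s * s := fun s => by
          rw [integral_mul_const]; rfl
        simp_rw [h1]
        have h2 := hint.integral_prod_right
        simp only [h1] at h2
        have h3 := integral_mono_ae h2 (integrable_const (L R.card)) (hL R hR)
        simpa using h3
    · intro v v' hv
      simp only [hg]
      refine integral_congr_ae (ae_of_all _ fun s => ?_)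
      simp only
      congr 1
      refine winShare_congr ?_
      rintro (_ | j) hj
      · rfl
      · simp only [allBids]; rw [hv j (some_mem_bidders.1 hj)]
  refine (Finset.sum_le_sum fun R _ => hterm R).trans (le_of_eq ?_)
  have h := Finset.sum_powerset_apply_card
    (fun m => q ^ m * (1 - q) ^ (N - m) * L' m) (x := (Finset.univ : Finset (Fin N)))
  rw [Finset.powerset_univ, Finset.card_univ, Fintype.card_fin, Finset.sum_range_succ] at h
  rw [h]
  simp only [hL', if_true, mul_zero, smul_zero, add_zero, nsmul_eq_mul]
  refine Finset.sum_congr rfl fun m hm => ?_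
  rw [if_neg (Finset.mem_range.1 hm).ne]

end Profile

/-! ### Cutoff structure of the acceptance decision in the first-price game -/

/-- The levels `b` for which `{β ≤ b}` is null form a lower set `Z`. Each point of `Z` has a null
neighbourhood relative to `Z`, either because `Z` contains a larger level or because the point is
its maximum. So `Z` is null for the law of `β`, and `D` lies in its preimage. -/
theorem measure_eq_zero_of_forall_le_null {ν : Measure ℝ} {β : ℝ → ℝ} (hβ : Measurable β)
    {D : Set ℝ} (h : ∀ x ∈ D, ν {y | β y ≤ β x} = 0) : ν D = 0 := by
  set Z : Set ℝ := {b | ν {y | β y ≤ b} = 0} with hZ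
  have hlower : ∀ b ∈ Z, ∀ b' ≤ b, b' ∈ Z := fun b hb b' hbb =>
    measure_mono_null (fun y (hy : β y ≤ b') => show β y ≤ b from le_trans hy hbb) hb
  have hmeas : MeasurableSet Z :=
    (show IsLowerSet Z from fun b b' hbb hb => hlower b hb b' hbb).ordConnected.measurableSet
  have hZ0 : (ν.map β) Z = 0 := by
    refine measure_null_of_locally_null Z fun b hb => ?_
    have hIic : ∀ b ∈ Z, (ν.map β) (Set.Iic b) = 0 := fun b hb => by
      rw [Measure.map_apply hβ measurableSet_Iic]; exact hb
    by_cases hmax : ∃ b' ∈ Z, b < b'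
    · obtain ⟨b', hb', hlt⟩ := hmax
      exact ⟨Set.Iic b', mem_nhdsWithin_of_mem_nhds (Iic_mem_nhds hlt), hIic b' hb'⟩
    · push Not at hmax
      exact ⟨Set.Iic b, Filter.mem_of_superset self_mem_nhdsWithin hmax, hIic b hb⟩
  rw [Measure.map_apply hβ hmeas] at hZ0
  exact measure_mono_null (fun x hx => h x hx) hZ0

theorem sum_binomial_weights {N : ℕ} (q : ℝ) (i : Fin N) :
    ∑ R ∈ Finset.univ.filter (fun R : Finset (Fin N) => i ∈ R),
      q ^ (R.card - 1) * (1 - q) ^ (N - R.card) = 1 := by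
  refine Eq.trans ?_ (sum_filter_mem_prod_erase (fun _ => 1 - q) i)
  refine Finset.sum_congr rfl fun R hR => ?_
  have hi := (Finset.mem_filter.1 hR).2
  rw [Finset.prod_ite, Finset.prod_const, Finset.prod_const, sub_sub_cancel]
  have h1 : (Finset.univ.erase i).filter (fun j => j ∈ R) = R.erase i := by
    ext j; simp
  have h2 : (Finset.univ.erase i).filter (fun j => j ∉ R) = Rᶜ := by
    ext j
    simp only [Finset.mem_filter, Finset.mem_erase, Finset.mem_univ, and_true, Finset.mem_compl,
      and_iff_right_iff_imp]
    exact fun hj h => hj (h ▸ hi)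
  rw [h1, h2, Finset.card_erase_of_mem hi, Finset.card_compl, Fintype.card_fin]

theorem sum_filter_mem_card {N : ℕ} (i : Fin N) (φ : ℕ → ℝ) :
    ∑ R ∈ Finset.univ.filter (fun R : Finset (Fin N) => i ∈ R), φ R.card =
      ∑ m ∈ Finset.range N, ((N - 1).choose m : ℝ) * φ (m + 1) := by
  rw [sum_filter_mem]
  have h : ∀ R ∈ (Finset.univ.erase i).powerset, φ (insert i R).card = φ (R.card + 1) := by
    intro R hR
    rw [Finset.card_insert_of_notMem]
    intro h
    simpa using Finset.mem_powerset.1 hR h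
  have hN : 1 ≤ N := i.pos
  rw [Finset.sum_congr rfl h, Finset.sum_powerset_apply_card (fun m => φ (m + 1)),
    Finset.card_erase_of_mem (Finset.mem_univ i), Finset.card_univ, Fintype.card_fin,
    Nat.sub_add_cancel hN]
  simp only [nsmul_eq_mul]

theorem IsValueDistribution.nullSingletonClass {μ : Measure ℝ} (hμ : IsValueDistribution μ) :
    NullSingletonClass μ :=
  ⟨fun _ => hμ.hasDensity (measure_singleton _)⟩

theorem IsValueDistribution.ae_mem {μ : Measure ℝ} (hμ : IsValueDistribution μ) :
    ∀ᵐ x ∂μ, x ∈ Set.Ioo (0 : ℝ) 1 := by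
  have := hμ.isProbabilityMeasure
  have := hμ.nullSingletonClass
  have h : ∀ᵐ x ∂μ, x ∈ Set.Icc (0 : ℝ) 1 :=
    (mem_ae_iff_prob_eq_one measurableSet_Icc).2 hμ.support
  filter_upwards [h, Measure.ae_ne μ 0, Measure.ae_ne μ 1] with x hx h0 h1
  exact ⟨lt_of_le_of_ne hx.1 (Ne.symm h0), lt_of_le_of_ne hx.2 h1⟩

namespace Profile

variable {N : ℕ} {σ : Profile N} {μ : Measure ℝ} {r p q : ℝ}

/-- With bids held fixed, the payoff is affine in the value, with slope minus the overall winning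
probability. This is the single-crossing property behind the cutoff. -/
theorem rejectPayoff_first_add {a : ℝ → ℝ} {ν : ℕ → ProbabilityMeasure ℝ}
    [IsProbabilityMeasure μ] (ha : ∀ i, σ.accept i = a) (hq : q = ∫ x, (1 - a x) ∂μ)
    (ham : Measurable a) (ha01 : ∀ x, a x ∈ Set.Icc (0 : ℝ) 1)
    (hν : ∀ m, ENNReal.ofReal q • (ν m : Measure ℝ) =
      μ.withDensity fun x => ENNReal.ofReal (1 - a x)) (i : Fin N) (x y : ℝ) (c : ℕ → ℝ) :
    σ.rejectPayoff μ .first r i x c = σ.rejectPayoff μ .first r i y c +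
      (y - x) * ∑ R ∈ Finset.univ.filter (fun R : Finset (Fin N) => i ∈ R),
      q ^ (R.card - 1) * (1 - q) ^ (N - R.card) *
        σ.sellerWinProb (ν R.card) r R i (c R.card) := by
  rw [rejectPayoff_first ha hq ham ha01 hν, rejectPayoff_first ha hq ham ha01 hν, Finset.mul_sum,
    ← Finset.sum_add_distrib]
  exact Finset.sum_congr rfl fun R _ => by ring

/-- The cutoff is the supremum of the types that cannot gain from rejecting, or 0 if there is none.
By the slope bound every lower type cannot gain either. A lower type that nevertheless rejects with
positive probability must win for sure in every auction that has positive weight, in particular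
against `N - 1` sellers; then almost no rejecting type bids as low, and such types form a null set.
-/
theorem IsFPAContinuation.exists_cutoff (hN : 2 ≤ N) (hμ : IsValueDistribution μ)
    (hp : 0 ≤ p) (h : σ.IsFPAContinuation μ r p) :
    ∃ c ∈ Set.Icc 0 p, (∀ i, ∀ x ∈ Set.Ioc c 1, σ.accept i x = 0) ∧
      (∀ i, ∀ᵐ x ∂μ, x < c → σ.accept i x = 1) ∧
      ∀ i, ∀ x ∈ Set.Ico 0 c, ∀ b : ℕ → ℝ, σ.rejectPayoff μ .first r i x b ≤ p - x := by
  have := hμ.isProbabilityMeasure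
  obtain ⟨ν, -, hν, -, -⟩ := h.biddingRational
  set i₀ : Fin N := ⟨0, by omega⟩
  set a := σ.accept i₀ with ha'
  have ha : ∀ i, σ.accept i = a := fun i => h.symmetric i i₀
  have ham : Measurable a := σ.accept_measurable i₀
  have ha01 : ∀ x, a x ∈ Set.Icc (0 : ℝ) 1 := σ.accept_mem i₀
  obtain ⟨q, hq⟩ : ∃ q, q = ∫ x, (1 - a x) ∂μ := ⟨_, rfl⟩
  have h1a : ∀ x, 1 - a x ∈ Set.Icc (0 : ℝ) 1 := fun x =>
    ⟨by linarith [(ha01 x).2], by linarith [(ha01 x).1]⟩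
  have h1int : Integrable (fun x => 1 - a x) μ :=
    integrable_of_mem_Icc (by fun_prop) (ae_of_all _ h1a)
  have hν' : ∀ m, ENNReal.ofReal q • (ν m : Measure ℝ) =
      μ.withDensity fun x => ENNReal.ofReal (1 - a x) := by
    intro m
    rw [hq, ofReal_integral_eq_lintegral_ofReal h1int (ae_of_all _ fun x => (h1a x).1)]
    exact hν m i₀
  have hq01 := integral_compl_mem ham ha01 hq
  have hadd := fun i x y c => rejectPayoff_first_add (r := r) ha hq ham ha01 hν' i x y c
  set w : Finset (Fin N) → ℝ := fun R => q ^ (R.card - 1) * (1 - q) ^ (N - R.card) with hw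
  have hw0 : ∀ R, 0 ≤ w R := fun R =>
    mul_nonneg (pow_nonneg hq01.1 _) (pow_nonneg (by linarith [hq01.2]) _)
  have hw1 := fun i : Fin N => sum_binomial_weights q i
  have hK := fun (i : Fin N) (c : ℕ → ℝ) (R : Finset (Fin N)) =>
    σ.sellerWinProb_mem (ν R.card) r R i (c R.card)
  have hsum1 : ∀ (i : Fin N) (c : ℕ → ℝ),
      ∑ R ∈ Finset.univ.filter (fun R : Finset (Fin N) => i ∈ R),
        w R * σ.sellerWinProb (ν R.card) r R i (c R.card) ≤ 1 := by
    intro i c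
    rw [← hw1 i]
    exact Finset.sum_le_sum fun R _ => mul_le_of_le_one_right (hw0 R) (hK i c R).2
  set A : Set ℝ := {x | x ∈ Set.Icc (0 : ℝ) 1 ∧
    ∀ i, ∀ b : ℕ → ℝ, σ.rejectPayoff μ .first r i x b ≤ p - x} with hA
  have hacc : ∀ i, ∀ x ∈ Set.Icc (0 : ℝ) 1, 0 < a x → ∀ b : ℕ → ℝ,
      σ.rejectPayoff μ .first r i x b ≤ p - x := by
    intro i x hx hax
    exact h.acceptanceRational.accept i x hx (by rw [ha]; exact hax)
  have hAp : ∀ x ∈ A, x ≤ p := by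
    intro x hx
    -- A bid above the reserve price never wins, so rejecting is worth at least 0.
    have h1 := hx.2 i₀ (fun _ => r + 1)
    rw [rejectPayoff_first ha hq ham ha01 hν'] at h1
    simp only [sellerWinProb_of_lt σ _ r _ _ (lt_add_one r), zero_mul, mul_zero,
      Finset.sum_const_zero] at h1
    linarith
  have hae := hμ.ae_mem
  rcases A.eq_empty_or_nonempty with hAe | hAne
  · refine ⟨0, ⟨le_rfl, hp⟩, fun i x hx => ?_, fun i => ?_, fun i x hx => ?_⟩
    · rw [ha]
      by_contra hne
      have hpos : 0 < a x := lt_of_le_of_ne (ha01 x).1 (Ne.symm hne)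
      have hx' : x ∈ Set.Icc (0 : ℝ) 1 := ⟨hx.1.le, hx.2⟩
      have : x ∈ A := ⟨hx', fun i => hacc i x hx' hpos⟩
      rw [hAe] at this
      exact this
    · filter_upwards [hae] with x hx hx0
      linarith [hx.1]
    · linarith [hx.1, hx.2]
  · have hbdd : BddAbove A := ⟨p, hAp⟩
    set c := sSup A with hc
    have hcp : c ≤ p := csSup_le hAne hAp
    have hc0 : 0 ≤ c := by
      obtain ⟨x, hx⟩ := hAne
      exact hx.1.1.trans (le_csSup hbdd hx)
    have hbelow : ∀ i, ∀ x, x < c → ∀ b : ℕ → ℝ, σ.rejectPayoff μ .first r i x b ≤ p - x := by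
      intro i x hx b
      obtain ⟨y, hy, hxy⟩ := exists_lt_of_lt_csSup hAne hx
      have h1 := hy.2 i b
      have h2 := mul_le_of_le_one_right (sub_nonneg.2 hxy.le) (hsum1 i b)
      rw [hadd i x y b]
      linarith
    refine ⟨c, ⟨hc0, hcp⟩, fun i x hx => ?_, fun i => ?_, fun i x hx => hbelow i x hx.2⟩
    · rw [ha]
      by_contra hne
      have hpos : 0 < a x := lt_of_le_of_ne (ha01 x).1 (Ne.symm hne)
      have hx' : x ∈ Set.Icc (0 : ℝ) 1 := ⟨hc0.trans hx.1.le, hx.2⟩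
      have : x ∈ A := ⟨hx', fun i => hacc i x hx' hpos⟩
      exact absurd (le_csSup hbdd this) (not_le.2 hx.1)
    · rw [ha]
      -- If rejection has probability 0, beliefs are unrestricted, but almost every type accepts
      -- anyway.
      rcases hq01.1.eq_or_lt with hq0 | hqpos
      · have h1 : (fun x => 1 - a x) =ᵐ[μ] 0 :=
          (integral_eq_zero_iff_of_nonneg (fun x => (h1a x).1) h1int).1 (by rw [← hq, ← hq0])
        filter_upwards [h1] with x hx _
        have : 1 - a x = 0 := hx
        linarith
      · set D : Set ℝ := {x | x ∈ Set.Ico 0 c ∧ a x < 1} with hD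
        have hDnull : ∀ x ∈ D, (ν (Finset.univ : Finset (Fin N)).card : Measure ℝ)
            {y | σ.bid (Finset.univ : Finset (Fin N)).card y ≤
              σ.bid (Finset.univ : Finset (Fin N)).card x} = 0 := by
          rintro x ⟨⟨hx0, hxc⟩, hax⟩
          set β := σ.bid (Finset.univ : Finset (Fin N)).card with hβ
          set νN := (ν (Finset.univ : Finset (Fin N)).card : Measure ℝ) with hνN
          have hx1 : x ∈ Set.Icc (0 : ℝ) 1 := by
            refine ⟨hx0, ?_⟩
            obtain ⟨y, hy, hxy⟩ := exists_lt_of_lt_csSup hAne hxc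
            exact hxy.le.trans hy.1.2
          have h1 := h.acceptanceRational.reject i₀ x hx1 hax
          have h2 := hbelow i₀ ((x + c) / 2) (by linarith) (fun m => σ.bid m x)
          rw [hadd i₀ x ((x + c) / 2)] at h1
          -- With the bids of type `x`, rejection yields at least `p - x` at `x` and at most `p`
          -- minus the value at the midpoint of `x` and `c`. The payoff therefore falls at rate at
          -- least 1, and this rate is the winning probability.
          have h3 : 1 ≤ ∑ R ∈ Finset.univ.filter (fun R : Finset (Fin N) => i₀ ∈ R),
              w R * σ.sellerWinProb (ν R.card) r R i₀ (σ.bid R.card x) := by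
            refine le_of_mul_le_mul_left (a := (x + c) / 2 - x) ?_ (by linarith)
            simp only [hw]
            linarith
          have h4 : ∑ R ∈ Finset.univ.filter (fun R : Finset (Fin N) => i₀ ∈ R),
              w R * (1 - σ.sellerWinProb (ν R.card) r R i₀ (σ.bid R.card x)) ≤ 0 := by
            simp only [mul_sub, mul_one, Finset.sum_sub_distrib]
            have := hw1 i₀
            simp only [hw] at h3 ⊢
            linarith
          have h5 := (Finset.sum_eq_zero_iff_of_nonneg (fun R _ => mul_nonneg (hw0 R)
            (sub_nonneg.2 (hK i₀ (fun m => σ.bid m x) R).2))).1 (le_antisymm h4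
              (Finset.sum_nonneg fun R _ => mul_nonneg (hw0 R)
                (sub_nonneg.2 (hK i₀ (fun m => σ.bid m x) R).2))) Finset.univ (by simp)
          have h6 : 0 < w Finset.univ := by
            simp only [hw, Finset.card_univ, Fintype.card_fin, Nat.sub_self, pow_zero, mul_one]
            exact pow_pos hqpos _
          have h7 := (mul_eq_zero.1 h5).resolve_left h6.ne'
          have h8 := sellerWinProb_univ_le (σ := σ) (r := r) νN hN (i := i₀) (b := β x)
          have h9 := measureReal_ge_eq_add (ν := νN) (β := β) (σ.bid_measurable _) (β x)
          have h10 : νN.real {y | β x ≤ β y} ≤ 1 := measureReal_le_one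
          have h11 : νN.real {y | β x ≤ β y} ^ (N - 1 - 1) ≤ 1 :=
            pow_le_one₀ measureReal_nonneg h10
          have h12 := measureReal_nonneg (μ := νN) (s := {y | β y = β x})
          have h13 := measureReal_nonneg (μ := νN) (s := {y | β x < β y})
          have h14 := mul_le_of_le_one_left
            (show 0 ≤ νN.real {y | β x < β y} + νN.real {y | β y = β x} / 2 by linarith) h11
          -- A sure win requires `1 ≤ A + B / 2`, where `A` and `B` are the masses of higher and of
          -- equal bids; as `A + B ≤ 1`, this gives `A = 1`.
          have h15 : νN.real {y | β x < β y}ᶜ = 0 := by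
            rw [probReal_compl_eq_one_sub
              (measurableSet_lt measurable_const (σ.bid_measurable _))]
            have h16 : (1 : ℝ) ≤ νN.real {y | β x < β y} + νN.real {y | β y = β x} / 2 := by
              linarith [h8.trans h14]
            linarith [measureReal_le_one (μ := νN) (s := {y | β x < β y})]
          rw [measureReal_eq_zero_iff (measure_ne_top _ _)] at h15
          convert h15 using 2
          ext y
          simp
        have hD0 := measure_eq_zero_of_forall_le_null (σ.bid_measurable _) hDnull
        have hDm : MeasurableSet D :=
          measurableSet_Ico.inter (measurableSet_lt ham measurable_const)
        have h1 : (μ.withDensity fun x => ENNReal.ofReal (1 - a x)) D = 0 := by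
          rw [← hν' (Finset.univ : Finset (Fin N)).card, Measure.smul_apply, hD0, smul_zero]
        rw [withDensity_apply_eq_zero (by fun_prop)] at h1
        have h2 : ∀ᵐ x ∂μ, ¬ x ∈ {x | ENNReal.ofReal (1 - a x) ≠ 0} ∩ D :=
          measure_eq_zero_iff_ae_notMem.1 h1
        filter_upwards [h2, hae] with x hx hx0 hxc
        by_contra hne
        have hlt : a x < 1 := lt_of_le_of_ne (ha01 x).2 hne
        refine hx ⟨?_, ⟨hx0.1.le, hxc⟩, hlt⟩
        simpa using hlt

end Profile

/-! ### Beliefs about a seller who rejected -/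

section Belief

variable {μ ν : Measure ℝ} {a : ℝ → ℝ} {c r : ℝ}

/-- At a cutoff the rejection weight is an indicator, so Bayes' rule makes the belief the prior
truncated to values above `c`. -/
theorem one_sub_accept_ae_eq_indicator (hμ : IsValueDistribution μ)
    (ha0 : ∀ x ∈ Set.Ioc c 1, a x = 0) (ha1 : ∀ᵐ x ∂μ, x < c → a x = 1) :
    (fun x => 1 - a x) =ᵐ[μ] (Set.Ioi c).indicator 1 := by
  have := hμ.isProbabilityMeasure
  have := hμ.nullSingletonClass
  filter_upwards [ha1, hμ.ae_mem, Measure.ae_ne μ c] with x h1 hx hne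
  rcases lt_or_gt_of_ne hne with h | h
  · rw [Set.indicator_of_notMem (by simpa using h.le), h1 h, sub_self]
  · rw [Set.indicator_of_mem (by simpa using h), ha0 x ⟨h, hx.2.le⟩, sub_zero, Pi.one_apply]

theorem integral_one_sub_accept (hμ : IsValueDistribution μ)
    (ha0 : ∀ x ∈ Set.Ioc c 1, a x = 0) (ha1 : ∀ᵐ x ∂μ, x < c → a x = 1) :
    ∫ x, (1 - a x) ∂μ = 1 - cdf μ c := by
  have := hμ.isProbabilityMeasure
  rw [integral_congr_ae (one_sub_accept_ae_eq_indicator hμ ha0 ha1),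
    integral_indicator_one measurableSet_Ioi, measureReal_Ioi_eq]

theorem withDensity_one_sub_accept (hμ : IsValueDistribution μ)
    (ha0 : ∀ x ∈ Set.Ioc c 1, a x = 0) (ha1 : ∀ᵐ x ∂μ, x < c → a x = 1) :
    (μ.withDensity fun x => ENNReal.ofReal (1 - a x)) = μ.restrict (Set.Ioi c) := by
  rw [← withDensity_indicator_one measurableSet_Ioi]
  refine withDensity_congr_ae ?_
  filter_upwards [one_sub_accept_ae_eq_indicator hμ ha0 ha1] with x hx
  rw [hx]
  by_cases h : x ∈ Set.Ioi c
  · simp [Set.indicator_of_mem h]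
  · simp [Set.indicator_of_notMem h]

variable (hμ : IsValueDistribution μ) (hq : 0 < 1 - cdf μ c)
  (hν : ENNReal.ofReal (1 - cdf μ c) • ν = μ.restrict (Set.Ioi c))
include hq hν

theorem belief_real_mul {s : Set ℝ} (hs : MeasurableSet s) :
    (1 - cdf μ c) * ν.real s = μ.real (s ∩ Set.Ioi c) := by
  have h : (ENNReal.ofReal (1 - cdf μ c) • ν) s = μ.restrict (Set.Ioi c) s := by rw [hν]
  rw [Measure.restrict_apply hs, Measure.smul_apply, smul_eq_mul] at h
  rw [measureReal_def, measureReal_def, ← h, ENNReal.toReal_mul, ENNReal.toReal_ofReal hq.le]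

theorem belief_null {s : Set ℝ} (hs : MeasurableSet s) (h0 : μ (s ∩ Set.Ioi c) = 0) : ν s = 0 := by
  have h : (ENNReal.ofReal (1 - cdf μ c) • ν) s = μ.restrict (Set.Ioi c) s := by rw [hν]
  rw [Measure.restrict_apply hs, h0, Measure.smul_apply, smul_eq_mul, mul_eq_zero] at h
  exact h.resolve_left (by simpa using hq)

include hμ

theorem belief_nullSingletonClass : NullSingletonClass ν := by
  have := hμ.nullSingletonClass
  exact ⟨fun x => belief_null hq hν (measurableSet_singleton x)
    (measure_mono_null Set.inter_subset_left (measure_singleton x))⟩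

theorem belief_ae_mem : ∀ᵐ x ∂ν, x ∈ Set.Ioc c 1 := by
  refine belief_null hq hν (measurableSet_Ioc.compl) ?_
  refine measure_mono_null ?_ hμ.ae_mem
  rintro x ⟨h1, h2⟩
  exact fun h => h1 ⟨h2, h.2.le⟩

theorem belief_Ioi {b : ℝ} (hb : c ≤ b) : (1 - cdf μ c) * ν.real (Set.Ioi b) = 1 - cdf μ b := by
  have := hμ.isProbabilityMeasure
  rw [belief_real_mul hq hν measurableSet_Ioi,
    Set.inter_eq_left.2 (Set.Ioi_subset_Ioi hb), measureReal_Ioi_eq]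

theorem belief_Ioi_eq_truncatedCDF {b : ℝ} (hb : c ≤ b) :
    ν.real (Set.Ioi b) = 1 - truncatedCDF μ c b := by
  have h := belief_Ioi hμ hq hν hb
  unfold truncatedCDF
  field_simp
  linarith

theorem belief_Ioi_pos [IsProbabilityMeasure ν] (hF : ∀ v < r, cdf μ v < 1) {b : ℝ} (hb : b < r) :
    0 < ν.real (Set.Ioi b) := by
  rcases le_total c b with h | h
  · have h1 := belief_Ioi hμ hq hν h
    have h2 := hF b hb
    exact pos_of_mul_pos_right (by rw [h1]; linarith) hq.le
  · have h1 : (1 : ℝ) ≤ ν.real (Set.Ioi b) := by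
      rw [← probReal_univ (μ := ν)]
      exact measureReal_mono_of_ae (belief_ae_mem hμ hq hν) fun x hx _ => h.trans_lt hx.1
    linarith

end Belief

/-! ### Equilibrium of the first-price auctions after rejection above a cutoff -/

namespace Profile

section Subgames

variable {N : ℕ} {σ : Profile N} {μ ν : Measure ℝ} [IsProbabilityMeasure ν] {r c : ℝ}
  {R : Finset (Fin N)} {i : Fin N}

theorem subgame_with_speculator (hμ : IsValueDistribution μ) (hF : ∀ v < r, cdf μ v < 1)
    (hc : 0 < c) (hcr : c ≤ r) (hq : 0 < 1 - cdf μ c)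
    (hν : ENNReal.ofReal (1 - cdf μ c) • ν = μ.restrict (Set.Ioi c))
    (hβx : ∀ x ∈ Set.Ioc c 1, x ≤ σ.bid R.card x) (hR : R ≠ Finset.univ) (hi : i ∈ R)
    (hopt : ∀ x ∈ Set.Ioc c 1, ∀ b, σ.sellerSubgamePayoff ν r R i x b ≤
      σ.sellerSubgamePayoff ν r R i x (σ.bid R.card x))
    (hopts : ∀ᵐ s ∂(σ.specBid R.card : Measure ℝ), ∀ s',
      σ.specSubgamePayoff ν r R s' ≤ σ.specSubgamePayoff ν r R s) :
    (∀ᵐ s ∂(σ.specBid R.card : Measure ℝ),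
      σ.specWinProb ν r R s * s ≤ lowestBid μ r R.card c) ∧
    ∀ b < lowestBid μ r R.card c, σ.sellerWinProb ν r R i b = 1 := by
  have hR1 : 1 ≤ R.card := Finset.card_pos.2 ⟨i, hi⟩
  have hk : R.card - 1 + 1 = R.card := Nat.sub_add_cancel hR1
  have := belief_nullSingletonClass hμ hq hν
  simp only [sellerSubgamePayoff_eq] at hopt
  simp only [specSubgamePayoff_eq] at hopts
  have hL : lowestBid μ r R.card c =
      sSup ((fun b => b * ν.real (Set.Ioi b) ^ (R.card - 1 + 1)) '' Set.Icc c r) := by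
    unfold lowestBid
    rw [hk]
    congr 1
    refine Set.image_congr fun b hb => ?_
    rw [belief_Ioi_eq_truncatedCDF hμ hq hν hb.1]
  rw [hL]
  refine speculator_revenue_le_and_low_bid_wins hc hcr (σ.bid_measurable R.card)
    (belief_ae_mem hμ hq hν) hβx (fun b hb => belief_Ioi_pos hμ hq hν hF hb)
    (fun b => σ.specWinProb_mem ν r R b) (fun s hs => σ.specWinProb_of_lt ν r R hs)
    (fun b hb => by rw [hk]; exact le_specWinProb ν hR hb)
    (fun b _ => specWinProb_le ν hR1) hopts (fun b => σ.sellerWinProb_mem ν r R i b)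
    (fun b hb => le_sellerWinProb ν hi hb) (fun b => sellerWinProb_le ν hR) hopt

theorem subgame_univ_winProb (hN : 2 ≤ N) (hμ : IsValueDistribution μ)
    (hF : ∀ v < r, cdf μ v < 1) (hr : r ≤ 1) (hq : 0 < 1 - cdf μ c)
    (hν : ENNReal.ofReal (1 - cdf μ c) • ν = μ.restrict (Set.Ioi c))
    (hβx : ∀ x ∈ Set.Ioc c 1, x ≤ σ.bid (Finset.univ : Finset (Fin N)).card x)
    (hopt : ∀ x ∈ Set.Ioc c 1, ∀ b, σ.sellerSubgamePayoff ν r Finset.univ i x b ≤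
      σ.sellerSubgamePayoff ν r Finset.univ i x (σ.bid (Finset.univ : Finset (Fin N)).card x))
    {x : ℝ} (hx : x ∈ Set.Ioo c r) :
    σ.sellerWinProb ν r Finset.univ i (σ.bid (Finset.univ : Finset (Fin N)).card x) =
      ν.real (Set.Ioi x) ^ (N - 1) := by
  have := belief_nullSingletonClass hμ hq hν
  simp only [sellerSubgamePayoff_eq] at hopt
  exact winProb_eq_of_optimal (W := σ.sellerWinProb ν r Finset.univ i) (σ.bid_measurable _)
    (belief_ae_mem hμ hq hν) hβx hr (by omega)
    (fun b hb => σ.sellerWinProb_of_lt ν r _ i hb) (fun b hb => le_sellerWinProb_univ ν hb)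
    (fun b _ => sellerWinProb_univ_le ν hN) hopt (fun b hb => belief_Ioi_pos hμ hq hν hF hb) hx

theorem subgame_univ_payoff (hN : 2 ≤ N) (hμ : IsValueDistribution μ)
    (hF : ∀ v < r, cdf μ v < 1) (hr : r ≤ 1) (hq : 0 < 1 - cdf μ c)
    (hν : ENNReal.ofReal (1 - cdf μ c) • ν = μ.restrict (Set.Ioi c))
    (hβx : ∀ x ∈ Set.Ioc c 1, x ≤ σ.bid (Finset.univ : Finset (Fin N)).card x)
    (hopt : ∀ x ∈ Set.Ioc c 1, ∀ b, σ.sellerSubgamePayoff ν r Finset.univ i x b ≤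
      σ.sellerSubgamePayoff ν r Finset.univ i x (σ.bid (Finset.univ : Finset (Fin N)).card x))
    {x : ℝ} (hx : x ∈ Set.Ioc c r) :
    σ.sellerSubgamePayoff ν r Finset.univ i x (σ.bid (Finset.univ : Finset (Fin N)).card x) =
      ∫ y in x..r, ν.real (Set.Ioi y) ^ (N - 1) := by
  have := belief_nullSingletonClass hμ hq hν
  simp only [sellerSubgamePayoff_eq] at hopt ⊢
  exact payoff_eq_integral_of_optimal (W := σ.sellerWinProb ν r Finset.univ i) (σ.bid_measurable _)
    (belief_ae_mem hμ hq hν) hβx hr (by omega)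
    (fun b hb => σ.sellerWinProb_of_lt ν r _ i hb) (σ.sellerWinProb_mem ν r _ i)
    (fun b hb => le_sellerWinProb_univ ν hb)
    (fun b _ => sellerWinProb_univ_le ν hN) hopt (fun b hb => belief_Ioi_pos hμ hq hν hF hb) hx

/-- The envelope formula is known only for types above `c`. The cutoff type mimics type `c + δ`,
whose payoff falls short of the full integral by at most `δ`; if `c = r`, the integral is 0 and the
bid `r` will do. -/
theorem exists_bid_univ (hN : 2 ≤ N) (hμ : IsValueDistribution μ)
    (hF : ∀ v < r, cdf μ v < 1) (hr : r ≤ 1) (hcr : c ≤ r) (hq : 0 < 1 - cdf μ c)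
    (hν : ENNReal.ofReal (1 - cdf μ c) • ν = μ.restrict (Set.Ioi c))
    (hβx : ∀ x ∈ Set.Ioc c 1, x ≤ σ.bid (Finset.univ : Finset (Fin N)).card x)
    (hopt : ∀ x ∈ Set.Ioc c 1, ∀ b, σ.sellerSubgamePayoff ν r Finset.univ i x b ≤
      σ.sellerSubgamePayoff ν r Finset.univ i x (σ.bid (Finset.univ : Finset (Fin N)).card x))
    {ε : ℝ} (hε : 0 < ε) :
    ∃ x, (∫ y in c..r, ν.real (Set.Ioi y) ^ (N - 1)) - ε ≤
      σ.sellerWinProb ν r Finset.univ i x * (x - c) := by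
  have := belief_nullSingletonClass hμ hq hν
  rcases hcr.eq_or_lt with h | h
  · refine ⟨r, ?_⟩
    rw [h]; simp [hε.le]
  · set δ := min ε (r - c) with hδ
    have hδ0 : 0 < δ := lt_min hε (by linarith)
    have hδε : δ ≤ ε := min_le_left _ _
    have hδr : δ ≤ r - c := min_le_right _ _
    have hx : c + δ ∈ Set.Ioc c r := ⟨by linarith, by linarith⟩
    have hpay := subgame_univ_payoff hN hμ hF hr hq hν hβx hopt hx
    rw [sellerSubgamePayoff_eq] at hpay
    refine ⟨σ.bid (Finset.univ : Finset (Fin N)).card (c + δ), ?_⟩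
    have hcont : Continuous fun y => ν.real (Set.Ioi y) ^ (N - 1) := by
      simp only [measureReal_Ioi_eq]
      have := continuous_cdf_of_noAtoms ν
      fun_prop
    have hsplit := intervalIntegral.integral_add_adjacent_intervals
      (hcont.intervalIntegrable (μ := volume) c (c + δ)) (hcont.intervalIntegrable (c + δ) r)
    have hle : ∫ y in c..(c + δ), ν.real (Set.Ioi y) ^ (N - 1) ≤ δ := by
      have h1 := intervalIntegral.integral_mono_on (by linarith)
        (hcont.intervalIntegrable (μ := volume) c (c + δ))
        (continuous_const.intervalIntegrable (μ := volume) c (c + δ)) (g := fun _ => (1 : ℝ))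
        (fun y _ => pow_le_one₀ measureReal_nonneg measureReal_le_one)
      simpa using h1
    have hW := (σ.sellerWinProb_mem ν r Finset.univ i
      (σ.bid (Finset.univ : Finset (Fin N)).card (c + δ))).1
    nlinarith

end Subgames

end Profile

/-! ### The speculator's profit in the first-price game -/

namespace Profile

variable {N : ℕ} {σ : Profile N} {μ : Measure ℝ} {r p c : ℝ}

/-- Against sellers who accept below the cutoff `c > 0`, the speculator earns at most `Π⋆ c`. -/
theorem IsFPAContinuation.speculatorPayoff_neg (hN : 2 ≤ N) (hμ : IsValueDistribution μ)
    (hr : r ∈ Set.Ioc (0 : ℝ) 1) (hF : ∀ v < r, cdf μ v < 1) (hp : p ≤ r)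
    (h : σ.IsFPAContinuation μ r p) (hc : 0 < c) (hcp : c ≤ p)
    (ha0 : ∀ i, ∀ x ∈ Set.Ioc c 1, σ.accept i x = 0)
    (ha1 : ∀ i, ∀ᵐ x ∂μ, x < c → σ.accept i x = 1)
    (hrej : ∀ i, ∀ x ∈ Set.Ico 0 c, ∀ b : ℕ → ℝ, σ.rejectPayoff μ .first r i x b ≤ p - x)
    (hprofit : fpaProfit N μ r c < 0) : σ.speculatorPayoff μ .first r p < 0 := by
  have := hμ.isProbabilityMeasure
  obtain ⟨ν, -, hν, hopt, hopts⟩ := h.biddingRational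
  set i₀ : Fin N := ⟨0, by omega⟩
  set a := σ.accept i₀ with ha'
  have ha : ∀ i, σ.accept i = a := fun i => h.symmetric i i₀
  have ham : Measurable a := σ.accept_measurable i₀
  have ha01 : ∀ x, a x ∈ Set.Icc (0 : ℝ) 1 := σ.accept_mem i₀
  have hq : 1 - cdf μ c = ∫ x, (1 - a x) ∂μ :=
    (integral_one_sub_accept hμ (ha0 i₀) (ha1 i₀)).symm
  have h1a : ∀ x, 1 - a x ∈ Set.Icc (0 : ℝ) 1 := fun x =>
    ⟨by linarith [(ha01 x).2], by linarith [(ha01 x).1]⟩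
  have hν' : ∀ m, ENNReal.ofReal (1 - cdf μ c) • (ν m : Measure ℝ) =
      μ.withDensity fun x => ENNReal.ofReal (1 - a x) := by
    intro m
    rw [hq, ofReal_integral_eq_lintegral_ofReal (integrable_of_mem_Icc (by fun_prop)
      (ae_of_all _ h1a)) (ae_of_all _ fun x => (h1a x).1)]
    exact hν m i₀
  have hbound := fun L => speculatorPayoff_first_le (p := p) ha hq ham ha01 hν' h.undominated_spec
    hr.1.le L
  rw [sub_sub_cancel] at hbound
  have hcr : c ≤ r := hcp.trans hp
  have hN1 : (1 : ℝ) < N := by exact_mod_cast hN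
  have hle_r : ∀ R : Finset (Fin N), ∀ᵐ s ∂(σ.specBid R.card : Measure ℝ),
      σ.specWinProb (ν R.card) r R s * s ≤ r := by
    intro R
    have h0 : ∀ᵐ s ∂(σ.specBid R.card : Measure ℝ), 0 ≤ s := by
      rw [ae_iff]; simp only [not_le]; exact h.undominated_spec _
    filter_upwards [h0] with s hs
    rcases le_or_gt s r with hsr | hsr
    · exact (mul_le_of_le_one_left hs (σ.specWinProb_mem _ r R s).2).trans hsr
    · rw [specWinProb_of_lt _ _ _ _ hsr, zero_mul]; exact hr.1.le
  -- If `F(c) = 1`, almost surely nobody rejects and Bayes' rule leaves beliefs free. But then `c =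
  -- p = r`, and `N ≥ 2` items are bought at `r` each for a revenue of at most `r`.
  rcases (sub_nonneg.2 (cdf_le_one μ c)).eq_or_lt with hq0 | hqpos
  · have hcr' : c = r := by
      refine le_antisymm hcr ?_
      by_contra hlt
      linarith [hF c (not_le.1 hlt)]
    have hpr : p = r := le_antisymm hp (hcr' ▸ hcp)
    have hb := hbound (fun _ => r) fun R _ => hle_r R
    rw [← hq0] at hb
    have hc1 : cdf μ c = 1 := by linarith
    rw [hc1, hpr] at hb
    rw [hpr]
    refine hb.trans_lt ?_
    rw [Finset.sum_eq_single_of_mem 0 (Finset.mem_range.2 (by omega))]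
    · simp only [Nat.choose_zero_right, Nat.cast_one, pow_zero, one_pow, one_mul, mul_one]
      nlinarith [hr.1]
    · intro m _ hm
      rw [zero_pow hm]; ring
  · have hνr : ∀ m, ENNReal.ofReal (1 - cdf μ c) • (ν m : Measure ℝ) = μ.restrict (Set.Ioi c) :=
      fun m => (hν' m).trans (withDensity_one_sub_accept hμ (ha0 i₀) (ha1 i₀))
    have hβx : ∀ m, ∀ x ∈ Set.Ioc c 1, x ≤ σ.bid m x := fun m x hx =>
      h.undominated m x ⟨hc.le.trans hx.1.le, hx.2⟩
    have hopt' : ∀ R : Finset (Fin N), ∀ i ∈ R, ∀ x ∈ Set.Ioc c 1, ∀ b,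
        σ.sellerSubgamePayoff (ν R.card) r R i x b ≤
        σ.sellerSubgamePayoff (ν R.card) r R i x (σ.bid R.card x) := fun R i hi x hx b =>
      hopt R i hi x ⟨hc.le.trans hx.1.le, hx.2⟩ (by rw [ha0 i x hx]; exact zero_lt_one) b
    have hsub := fun (R : Finset (Fin N)) (hR : R ≠ Finset.univ) i (hi : i ∈ R) =>
      subgame_with_speculator hμ hF hc hcr hqpos (hνr R.card) (hβx R.card) hR hi (hopt' R i hi)
        (hopts R hR)
    set F := cdf μ c with hFc
    have hF0 : 0 ≤ F := cdf_nonneg μ c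
    -- the price is at least `fpaPrice`
    have hprice : fpaPrice N μ r c ≤ p := by
      refine le_of_forall_pos_le_add fun ε hε => ?_
      obtain ⟨x, hx⟩ := exists_bid_univ (i := i₀) hN hμ hF hr.2 hcr hqpos
        (hνr (Finset.univ : Finset (Fin N)).card) (hβx _) (hopt' Finset.univ i₀ (Finset.mem_univ _))
        hε
      -- The deviation that bounds the price from below: undercut `lowestBid` by `ε` whenever the
      -- speculator is present, and otherwise mimic a type just above the cutoff.
      set b : ℕ → ℝ := fun m => if m = N then x else lowestBid μ r m c - ε with hb
      -- The bound is known for types strictly below `c`; it reaches `c` as the type tends to `c`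
      -- with bids held fixed.
      have hlim : σ.rejectPayoff μ .first r i₀ c b ≤ p - c := by
        refine le_of_forall_pos_le_add fun δ hδ => ?_
        have hmem : max 0 (c - δ) ∈ Set.Ico 0 c :=
          ⟨le_max_left _ _, max_lt hc (by linarith)⟩
        have h1 := hrej i₀ _ hmem b
        rw [rejectPayoff_first_add ha hq ham ha01 hν' i₀ _ c b] at h1
        have h2 : 0 ≤ ∑ R ∈ Finset.univ.filter (fun R : Finset (Fin N) => i₀ ∈ R),
            (1 - F) ^ (R.card - 1) * (1 - (1 - F)) ^ (N - R.card) *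
            σ.sellerWinProb (ν R.card) r R i₀ (b R.card) := by
          refine Finset.sum_nonneg fun R _ => mul_nonneg (mul_nonneg (pow_nonneg hqpos.le _)
            (pow_nonneg (by linarith) _)) (σ.sellerWinProb_mem _ r R i₀ _).1
        have h3 := mul_nonneg (sub_nonneg.2 hmem.2.le) h2
        have h4 := le_max_right 0 (c - δ)
        linarith
      set U : ℕ → ℝ := fun m => if m = N then
        ∫ y in c..r, (ν (Finset.univ : Finset (Fin N)).card : Measure ℝ).real (Set.Ioi y) ^ (N - 1)
        else lowestBid μ r m c - c with hU
      have hterm : ∀ R : Finset (Fin N), i₀ ∈ R → U R.card - ε ≤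
          σ.sellerWinProb (ν R.card) r R i₀ (b R.card) * (b R.card - c) := by
        intro R hi
        by_cases hR : R = Finset.univ
        · subst hR
          have hcard : (Finset.univ : Finset (Fin N)).card = N := by simp
          have hbx : b (Finset.univ : Finset (Fin N)).card = x := by simp only [hb, hcard, if_true]
          have hUx : U (Finset.univ : Finset (Fin N)).card = ∫ y in c..r,
            (ν (Finset.univ : Finset (Fin N)).card : Measure ℝ).real (Set.Ioi y) ^ (N - 1) := by
            simp only [hU]; rw [if_pos hcard]
          rw [hbx, hUx]
          exact hx
        · have hcard : R.card ≠ N := fun h => hR (Finset.eq_univ_of_card R (by simpa using h))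
          have hbx : b R.card = lowestBid μ r R.card c - ε := by simp only [hb]; rw [if_neg hcard]
          rw [hbx, (hsub R hR i₀ hi).2 _ (by linarith)]
          simp only [hU]; rw [if_neg hcard]
          linarith
      have hsum : (∑ R ∈ Finset.univ.filter (fun R : Finset (Fin N) => i₀ ∈ R),
          (1 - F) ^ (R.card - 1) * F ^ (N - R.card) * (U R.card)) - ε ≤ p - c := by
        refine le_trans ?_ hlim
        rw [rejectPayoff_first ha hq ham ha01 hν', sub_sub_cancel]
        have hw1 := sum_binomial_weights (1 - F) i₀
        rw [sub_sub_cancel] at hw1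
        have hε1 : ∑ R ∈ Finset.univ.filter (fun R : Finset (Fin N) => i₀ ∈ R),
            ε * ((1 - F) ^ (R.card - 1) * F ^ (N - R.card)) = ε := by
          rw [← Finset.mul_sum, hw1, mul_one]
        refine (sub_le_sub_left hε1.le _).trans ?_
        rw [← Finset.sum_sub_distrib]
        refine Finset.sum_le_sum fun R hR => ?_
        have h5 := mul_le_mul_of_nonneg_left (hterm R (Finset.mem_filter.1 hR).2)
          (mul_nonneg (pow_nonneg hqpos.le (R.card - 1)) (pow_nonneg hF0 (N - R.card)))
        linarith
      rw [sum_filter_mem_card i₀ fun m => (1 - F) ^ (m - 1) * F ^ (N - m) * U m] at hsum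
      obtain ⟨n, rfl⟩ : ∃ n, N = n + 1 := ⟨N - 1, by omega⟩
      rw [Finset.sum_range_succ] at hsum
      simp only [Nat.add_sub_cancel, Nat.choose_self, Nat.cast_one, one_mul, Nat.sub_self, pow_zero,
        mul_one] at hsum
      unfold fpaPrice
      simp only [Nat.add_sub_cancel]
      -- The probability that the `n` other sellers reject cancels the denominators of the truncated
      -- tails.
      have hUn : (1 - F) ^ n * U (n + 1) = ∫ x in c..r, (1 - cdf μ x) ^ n := by
        simp only [hU, if_true]
        rw [← intervalIntegral.integral_const_mul]
        refine intervalIntegral.integral_congr fun y hy => ?_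
        rw [Set.uIcc_of_le hcr] at hy
        simp only [Nat.add_sub_cancel]
        rw [← mul_pow, belief_Ioi hμ hqpos (hνr _) hy.1]
      rw [hUn] at hsum
      have hsum2 : ∑ m ∈ Finset.range n, (n.choose m : ℝ) * ((1 - F) ^ m * F ^ (n + 1 - (m + 1)) *
          U (m + 1)) = ∑ m ∈ Finset.range n, (n.choose m : ℝ) * (1 - F) ^ m * F ^ (n - m) *
          (lowestBid μ r (m + 1) c - c) := by
        refine Finset.sum_congr rfl fun m hm => ?_
        have : m + 1 ≠ n + 1 := by
          have := Finset.mem_range.1 hm; omega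
        simp only [hU]
        rw [if_neg this, Nat.add_sub_add_right]
        ring
      rw [hsum2] at hsum
      linarith
    -- the revenue is at most that in `fpaProfit`
    have hb := hbound (fun m => if m = 0 then r else lowestBid μ r m c) fun R hR => by
      by_cases h0 : R.card = 0
      · simp only [h0, if_true]
        have := hle_r R
        rwa [h0] at this
      · obtain ⟨i, hi⟩ := Finset.card_pos.1 (Nat.pos_of_ne_zero h0)
        simp only [if_neg h0]
        exact (hsub R hR i hi).1
    refine hb.trans_lt (lt_of_le_of_lt ?_ hprofit)
    unfold fpaProfit
    rw [Finset.range_eq_Ico, Finset.sum_eq_sum_Ico_succ_bot (by omega)]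
    have hsum3 : ∑ m ∈ Finset.Ico (0 + 1) N, (N.choose m : ℝ) * ((1 - F) ^ m * F ^ (N - m) *
        if m = 0 then r else lowestBid μ r m c) = ∑ m ∈ Finset.Ico 1 N,
        (N.choose m : ℝ) * (1 - F) ^ m * F ^ (N - m) * lowestBid μ r m c := by
      refine Finset.sum_congr rfl fun m hm => ?_
      have : m ≠ 0 := by have := Finset.mem_Ico.1 hm; omega
      rw [if_neg this]
      ring
    rw [hsum3]
    simp only [Nat.choose_zero_right, Nat.cast_one, pow_zero, one_mul, if_true, Nat.sub_zero]
    have h6 : (N : ℝ) * F * fpaPrice N μ r c ≤ N * F * p :=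
      mul_le_mul_of_nonneg_left hprice (by positivity)
    linarith

/-- If no seller accepts, all sellers take part in the auction. -/
theorem expect_of_accept_eq_zero [IsProbabilityMeasure μ]
    (ha : ∀ i, ∀ᵐ x ∂μ, σ.accept i x = 0) (X : Finset (Fin N) → (Fin N → ℝ) → ℝ → ℝ) :
    σ.expect μ X = ∫ v, ∫ s, X Finset.univ v s
      ∂(σ.specBid (Finset.univ : Finset (Fin N)).card : Measure ℝ) ∂(Measure.pi fun _ => μ) := by
  unfold expect
  refine integral_congr_ae ?_
  filter_upwards [pi_ae_of_forall_ae ha] with v hv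
  rw [Finset.sum_eq_single_of_mem Finset.univ (Finset.mem_univ _)]
  · simp [hv]
  · intro R _ hR
    obtain ⟨j, hj⟩ : ∃ j, j ∉ R := by
      by_contra! h
      exact hR (Finset.eq_univ_iff_forall.2 h)
    rw [Finset.prod_eq_zero (Finset.mem_univ j) (by rw [if_neg hj, hv j]), zero_mul]

theorem speculatorPayoff_eq_zero [IsProbabilityMeasure μ]
    (ha : ∀ i, ∀ᵐ x ∂μ, σ.accept i x = 0) (fmt : AuctionFormat) :
    σ.speculatorPayoff μ fmt r p = 0 := by
  unfold speculatorPayoff share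
  rw [expect_of_accept_eq_zero ha]
  have : (none : Option (Fin N)) ∉ bidders Finset.univ := fun h => none_mem_bidders.1 h rfl
  simp [winShare_eq_zero_of_notMem this]

end Profile

/-- The offer 0 admits only the cutoff 0 and hence yields profit 0. A positive cutoff yields a
negative profit, so it cannot follow an optimal offer. -/
theorem IsFPAEquilibrium.accept_eq_zero {N : ℕ} (hN : 2 ≤ N) {μ : Measure ℝ}
    (hμ : IsValueDistribution μ) {r : ℝ} (hr : r ∈ Set.Ioc (0 : ℝ) 1) (hF : ∀ v < r, cdf μ v < 1)
    (hprofit : ∀ v ∈ Set.Ioc 0 r, fpaProfit N μ r v < 0) {E : SpeculationStrategy N}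
    (hE : IsFPAEquilibrium μ r E) (i : Fin N) :
    ∀ x ∈ Set.Ioc (0 : ℝ) 1, (E.after E.offer).accept i x = 0 := by
  have := hμ.isProbabilityMeasure
  have h0mem : (0 : ℝ) ∈ Set.Icc 0 r := ⟨le_rfl, hr.1.le⟩
  have hzero : (E.after 0).speculatorPayoff μ .first r 0 = 0 := by
    obtain ⟨c, hc, ha0, -, -⟩ := (hE.continuation 0 h0mem).exists_cutoff hN hμ le_rfl
    have hc0 : c = 0 := le_antisymm hc.2 hc.1
    rw [hc0] at ha0
    refine Profile.speculatorPayoff_eq_zero (fun i => ?_) _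
    filter_upwards [hμ.ae_mem] with x hx using ha0 i x ⟨hx.1, hx.2.le⟩
  have hopt := hE.optimal 0 h0mem
  rw [hzero] at hopt
  obtain ⟨c, hc, ha0, ha1, hrej⟩ :=
    (hE.continuation E.offer hE.offer_mem).exists_cutoff hN hμ hE.offer_mem.1
  rcases hc.1.eq_or_lt with h | h
  · rw [← h] at ha0
    exact ha0 i
  · exact absurd hopt (not_le.2 ((hE.continuation E.offer hE.offer_mem).speculatorPayoff_neg hN hμ
      hr hF hE.offer_mem.2 h hc.2 ha0 ha1 hrej (hprofit c ⟨h, hc.2.trans hE.offer_mem.2⟩)))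

/-! ### The standard first-price auction -/

/-- Interim payoff of a seller with value `x` in the auction without speculation. -/
def standardPayoff (N : ℕ) (μ : Measure ℝ) (r x : ℝ) : ℝ :=
  if x ≤ r then ∫ y in x..r, (1 - cdf μ y) ^ (N - 1) else 0

/-- Interim winning probability of a seller with value `x` in the auction without speculation. -/
def standardWinProb (N : ℕ) (μ : Measure ℝ) (r x : ℝ) : ℝ :=
  if x < r then (1 - cdf μ x) ^ (N - 1) else 0

theorem IsValueDistribution.cdf_zero {μ : Measure ℝ} (hμ : IsValueDistribution μ) :
    cdf μ 0 = 0 := by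
  have := hμ.isProbabilityMeasure
  rw [cdf_eq_real]
  have : μ (Set.Iic 0) = 0 := by
    refine measure_mono_null ?_ hμ.ae_mem
    intro x (hx : x ≤ 0) h
    exact absurd h.1 (not_lt.2 hx)
  simp [measureReal_def, this]

theorem belief_eq_of_cutoff_zero {μ ν : Measure ℝ} (hμ : IsValueDistribution μ)
    (hν : ENNReal.ofReal (1 - cdf μ 0) • ν = μ.restrict (Set.Ioi 0)) : ν = μ := by
  rw [hμ.cdf_zero, sub_zero, ENNReal.ofReal_one, one_smul] at hν
  rw [hν]
  exact Measure.restrict_eq_self_of_ae_mem (by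
    filter_upwards [hμ.ae_mem] with x hx using hx.1)

namespace Profile

variable {N : ℕ} {σ : Profile N} {μ : Measure ℝ} {r p : ℝ}

section NoSpeculation

variable (hN : 2 ≤ N) (hμ : IsValueDistribution μ) (hr : r ∈ Set.Ioc (0 : ℝ) 1)
  (hF : ∀ v < r, cdf μ v < 1) (h : σ.IsFPAContinuation μ r p)
  (ha0 : ∀ i, ∀ x ∈ Set.Ioc (0 : ℝ) 1, σ.accept i x = 0)
include hN hμ hr hF h ha0

theorem IsFPAContinuation.winProb_payoff_of_accept_eq_zero (i : Fin N) :
    (∀ᵐ x ∂μ, σ.sellerWinProb μ r Finset.univ i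
      (σ.bid (Finset.univ : Finset (Fin N)).card x) = standardWinProb N μ r x) ∧
    (∀ᵐ x ∂μ, σ.sellerWinProb μ r Finset.univ i (σ.bid (Finset.univ : Finset (Fin N)).card x) *
      (σ.bid (Finset.univ : Finset (Fin N)).card x - x) = standardPayoff N μ r x) := by
  have := hμ.isProbabilityMeasure
  have := hμ.nullSingletonClass
  obtain ⟨ν, -, hν, hopt, -⟩ := h.biddingRational
  have ha1 : ∀ᵐ x ∂μ, x < 0 → σ.accept i x = 1 := by
    filter_upwards [hμ.ae_mem] with x hx hx0
    linarith [hx.1]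
  have hνr : ∀ m, ENNReal.ofReal (1 - cdf μ 0) • (ν m : Measure ℝ) = μ.restrict (Set.Ioi 0) := by
    intro m
    have h1a : ∀ x, 1 - σ.accept i x ∈ Set.Icc (0 : ℝ) 1 := fun x =>
      ⟨by linarith [(σ.accept_mem i x).2], by linarith [(σ.accept_mem i x).1]⟩
    have hint : Integrable (fun x => 1 - σ.accept i x) μ := integrable_of_mem_Icc
      (measurable_const.sub (σ.accept_measurable i)) (ae_of_all _ h1a)
    rw [← withDensity_one_sub_accept hμ (ha0 i) ha1, ← integral_one_sub_accept hμ (ha0 i) ha1,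
      ofReal_integral_eq_lintegral_ofReal hint (ae_of_all _ fun x => (h1a x).1)]
    exact hν m i
  have hνμ : ∀ m, (ν m : Measure ℝ) = μ := fun m => belief_eq_of_cutoff_zero hμ (hνr m)
  have hopt' : ∀ x ∈ Set.Ioc (0 : ℝ) 1, ∀ b, σ.sellerSubgamePayoff μ r Finset.univ i x b ≤
      σ.sellerSubgamePayoff μ r Finset.univ i x
        (σ.bid (Finset.univ : Finset (Fin N)).card x) := fun x hx b => by
    have := hopt Finset.univ i (Finset.mem_univ i) x ⟨hx.1.le, hx.2⟩
      (by rw [ha0 i x hx]; exact zero_lt_one) b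
    rwa [hνμ] at this
  have hβx : ∀ x ∈ Set.Ioc (0 : ℝ) 1, x ≤ σ.bid (Finset.univ : Finset (Fin N)).card x :=
    fun x hx => h.undominated _ x ⟨hx.1.le, hx.2⟩
  have hq : 0 < 1 - cdf μ 0 := by rw [hμ.cdf_zero]; norm_num
  have hνr' := hνr 0
  rw [hνμ] at hνr'
  have hlose : ∀ x, r < x → x ∈ Set.Ioo (0 : ℝ) 1 → σ.sellerWinProb μ r Finset.univ i
      (σ.bid (Finset.univ : Finset (Fin N)).card x) = 0 := fun x hx hx1 =>
    sellerWinProb_of_lt _ _ _ _ _ (hx.trans_le (hβx x ⟨hx1.1, hx1.2.le⟩))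
  constructor
  · filter_upwards [hμ.ae_mem, Measure.ae_ne μ r] with x hx hxr
    unfold standardWinProb
    split_ifs with hlt
    · rw [subgame_univ_winProb hN hμ hF hr.2 hq hνr' hβx hopt' ⟨hx.1, hlt⟩, measureReal_Ioi_eq]
    · exact hlose x (lt_of_le_of_ne (not_lt.1 hlt) (Ne.symm hxr)) hx
  · filter_upwards [hμ.ae_mem] with x hx
    unfold standardPayoff
    split_ifs with hle
    · rw [← sellerSubgamePayoff_eq, subgame_univ_payoff hN hμ hF hr.2 hq hνr' hβx hopt' ⟨hx.1, hle⟩]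
      simp only [measureReal_Ioi_eq]
    · rw [hlose x (not_le.1 hle) hx, zero_mul]

omit hN hμ hr hF h ha0 in
theorem measurable_integral_share (i : Fin N) : Measurable fun v : Fin N → ℝ =>
    ∫ s, winShare r (bidders Finset.univ)
      (allBids (σ.bid (Finset.univ : Finset (Fin N)).card) s v) (some i)
      ∂(σ.specBid (Finset.univ : Finset (Fin N)).card : Measure ℝ) :=
  measurable_integral_right (σ.measurable_share r Finset.univ (some i))

omit hN hμ hr hF h ha0 in
theorem integral_share_mem (i : Fin N) (v : Fin N → ℝ) :
    ∫ s, winShare r (bidders Finset.univ)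
      (allBids (σ.bid (Finset.univ : Finset (Fin N)).card) s v) (some i)
      ∂(σ.specBid (Finset.univ : Finset (Fin N)).card : Measure ℝ) ∈ Set.Icc (0 : ℝ) 1 :=
  integral_mem_Icc ((σ.measurable_share r Finset.univ (some i)).comp
    (measurable_const.prodMk measurable_id)) (ae_of_all _ fun _ => ⟨winShare_nonneg, winShare_le_one⟩)

omit hN hμ hr hF h ha0 in
theorem integral_share_of_lt (i : Fin N) {v : Fin N → ℝ}
    (hv : r < σ.bid (Finset.univ : Finset (Fin N)).card (v i)) :
    ∫ s, winShare r (bidders Finset.univ)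
      (allBids (σ.bid (Finset.univ : Finset (Fin N)).card) s v) (some i)
      ∂(σ.specBid (Finset.univ : Finset (Fin N)).card : Measure ℝ) = 0 := by
  have : ∀ s, winShare r (bidders Finset.univ)
      (allBids (σ.bid (Finset.univ : Finset (Fin N)).card) s v) (some i) = 0 :=
    fun s => winShare_eq_zero_of_lt hv
  simp only [this, integral_zero]

omit hN hμ hr hF h ha0 in
theorem integral_share_mul [IsProbabilityMeasure μ] (i : Fin N) (g : ℝ → ℝ)
    (hint : Integrable (fun v : Fin N → ℝ => (∫ s, winShare r (bidders Finset.univ)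
      (allBids (σ.bid (Finset.univ : Finset (Fin N)).card) s v) (some i)
      ∂(σ.specBid (Finset.univ : Finset (Fin N)).card : Measure ℝ)) * g (v i))
      (Measure.pi fun _ => μ)) :
    ∫ v, (∫ s, winShare r (bidders Finset.univ)
      (allBids (σ.bid (Finset.univ : Finset (Fin N)).card) s v) (some i)
      ∂(σ.specBid (Finset.univ : Finset (Fin N)).card : Measure ℝ)) * g (v i)
      ∂(Measure.pi fun _ => μ) =
    ∫ x, σ.sellerWinProb μ r Finset.univ i (σ.bid (Finset.univ : Finset (Fin N)).card x) * g x
      ∂μ := by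
  rw [integral_pi_update μ i hint]
  refine integral_congr_ae (ae_of_all _ fun x => ?_)
  simp only [Function.update_self, integral_mul_const, allBids_update]
  rfl

theorem IsFPAContinuation.sellerPayoff_of_accept_eq_zero (i : Fin N) :
    σ.sellerPayoff μ .first r p i = ∫ x, standardPayoff N μ r x ∂μ := by
  have := hμ.isProbabilityMeasure
  have hae : ∀ i, ∀ᵐ x ∂μ, σ.accept i x = 0 := fun i => by
    filter_upwards [hμ.ae_mem] with x hx using ha0 i x ⟨hx.1, hx.2.le⟩
  unfold sellerPayoff share price
  rw [expect_of_accept_eq_zero hae]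
  simp only [Finset.mem_univ, if_true, winPrice, allBids]
  simp only [integral_mul_const]
  refine (integral_share_mul i
    (fun x => σ.bid (Finset.univ : Finset (Fin N)).card x - x) ?_).trans
    (integral_congr_ae (h.winProb_payoff_of_accept_eq_zero hN hμ hr hF ha0 i).2)
  refine integrable_of_mem_Icc (a := 0) (b := 1) ((measurable_integral_share i).mul
    (((σ.bid_measurable _).comp (measurable_pi_apply i)).sub (measurable_pi_apply i))) ?_
  filter_upwards [pi_ae_of_forall_ae fun _ : Fin N => hμ.ae_mem] with v hv
  have h1 := integral_share_mem (σ := σ) (r := r) i v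
  have h2 := h.undominated (Finset.univ : Finset (Fin N)).card (v i) ⟨(hv i).1.le, (hv i).2.le⟩
  rcases le_or_gt (σ.bid (Finset.univ : Finset (Fin N)).card (v i)) r with h3 | h3
  · exact ⟨mul_nonneg h1.1 (by linarith), mul_le_one₀ h1.2 (by linarith)
      (by linarith [hr.2, (hv i).1])⟩
  · rw [integral_share_of_lt i h3, zero_mul]; exact ⟨le_rfl, zero_le_one⟩

/-- Payments cancel between auctioneer and sellers, leaving only the winning probabilities. Products
of winning probability and bid are integrable because bids above `r` never win. -/
theorem IsFPAContinuation.totalSurplus_of_accept_eq_zero (w : ℝ) :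
    σ.totalSurplus μ .first r p w = N * ∫ x, standardWinProb N μ r x * (w - x) ∂μ := by
  have := hμ.isProbabilityMeasure
  have hae : ∀ i, ∀ᵐ x ∂μ, σ.accept i x = 0 := fun i => by
    filter_upwards [hμ.ae_mem] with x hx using ha0 i x ⟨hx.1, hx.2.le⟩
  set β := σ.bid (Finset.univ : Finset (Fin N)).card with hβ
  set f : Fin N → (Fin N → ℝ) → ℝ := fun i v => ∫ s, winShare r (bidders Finset.univ)
      (allBids β s v) (some i)
      ∂(σ.specBid (Finset.univ : Finset (Fin N)).card : Measure ℝ) with hf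
  have hfm : ∀ i, Measurable (f i) := fun i => measurable_integral_share i
  have hβm : Measurable β := σ.bid_measurable _
  have hf01 : ∀ i v, f i v ∈ Set.Icc (0 : ℝ) 1 := fun i v => integral_share_mem i v
  have hvae := pi_ae_of_forall_ae (ι := Fin N) fun _ : Fin N => hμ.ae_mem
  have hfβ : ∀ i, ∀ᵐ v ∂(Measure.pi fun _ : Fin N => μ), f i v * β (v i) ∈ Set.Icc (0 : ℝ) 1 := by
    intro i
    filter_upwards [hvae] with v hv
    have h2 := h.undominated (Finset.univ : Finset (Fin N)).card (v i) ⟨(hv i).1.le, (hv i).2.le⟩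
    rcases le_or_gt (β (v i)) r with h3 | h3
    · exact ⟨mul_nonneg (hf01 i v).1 ((hv i).1.le.trans h2), mul_le_one₀ (hf01 i v).2
        ((hv i).1.le.trans h2) (h3.trans hr.2)⟩
    · rw [show f i v = 0 from integral_share_of_lt i h3, zero_mul]; exact ⟨le_rfl, zero_le_one⟩
  have hint_f : ∀ i, Integrable (f i) (Measure.pi fun _ => μ) := fun i =>
    integrable_of_mem_Icc (hfm i) (ae_of_all _ (hf01 i))
  have hint_fβ : ∀ i, Integrable (fun v => f i v * β (v i)) (Measure.pi fun _ => μ) := fun i =>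
    integrable_of_mem_Icc ((hfm i).mul (hβm.comp (measurable_pi_apply i))) (hfβ i)
  have hint_fv : ∀ i, Integrable (fun v => f i v * v i) (Measure.pi fun _ => μ) := fun i =>
    integrable_of_mem_Icc (a := 0) (b := 1) ((hfm i).mul (measurable_pi_apply i)) (by
      filter_upwards [hvae] with v hv
      exact ⟨mul_nonneg (hf01 i v).1 (hv i).1.le, mul_le_one₀ (hf01 i v).2 (hv i).1.le (hv i).2.le⟩)
  have hauct : σ.auctioneerPayoff μ .first r w =
      ∑ i, ∫ v, (f i v * w - f i v * β (v i)) ∂(Measure.pi fun _ => μ) := by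
    have hint : ∀ i, Integrable (fun v => f i v * w - f i v * β (v i)) (Measure.pi fun _ => μ) :=
      fun i => ((hint_f i).mul_const w).sub (hint_fβ i)
    unfold auctioneerPayoff share price
    rw [expect_of_accept_eq_zero hae, ← integral_finsetSum _ fun i _ => hint i]
    refine integral_congr_ae (ae_of_all _ fun v => ?_)
    have hb : bidders (Finset.univ : Finset (Fin N)) =
        Finset.univ.map Function.Embedding.some := if_pos rfl
    simp only [hb, Finset.sum_map, winPrice, Function.Embedding.some_apply, allBids]
    rw [integral_finsetSum]
    · refine Finset.sum_congr rfl fun i _ => ?_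
      rw [integral_mul_const, ← mul_sub]
      simp only [hf, hb]
      rfl
    · intro i _
      refine Integrable.mul_const (integrable_of_mem_Icc (a := 0) (b := 1) ?_
        (ae_of_all _ fun s => ⟨winShare_nonneg, winShare_le_one⟩)) _
      exact (measurable_winShare r _ (some i)).comp
        ((measurable_allBids hβm).comp (measurable_const.prodMk measurable_id))
  have hseller : ∀ i, σ.sellerPayoff μ .first r p i =
      ∫ v, (f i v * β (v i) - f i v * v i) ∂(Measure.pi fun _ => μ) := by
    intro i
    unfold sellerPayoff share price
    rw [expect_of_accept_eq_zero hae]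
    simp only [Finset.mem_univ, if_true, winPrice, allBids]
    simp only [integral_mul_const]
    simp only [mul_sub]
    rfl
  unfold totalSurplus
  rw [speculatorPayoff_eq_zero hae, add_zero, hauct, Finset.sum_congr rfl fun i _ => hseller i,
    ← Finset.sum_add_distrib]
  have hi : ∀ i : Fin N, ∫ v, (f i v * w - f i v * β (v i)) ∂(Measure.pi fun _ => μ) +
      ∫ v, (f i v * β (v i) - f i v * v i) ∂(Measure.pi fun _ => μ) =
      ∫ x, standardWinProb N μ r x * (w - x) ∂μ := by
    intro i
    have hint1 : Integrable (fun v => f i v * w - f i v * β (v i)) (Measure.pi fun _ => μ) :=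
      ((hint_f i).mul_const w).sub (hint_fβ i)
    have hint2 : Integrable (fun v => f i v * β (v i) - f i v * v i) (Measure.pi fun _ => μ) :=
      (hint_fβ i).sub (hint_fv i)
    rw [← integral_add hint1 hint2]
    have h1 : ∀ v, f i v * w - f i v * β (v i) + (f i v * β (v i) - f i v * v i) =
        f i v * (w - v i) := fun v => by ring
    simp only [h1]
    refine (integral_share_mul i (fun x => w - x) ?_).trans (integral_congr_ae ?_)
    · have := ((hint_f i).mul_const w).sub (hint_fv i)
      refine this.congr (ae_of_all _ fun v => ?_)
      simp only [Pi.sub_apply, hf]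
      ring
    · filter_upwards [(h.winProb_payoff_of_accept_eq_zero hN hμ hr hF ha0 i).1] with x hx
      rw [hx]
  rw [Finset.sum_congr rfl fun i _ => hi i]
  simp

end NoSpeculation

end Profile

/-! ### The minimum of a family of random values -/

theorem max_sub_zero_eq_integral {x m r : ℝ} (hx : x ≤ r) (hm : m ≤ r) :
    max (m - x) 0 = ∫ y in x..r, (Set.Iio m).indicator (fun _ => (1 : ℝ)) y := by
  rw [intervalIntegral.integral_of_le hx, integral_Ioc_eq_integral_Ioo,
    setIntegral_indicator measurableSet_Iio]
  have : Set.Ioo x r ∩ Set.Iio m = Set.Ioo x m := by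
    ext y
    simp only [Set.mem_inter_iff, Set.mem_Ioo, Set.mem_Iio]
    exact ⟨fun h => ⟨h.1.1, h.2⟩, fun h => ⟨⟨h.1, h.2.trans_le hm⟩, h.2⟩⟩
  rw [this, setIntegral_const, Real.volume_real_Ioo, smul_eq_mul, mul_one]

section Fold

variable {ι : Type} {r : ℝ} {T : Finset ι}

theorem fold_min_mem {v : ι → ℝ} (hr : 0 ≤ r) (hv : ∀ j ∈ T, 0 ≤ v j) :
    T.fold min r v ∈ Set.Icc 0 r :=
  ⟨(Finset.le_fold_min _).2 ⟨hr, hv⟩, (Finset.fold_min_le _).2 (Or.inl le_rfl)⟩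

/-- Layer-cake formula for the positive part of the minimum of independent values. -/
theorem integral_prod_mul_max_fold_min [Fintype ι] [DecidableEq ι] {μ : Measure ℝ} [IsProbabilityMeasure μ]
    (w : ι → ℝ → ℝ) (hw : ∀ j, Measurable (w j)) (hw01 : ∀ j x, w j x ∈ Set.Icc (0 : ℝ) 1)
    {x : ℝ} (hx : x ≤ r) :
    ∫ v, (∏ j ∈ T, w j (v j)) * max (T.fold min r v - x) 0 ∂(Measure.pi fun _ => μ) =
      ∫ y in x..r, ∏ j ∈ T, ∫ z in Set.Ioi y, w j z ∂μ := by
  have hW : Measurable fun v : ι → ℝ => ∏ j ∈ T, w j (v j) :=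
    Finset.measurable_prod _ fun j _ => (hw j).comp (measurable_pi_apply j)
  have hW01 : ∀ v : ι → ℝ, ∏ j ∈ T, w j (v j) ∈ Set.Icc (0 : ℝ) 1 := fun v =>
    ⟨Finset.prod_nonneg fun j _ => (hw01 j _).1,
      Finset.prod_le_one (fun j _ => (hw01 j _).1) fun j _ => (hw01 j _).2⟩
  have h1 : ∀ v : ι → ℝ, (∏ j ∈ T, w j (v j)) * max (T.fold min r v - x) 0 =
      ∫ y in Set.Ioc x r, (∏ j ∈ T, w j (v j)) *
        (Set.Iio (T.fold min r v)).indicator (fun _ => (1 : ℝ)) y := by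
    intro v
    rw [max_sub_zero_eq_integral hx (Finset.fold_min_le _ |>.2 (Or.inl le_rfl)),
      intervalIntegral.integral_of_le hx, integral_const_mul]
  simp only [h1]
  rw [integral_integral_swap, intervalIntegral.integral_of_le hx]
  · rw [integral_Ioc_eq_integral_Ioo, integral_Ioc_eq_integral_Ioo]
    refine setIntegral_congr_fun measurableSet_Ioo fun y hy => ?_
    -- At a fixed level `y < r`, the minimum exceeds `y` iff every coordinate does, so the integrand
    -- is a product over coordinates.
    have h2 : ∀ v : ι → ℝ, (∏ j ∈ T, w j (v j)) *
        (Set.Iio (T.fold min r v)).indicator (fun _ => (1 : ℝ)) y =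
        ∏ j, if j ∈ T then (Set.Ioi y).indicator (w j) (v j) else 1 := by
      intro v
      rw [Finset.prod_ite_mem, Finset.univ_inter]
      by_cases hlt : y < T.fold min r v
      · rw [Set.indicator_of_mem (show y ∈ Set.Iio _ from hlt), mul_one]
        refine Finset.prod_congr rfl fun j hj => ?_
        rw [Set.indicator_of_mem (show v j ∈ Set.Ioi y from (Finset.lt_fold_min _ |>.1 hlt).2 j hj)]
      · rw [Set.indicator_of_notMem (show y ∉ Set.Iio _ from hlt), mul_zero]
        have : ¬ ∀ j ∈ T, y < v j := fun h => hlt (Finset.lt_fold_min _ |>.2 ⟨hy.2, h⟩)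
        push Not at this
        obtain ⟨j, hj, hjy⟩ := this
        exact (Finset.prod_eq_zero hj
          (Set.indicator_of_notMem (show v j ∉ Set.Ioi y from not_lt.2 hjy) _)).symm
    simp only [h2]
    rw [integral_fintype_prod_eq_prod (fun j z => if j ∈ T then (Set.Ioi y).indicator (w j) z else 1),
      ← Finset.prod_subset (Finset.subset_univ T)]
    · refine Finset.prod_congr rfl fun j hj => ?_
      simp only [hj, if_true]
      exact integral_indicator measurableSet_Ioi
    · intro j _ hj
      simp [hj]
  · refine integrable_of_mem_Icc (a := 0) (b := 1) ?_ (ae_of_all _ fun q => ?_)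
    · refine (hW.comp measurable_fst).mul ?_
      have : (fun q : (ι → ℝ) × ℝ =>
          (Set.Iio (T.fold min r q.1)).indicator (fun _ => (1 : ℝ)) q.2) =
          {q : (ι → ℝ) × ℝ | q.2 < T.fold min r q.1}.indicator fun _ => 1 := by
        funext q; simp [Set.indicator]
      change Measurable fun q : (ι → ℝ) × ℝ =>
          (Set.Iio (T.fold min r q.1)).indicator (fun _ => (1 : ℝ)) q.2
      rw [this]
      exact measurable_const.indicator (measurableSet_lt measurable_snd
        ((measurable_fold_min r T).comp measurable_fst))
    · have h0 : (Set.Iio (T.fold min r q.1)).indicator (fun _ => (1 : ℝ)) q.2 ∈ Set.Icc (0 : ℝ) 1 := by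
        by_cases h : q.2 ∈ Set.Iio (T.fold min r q.1)
        · rw [Set.indicator_of_mem h]; exact ⟨zero_le_one, le_rfl⟩
        · rw [Set.indicator_of_notMem h]; exact ⟨le_rfl, zero_le_one⟩
      exact ⟨mul_nonneg (hW01 _).1 h0.1, mul_le_one₀ (hW01 _).2 h0.1 h0.2⟩

end Fold

/-! ### Cutoffs -/

section Threshold

variable {h : ℝ → ℝ} {r : ℝ}

theorem strictMonoOn_add_integral (hh : Antitone h) (h1 : ∀ y, 0 < y → h y < 1) :
    StrictMonoOn (fun x => x + ∫ y in x..r, h y) (Set.Ici 0) := by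
  intro x hx y hy hxy
  have hint : ∀ a b, IntervalIntegrable h volume a b := fun a b => hh.intervalIntegrable
  have h2 := intervalIntegral.integral_add_adjacent_intervals (hint x y) (hint y r)
  have h3 : 0 < ∫ z in x..y, (1 - h z) :=
    intervalIntegral.intervalIntegral_pos_of_pos_on (intervalIntegrable_const.sub (hint x y))
      (fun z hz => sub_pos.2 (h1 z (lt_of_le_of_lt hx hz.1))) hxy
  rw [intervalIntegral.integral_sub intervalIntegrable_const (hint x y)] at h3
  simp only [intervalIntegral.integral_const, smul_eq_mul, mul_one] at h3
  change x + _ < y + _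
  linarith

/-- The function `x + ∫ y in x..r, h y` is continuous, strictly increasing on `[0, ∞)` and equals `r
≥ p` at `r`. If `p` is at most its value at 0, the threshold is the corner 0; hence equality is
claimed only for `c > 0`. -/
theorem exists_threshold (hh : Antitone h) (h1 : ∀ y, 0 < y → h y < 1) (hr : 0 ≤ r) {p : ℝ}
    (hp : p ≤ r) : ∃ c ∈ Set.Icc 0 r, (∀ x ∈ Set.Ioo 0 c, x + (∫ y in x..r, h y) < p) ∧
      (∀ x ∈ Set.Ioc c r, p < x + ∫ y in x..r, h y) ∧ (p ≤ c + ∫ y in c..r, h y) ∧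
      (0 < c → c + (∫ y in c..r, h y) = p) := by
  have hmono := strictMonoOn_add_integral (r := r) hh h1
  have hint : ∀ a b, IntervalIntegrable h volume a b := fun a b => hh.intervalIntegrable
  have hcont : Continuous fun x => x + ∫ y in x..r, h y := by
    refine continuous_id.add ?_
    simp only [intervalIntegral.integral_symm r]
    exact (intervalIntegral.continuous_primitive hint r).neg
  rcases le_or_gt p (0 + ∫ y in (0 : ℝ)..r, h y) with h0 | h0
  · refine ⟨0, ⟨le_rfl, hr⟩, fun x hx => absurd hx.1 (not_lt.2 hx.2.le), fun x hx => ?_, h0,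
      fun h => absurd h (lt_irrefl _)⟩
    exact h0.trans_lt (hmono (Set.mem_Ici.2 le_rfl) (Set.mem_Ici.2 hx.1.le) hx.1)
  · obtain ⟨c, hc, hcp⟩ := intermediate_value_Icc hr hcont.continuousOn
      (show p ∈ Set.Icc _ _ from ⟨h0.le, by simpa using hp⟩)
    refine ⟨c, hc, fun x hx => ?_, fun x hx => ?_, hcp.ge, fun _ => hcp⟩
    · rw [← hcp]; exact hmono hx.1.le hc.1 hx.2
    · rw [← hcp]; exact hmono hc.1 (hc.1.trans hx.1.le) hx.1

end Threshold

/-! ### Truthful bidding in the second-price auction -/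

section Truthful

variable {N : ℕ} {r : ℝ} {R : Finset (Fin N)} {b : Option (Fin N) → ℝ}

theorem winPrice_second_univ (i : Fin N) :
    winPrice .second r (bidders Finset.univ) b (some i) =
      (Finset.univ.erase i).fold min r fun j => b (some j) := by
  classical
  have hb : bidders (Finset.univ : Finset (Fin N)) =
      Finset.univ.map Function.Embedding.some := if_pos rfl
  have : (Finset.univ.map Function.Embedding.some).erase (some i) =
      (Finset.univ.erase i).map Function.Embedding.some :=
    (Finset.map_erase Function.Embedding.some Finset.univ i).symm
  simp only [winPrice, hb]
  refine Eq.trans ?_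
    ((congrArg (fun T : Finset (Option (Fin N)) => T.fold min r b) this).trans ?_)
  · convert rfl
  · rw [Finset.fold_map]; rfl

theorem winPrice_second_none (hR : R ≠ Finset.univ) :
    winPrice .second r (bidders R) b none = R.fold min r fun j => b (some j) := by
  classical
  have hb : bidders R = Finset.insertNone R := if_neg hR
  have : (Finset.insertNone R).erase none = R.map Function.Embedding.some := by
    ext (_ | j) <;> simp
  simp only [winPrice, hb]
  refine Eq.trans ?_
    ((congrArg (fun T : Finset (Option (Fin N)) => T.fold min r b) this).trans ?_)
  · convert rfl
  · rw [Finset.fold_map]; rfl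

/-- The tie-breaking rule plays no role: in a tie at the lowest bid, the price equals the bid and
the margin is 0. -/
theorem winShare_mul_winPrice_sub_univ (i : Fin N) :
    winShare r (bidders Finset.univ) b (some i) *
      (winPrice .second r (bidders Finset.univ) b (some i) - b (some i)) =
      max (((Finset.univ.erase i).fold min r fun j => b (some j)) - b (some i)) 0 := by
  rw [winPrice_second_univ]
  set m := (Finset.univ.erase i).fold min r fun j => b (some j) with hm
  rcases lt_trichotomy (b (some i)) m with h | h | h
  · have h' := (Finset.lt_fold_min _).1 h
    rw [winShare_eq_one (some_mem_bidders.2 (Finset.mem_univ i)) h'.1.le, one_mul,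
      max_eq_left (sub_pos.2 h).le]
    rintro (_ | j) hj hji
    · exact absurd rfl (none_mem_bidders.1 hj)
    · exact h'.2 j (Finset.mem_erase.2 ⟨fun h => hji (by rw [h]), Finset.mem_univ j⟩)
  · simp [h]
  · rw [max_eq_right (by linarith)]
    rcases (Finset.fold_min_lt _).1 h with h' | ⟨j, -, h'⟩
    · rw [winShare_eq_zero_of_lt h', zero_mul]
    · rw [winShare_eq_zero_of_mem (some_mem_bidders.2 (Finset.mem_univ j)) h', zero_mul]

end Truthful

namespace Profile

variable {N : ℕ} {σ : Profile N} {μ : Measure ℝ} {r p : ℝ}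

/-- Against a positive value, the speculator's bid 0 wins whenever he is present, so only the event
that everybody rejects contributes. -/
theorem IsSPAContinuation.rejectPayoff_eq (h : σ.IsSPAContinuation μ r p) (i : Fin N) {x : ℝ}
    (hx : 0 < x) : σ.rejectPayoff μ .second r i x (fun m => σ.bid m x) =
      ∫ v, (∏ j ∈ Finset.univ.erase i, (1 - σ.accept j (v j))) *
        max ((Finset.univ.erase i).fold min r v - x) 0 ∂(Measure.pi fun _ => μ) := by
  unfold rejectPayoff
  refine integral_congr_ae (ae_of_all _ fun v => ?_)
  simp only [h.withholding, integral_dirac, h.truthful]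
  have hβ : ∀ m, σ.bid m = fun z => z := fun m => funext (h.truthful m)
  rw [Finset.sum_eq_single_of_mem Finset.univ (by simp)]
  · have := winShare_mul_winPrice_sub_univ (r := r)
      (b := deviationBids (σ.bid (Finset.univ : Finset (Fin N)).card) 0 v i x) i
    rw [deviationBids_self] at this
    rw [this]
    congr 1
    · exact Finset.prod_congr rfl fun j _ => if_pos (Finset.mem_univ j)
    · congr 2
      refine Finset.fold_congr fun j hj => ?_
      rw [deviationBids_of_ne _ _ _ _ (Finset.ne_of_mem_erase hj), h.truthful]
  · intro R _ hR
    rw [winShare_eq_zero_of_mem (none_mem_bidders.2 hR)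
      (by rw [deviationBids_self, deviationBids_none]; exact hx), zero_mul, mul_zero]

theorem IsSPAContinuation.rejectPayoff_eq_integral [IsProbabilityMeasure μ]
    (h : σ.IsSPAContinuation μ r p) (i : Fin N) {x : ℝ} (hx : 0 < x) (hxr : x ≤ r) :
    σ.rejectPayoff μ .second r i x (fun m => σ.bid m x) =
      ∫ y in x..r, ∏ j ∈ Finset.univ.erase i, ∫ z in Set.Ioi y, (1 - σ.accept j z) ∂μ := by
  rw [h.rejectPayoff_eq i hx]
  exact integral_prod_mul_max_fold_min (fun j z => 1 - σ.accept j z)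
    (fun j => measurable_const.sub (σ.accept_measurable j))
    (fun j z => ⟨by linarith [(σ.accept_mem j z).2], by linarith [(σ.accept_mem j z).1]⟩) hxr

theorem IsSPAContinuation.rejectPayoff_eq_zero (h : σ.IsSPAContinuation μ r p) (i : Fin N) {x : ℝ}
    (hx : 0 < x) (hxr : r < x) : σ.rejectPayoff μ .second r i x (fun m => σ.bid m x) = 0 := by
  rw [h.rejectPayoff_eq i hx]
  have : ∀ v : Fin N → ℝ, max ((Finset.univ.erase i).fold min r v - x) 0 = 0 := fun v =>
    max_eq_right (by
      have : (Finset.univ.erase i).fold min r v ≤ r := (Finset.fold_min_le r).2 (Or.inl le_rfl)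
      linarith)
  simp only [this, mul_zero, integral_zero]

end Profile

/-! ### Cutoff structure of the second-price game -/

/-- The acquisition price that induces the cutoff `c` in the second-price game. -/
def spaPrice (N : ℕ) (μ : Measure ℝ) (r c : ℝ) : ℝ :=
  c + ∫ y in c..r, (1 - cdf μ y) ^ (N - 1)

theorem antitone_one_sub_cdf_pow (μ : Measure ℝ) (n : ℕ) : Antitone fun y => (1 - cdf μ y) ^ n :=
  fun _ _ hxy => pow_le_pow_left₀ (sub_nonneg.2 (cdf_le_one μ _))
    (sub_le_sub_left (monotone_cdf μ hxy) _) n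

theorem IsValueDistribution.cdf_pos_of_pos {μ : Measure ℝ} (hμ : IsValueDistribution μ) {y : ℝ}
    (hy : 0 < y) : 0 < cdf μ y :=
  (hμ.cdf_pos (min y 1) ⟨lt_min hy one_pos, min_le_right _ _⟩).trans_le
    (monotone_cdf μ (min_le_left _ _))

theorem IsValueDistribution.one_sub_cdf_pow_lt_one {μ : Measure ℝ} (hμ : IsValueDistribution μ)
    {n : ℕ} (hn : n ≠ 0) {y : ℝ} (hy : 0 < y) : (1 - cdf μ y) ^ n < 1 :=
  pow_lt_one₀ (sub_nonneg.2 (cdf_le_one μ y)) (by linarith [hμ.cdf_pos_of_pos hy]) hn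

theorem strictMonoOn_spaPrice {N : ℕ} (hN : 2 ≤ N) {μ : Measure ℝ} (hμ : IsValueDistribution μ)
    (r : ℝ) : StrictMonoOn (spaPrice N μ r) (Set.Ici 0) :=
  strictMonoOn_add_integral (antitone_one_sub_cdf_pow μ (N - 1)) fun _ hy =>
    hμ.one_sub_cdf_pow_lt_one (by omega) hy

namespace Profile

variable {N : ℕ} {σ : Profile N} {μ : Measure ℝ} {r p : ℝ}

theorem integral_Ioi_one_sub_accept [IsProbabilityMeasure μ] (hμ : IsValueDistribution μ)
    {a : ℝ → ℝ} {c : ℝ} (h0 : ∀ x ∈ Set.Ioc c 1, a x = 0) {y : ℝ} (hy : c ≤ y) :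
    ∫ z in Set.Ioi y, (1 - a z) ∂μ = 1 - cdf μ y := by
  have h1 : ∀ᵐ z ∂μ, z ∈ Set.Ioi y → 1 - a z = 1 := by
    filter_upwards [hμ.ae_mem] with z hz hzy
    rw [h0 z ⟨hy.trans_lt hzy, hz.2.le⟩, sub_zero]
  rw [setIntegral_congr_ae measurableSet_Ioi h1, setIntegral_const, smul_eq_mul, mul_one,
    measureReal_Ioi_eq]

/-- Each seller has his own threshold against the strategies of the others, and these strategies may
differ. Suppose `c i < c j`. On `[c j, r]` both `i` and `j` reject with certainty, so they face the
same payoff from rejection at value `c j`. There seller `j` is indifferent while seller `i` strictly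
prefers to reject, a contradiction. So the thresholds coincide and the rejection payoff takes the
symmetric form. -/
theorem IsSPAContinuation.exists_cutoff (hN : 2 ≤ N) (hμ : IsValueDistribution μ)
    (hr : r ∈ Set.Ioc (0 : ℝ) 1) (hp : p ≤ r) (h : σ.IsSPAContinuation μ r p) :
    ∃ c ∈ Set.Icc 0 r, (∀ i, ∀ x ∈ Set.Ioo 0 c, σ.accept i x = 1) ∧
      (∀ i, ∀ x ∈ Set.Ioc c 1, σ.accept i x = 0) ∧ p ≤ spaPrice N μ r c ∧
      (0 < c → spaPrice N μ r c = p) := by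
  have := hμ.isProbabilityMeasure
  set H : Fin N → ℝ → ℝ := fun j y => ∫ z in Set.Ioi y, (1 - σ.accept j z) ∂μ with hH
  have h1a : ∀ j z, 1 - σ.accept j z ∈ Set.Icc (0 : ℝ) 1 := fun j z =>
    ⟨by linarith [(σ.accept_mem j z).2], by linarith [(σ.accept_mem j z).1]⟩
  have hint : ∀ j, Integrable (fun z => 1 - σ.accept j z) μ := fun j =>
    integrable_of_mem_Icc (measurable_const.sub (σ.accept_measurable j)) (ae_of_all _ (h1a j))
  have hH0 : ∀ j y, 0 ≤ H j y := fun j y => integral_nonneg fun z => (h1a j z).1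
  have hHanti : ∀ j, Antitone (H j) := fun j y y' hy =>
    setIntegral_mono_set (hint j).integrableOn (ae_of_all _ fun z => (h1a j z).1)
      (Set.Ioi_subset_Ioi hy).eventuallyLE
  have hHle : ∀ j y, H j y ≤ 1 - cdf μ y := fun j y => by
    have h2 := setIntegral_mono (s := Set.Ioi y) (hint j).integrableOn
      (integrable_const (1 : ℝ)).integrableOn fun z => (h1a j z).2
    rwa [setIntegral_const, smul_eq_mul, mul_one, measureReal_Ioi_eq] at h2
  set g : Fin N → ℝ → ℝ := fun i y => ∏ j ∈ Finset.univ.erase i, H j y with hg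
  have hganti : ∀ i, Antitone (g i) := fun i y y' hy =>
    Finset.prod_le_prod (fun j _ => hH0 j _) fun j _ => hHanti j hy
  have hg1 : ∀ i y, 0 < y → g i y < 1 := by
    intro i y hy
    refine lt_of_le_of_lt (Finset.prod_le_prod (fun j _ => hH0 j y) fun j _ => hHle j y) ?_
    rw [Finset.prod_const]
    refine hμ.one_sub_cdf_pow_lt_one ?_ hy
    simp only [Finset.card_erase_of_mem (Finset.mem_univ i), Finset.card_univ, Fintype.card_fin]
    omega
  choose c hc hlt hgt hle heq using fun i => exists_threshold (hganti i) (hg1 i) hr.1.le hp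
  have hV : ∀ i x, 0 < x → x ≤ r → σ.rejectPayoff μ .second r i x (fun m => σ.bid m x) =
      ∫ y in x..r, g i y := fun i x hx hxr => h.rejectPayoff_eq_integral i hx hxr
  have ha1 : ∀ i, ∀ x ∈ Set.Ioo 0 (c i), σ.accept i x = 1 := by
    intro i x hx
    refine le_antisymm (σ.accept_mem i x).2 (not_lt.1 fun hlt1 => ?_)
    have hxr : x ≤ r := hx.2.le.trans (hc i).2
    have h3 := h.acceptanceRational.reject i x ⟨hx.1.le, hxr.trans hr.2⟩ hlt1
    rw [hV i x hx.1 hxr] at h3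
    linarith [hlt i x hx]
  have ha0 : ∀ i, ∀ x ∈ Set.Ioc (c i) 1, σ.accept i x = 0 := by
    intro i x hx
    refine le_antisymm (not_lt.1 fun hpos => ?_) (σ.accept_mem i x).1
    have hx0 : 0 < x := (hc i).1.trans_lt hx.1
    have h3 := h.acceptanceRational.accept i x ⟨hx0.le, hx.2⟩ hpos (fun m => σ.bid m x)
    rcases le_or_gt x r with hxr | hxr
    · rw [hV i x hx0 hxr] at h3
      linarith [hgt i x ⟨hx.1, hxr⟩]
    · rw [h.rejectPayoff_eq_zero i hx0 hxr] at h3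
      linarith
  have hHeq : ∀ j y, c j ≤ y → H j y = 1 - cdf μ y := fun j y hy =>
    integral_Ioi_one_sub_accept hμ (ha0 j) hy
  have hcle : ∀ i j, c j ≤ c i := by
    intro i j
    by_contra! hij
    have hji : j ≠ i := fun h => by rw [h] at hij; exact lt_irrefl _ hij
    have h4 : ∫ y in (c j)..r, g i y = ∫ y in (c j)..r, g j y := by
      refine intervalIntegral.integral_congr fun y hy => ?_
      rw [Set.uIcc_of_le (hc j).2] at hy
      change ∏ k ∈ Finset.univ.erase i, H k y = ∏ k ∈ Finset.univ.erase j, H k y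
      rw [← Finset.mul_prod_erase _ _ (Finset.mem_erase.2 ⟨hji, Finset.mem_univ j⟩),
        ← Finset.mul_prod_erase (Finset.univ.erase j) _
          (Finset.mem_erase.2 ⟨hji.symm, Finset.mem_univ i⟩),
        Finset.erase_right_comm, hHeq j y hy.1, hHeq i y (hij.le.trans hy.1)]
    have h5 := hgt i (c j) ⟨hij, (hc j).2⟩
    rw [h4, heq j ((hc i).1.trans_lt hij)] at h5
    exact lt_irrefl _ h5
  set i₀ : Fin N := ⟨0, by omega⟩
  have hci : ∀ i, c i = c i₀ := fun i => le_antisymm (hcle _ _) (hcle _ _)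
  have hprice : c i₀ + ∫ y in (c i₀)..r, g i₀ y = spaPrice N μ r (c i₀) := by
    unfold spaPrice
    congr 1
    refine intervalIntegral.integral_congr fun y hy => ?_
    rw [Set.uIcc_of_le (hc i₀).2] at hy
    change ∏ k ∈ Finset.univ.erase i₀, H k y = _
    rw [Finset.prod_congr rfl fun k _ => hHeq k y ((hci k).le.trans hy.1), Finset.prod_const]
    simp
  refine ⟨c i₀, hc i₀, fun i => hci i ▸ ha1 i, fun i => hci i ▸ ha0 i, hprice ▸ hle i₀, fun hpos => ?_⟩
  rw [← hprice]
  exact heq i₀ hpos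

end Profile

theorem integral_lt_integral_of_ae_le {α : Type*} [MeasurableSpace α] {ν : Measure α}
    {f g : α → ℝ} (hf : Integrable f ν) (hg : Integrable g ν) (hle : ∀ᵐ x ∂ν, f x ≤ g x)
    (hlt : ν {x | f x < g x} ≠ 0) : ∫ x, f x ∂ν < ∫ x, g x ∂ν := by
  refine lt_of_le_of_ne (integral_mono_ae hf hg hle) fun heq => hlt ?_
  have h := (integral_eq_iff_of_ae_le hf hg hle).1 heq
  exact measure_mono_null (fun x (hx : f x < g x) (h' : f x = g x) => hx.ne h') h

/-! ### Outcomes of the second-price game at a given cutoff -/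

section Rejectors

variable {N : ℕ} {c : ℝ}

/-- The sellers with values above the cutoff `c`. -/
def rejectors (c : ℝ) (v : Fin N → ℝ) : Finset (Fin N) := Finset.univ.filter fun i => c < v i

theorem mem_rejectors {v : Fin N → ℝ} {i : Fin N} : i ∈ rejectors c v ↔ c < v i := by
  simp [rejectors]

theorem rejectors_eq_univ_iff {v : Fin N → ℝ} : rejectors c v = Finset.univ ↔ ∀ i, c < v i := by
  simp [Finset.eq_univ_iff_forall, mem_rejectors]

theorem measurableSet_rejectors_eq (c : ℝ) (R : Finset (Fin N)) :
    MeasurableSet {v : Fin N → ℝ | rejectors c v = R} := by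
  have : {v : Fin N → ℝ | rejectors c v = R} =
      ⋂ i, if i ∈ R then {v | c < v i} else {v | v i ≤ c} := by
    ext v
    simp only [Set.mem_ofPred_eq, Set.mem_iInter, Finset.ext_iff, mem_rejectors]
    refine forall_congr' fun i => ?_
    by_cases hi : i ∈ R <;> simp [hi]
  rw [this]
  refine MeasurableSet.iInter fun i => ?_
  split_ifs
  · exact measurableSet_lt measurable_const (measurable_pi_apply i)
  · exact measurableSet_le (measurable_pi_apply i) measurable_const

theorem measurable_of_rejectors {X : Finset (Fin N) → (Fin N → ℝ) → ℝ}
    (hX : ∀ R, Measurable (X R)) : Measurable fun v => X (rejectors c v) v := by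
  have : (fun v => X (rejectors c v) v) =
      fun v => ∑ R, ({v | rejectors c v = R} : Set (Fin N → ℝ)).indicator (X R) v := by
    funext v
    simp [Set.indicator_apply]
  rw [this]
  exact Finset.measurable_sum _ fun R _ => (hX R).indicator (measurableSet_rejectors_eq c R)

end Rejectors

namespace Profile

variable {N : ℕ} {σ : Profile N} {μ : Measure ℝ} {r p c : ℝ}

theorem IsSPAContinuation.expect_eq (hμ : IsValueDistribution μ) (h : σ.IsSPAContinuation μ r p)
    (ha1 : ∀ i, ∀ x ∈ Set.Ioo 0 c, σ.accept i x = 1) (ha0 : ∀ i, ∀ x ∈ Set.Ioc c 1, σ.accept i x = 0)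
    (X : Finset (Fin N) → (Fin N → ℝ) → ℝ → ℝ) :
    σ.expect μ X = ∫ v, X (rejectors c v) v 0 ∂(Measure.pi fun _ => μ) := by
  have := hμ.isProbabilityMeasure
  have := hμ.nullSingletonClass
  unfold expect
  simp only [h.withholding, integral_dirac]
  refine integral_congr_ae ?_
  filter_upwards [pi_ae_of_forall_ae fun _ : Fin N => hμ.ae_mem,
    pi_ae_of_forall_ae fun _ : Fin N => Measure.ae_ne μ c] with v hv hvc
  have hacc : ∀ i, σ.accept i (v i) = if c < v i then 0 else 1 := by
    intro i
    split_ifs with hlt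
    · exact ha0 i _ ⟨hlt, (hv i).2.le⟩
    · exact ha1 i _ ⟨(hv i).1, lt_of_le_of_ne (not_lt.1 hlt) (hvc i)⟩
  rw [Finset.sum_eq_single_of_mem (rejectors c v) (Finset.mem_univ _)]
  · rw [Finset.prod_eq_one, one_mul]
    intro i _
    rw [hacc i]
    by_cases hlt : c < v i
    · simp [mem_rejectors, hlt]
    · simp [mem_rejectors, hlt]
  · intro R _ hR
    obtain ⟨i, hi⟩ : ∃ i, ¬ (i ∈ R ↔ c < v i) := by
      by_contra! hall
      exact hR (Finset.ext fun i => (hall i).trans mem_rejectors.symm)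
    rw [Finset.prod_eq_zero (Finset.mem_univ i), zero_mul]
    rw [hacc i]
    by_cases hlt : c < v i
    · have : i ∉ R := fun hiR => hi ⟨fun _ => hlt, fun _ => hiR⟩
      simp [this, hlt]
    · have : i ∈ R := by
        by_contra hiR
        exact hi ⟨fun h => absurd h hiR, fun h => absurd h hlt⟩
      simp [this, hlt]

theorem integral_max_fold_min [IsProbabilityMeasure μ] (i : Fin N) (x : ℝ) :
    ∫ v, max ((Finset.univ.erase i).fold min r v - x) 0 ∂(Measure.pi fun _ => μ) =
      standardPayoff N μ r x := by
  unfold standardPayoff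
  split_ifs with hx
  · have h := integral_prod_mul_max_fold_min (μ := μ) (T := Finset.univ.erase i) (r := r)
      (fun _ _ => 1) (fun _ => measurable_const) (fun _ _ => ⟨zero_le_one, le_rfl⟩) hx
    simp only [Finset.prod_const_one, one_mul] at h
    rw [h]
    simp only [setIntegral_const, smul_eq_mul, mul_one, measureReal_Ioi_eq, Finset.prod_const]
    simp
  · have : ∀ v : Fin N → ℝ, max ((Finset.univ.erase i).fold min r v - x) 0 = 0 := fun v =>
      max_eq_right (by
        have : (Finset.univ.erase i).fold min r v ≤ r := (Finset.fold_min_le r).2 (Or.inl le_rfl)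
        linarith)
    simp only [this, integral_zero]

theorem fold_min_erase_update (i : Fin N) (v : Fin N → ℝ) (x : ℝ) :
    (Finset.univ.erase i).fold min r (Function.update v i x) = (Finset.univ.erase i).fold min r v :=
  Finset.fold_congr fun _ hj => Function.update_of_ne (Finset.ne_of_mem_erase hj) _ _

theorem allBids_truthful (h : σ.IsSPAContinuation μ r p) (m : ℕ) (s : ℝ) (v : Fin N → ℝ)
    (i : Fin N) : allBids (σ.bid m) s v (some i) = v i := h.truthful m (v i)

/-- One formula covers both cases: if some seller accepted, the rejecting seller loses to the
speculator, and the positive part is 0 as well because an accepting seller has a lower value. -/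
theorem IsSPAContinuation.share_mul_sub (h : σ.IsSPAContinuation μ r p) {v : Fin N → ℝ}
    {i : Fin N} (hv : 0 < v i) (hi : c < v i) :
    σ.share r (rejectors c v) v 0 (some i) * (σ.price .second r (rejectors c v) v 0 (some i) - v i) =
      max ((Finset.univ.erase i).fold min r v - v i) 0 := by
  by_cases hR : rejectors c v = Finset.univ
  · rw [hR]
    have := winShare_mul_winPrice_sub_univ (r := r)
      (b := allBids (σ.bid (Finset.univ : Finset (Fin N)).card) 0 v) i
    simp only [allBids_truthful h] at this
    exact this
  · obtain ⟨j, hj⟩ : ∃ j, ¬ c < v j := by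
      by_contra! hall
      exact hR (rejectors_eq_univ_iff.2 hall)
    have hji : j ≠ i := fun h => hj (h ▸ hi)
    have hle : (Finset.univ.erase i).fold min r v ≤ v j :=
      (Finset.fold_min_le _).2 (Or.inr ⟨j, Finset.mem_erase.2 ⟨hji, Finset.mem_univ j⟩, le_rfl⟩)
    rw [max_eq_right (by linarith [not_lt.1 hj])]
    unfold share
    rw [winShare_eq_zero_of_mem (none_mem_bidders.2 hR), zero_mul]
    rw [allBids_truthful h]
    exact hv

theorem IsSPAContinuation.spec_share_mul_price (h : σ.IsSPAContinuation μ r p) {v : Fin N → ℝ}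
    (hr : 0 ≤ r) (hv : ∀ i, 0 < v i) (R : Finset (Fin N)) :
    σ.share r R v 0 none * σ.price .second r R v 0 none =
      if R = Finset.univ then 0 else R.fold min r v := by
  split_ifs with hR
  · unfold share
    rw [winShare_eq_zero_of_notMem fun hn => none_mem_bidders.1 hn hR, zero_mul]
  · unfold share price
    rw [winShare_eq_one (none_mem_bidders.2 hR) hr, one_mul, winPrice_second_none hR]
    · exact Finset.fold_congr fun i _ => allBids_truthful h _ _ _ _
    · rintro (_ | j) hj hne
      · exact absurd rfl hne
      · rw [allBids_truthful h]; exact hv j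

end Profile

/-! ### Sellers' payoffs in the second-price game -/

theorem measurable_standardPayoff (N : ℕ) (μ : Measure ℝ) (r : ℝ) :
    Measurable (standardPayoff N μ r) := by
  refine Measurable.ite measurableSet_Iic ?_ measurable_const
  simp only [intervalIntegral.integral_symm r]
  exact (intervalIntegral.continuous_primitive
    (fun _ _ => (antitone_one_sub_cdf_pow μ (N - 1)).intervalIntegrable) r).measurable.neg

theorem standardPayoff_mem (N : ℕ) (μ : Measure ℝ) {r x : ℝ} (hx : 0 ≤ x) (hr : r ≤ 1) :
    standardPayoff N μ r x ∈ Set.Icc (0 : ℝ) 1 := by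
  unfold standardPayoff
  split_ifs with hxr
  · have hint : ∀ a b, IntervalIntegrable (fun y => (1 - cdf μ y) ^ (N - 1)) volume a b :=
      fun _ _ => (antitone_one_sub_cdf_pow μ (N - 1)).intervalIntegrable
    refine ⟨intervalIntegral.integral_nonneg hxr fun y _ =>
      pow_nonneg (sub_nonneg.2 (cdf_le_one μ y)) _, ?_⟩
    have := intervalIntegral.integral_mono_on hxr (hint x r) (intervalIntegrable_const (c := (1 : ℝ)))
      fun y _ => pow_le_one₀ (sub_nonneg.2 (cdf_le_one μ y)) (by linarith [cdf_nonneg μ y])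
    simp only [intervalIntegral.integral_const, smul_eq_mul, mul_one] at this
    linarith
  · exact ⟨le_rfl, zero_le_one⟩

namespace Profile

variable {N : ℕ} {σ : Profile N} {μ : Measure ℝ} {r p c : ℝ}

theorem IsSPAContinuation.sellerPayoff_eq (hμ : IsValueDistribution μ)
    (hr : r ∈ Set.Ioc (0 : ℝ) 1) (h : σ.IsSPAContinuation μ r p)
    (ha1 : ∀ i, ∀ x ∈ Set.Ioo 0 c, σ.accept i x = 1)
    (ha0 : ∀ i, ∀ x ∈ Set.Ioc c 1, σ.accept i x = 0) (i : Fin N) :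
    σ.sellerPayoff μ .second r p i =
      ∫ x, (if c < x then standardPayoff N μ r x else p - x) ∂μ := by
  have := hμ.isProbabilityMeasure
  have hae := pi_ae_of_forall_ae fun _ : Fin N => hμ.ae_mem
  unfold sellerPayoff
  rw [h.expect_eq hμ ha1 ha0]
  have h1 : ∫ v, (if i ∈ rejectors c v then σ.share r (rejectors c v) v 0 (some i) *
      (σ.price .second r (rejectors c v) v 0 (some i) - v i) else p - v i)
      ∂(Measure.pi fun _ => μ) =
      ∫ v, (if c < v i then max ((Finset.univ.erase i).fold min r v - v i) 0 else p - v i)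
      ∂(Measure.pi fun _ => μ) := by
    refine integral_congr_ae ?_
    filter_upwards [hae] with v hv
    simp only [mem_rejectors]
    split_ifs with hi
    · exact h.share_mul_sub (hv i).1 hi
    · rfl
  rw [h1, integral_pi_update μ i]
  · refine integral_congr_ae (ae_of_all _ fun x => ?_)
    simp only [Function.update_self, fold_min_erase_update]
    split_ifs with hx
    · exact integral_max_fold_min i x
    · simp
  · refine integrable_of_mem_Icc (a := min 0 (p - 1)) (b := max 1 p) ?_ ?_
    · exact Measurable.ite (measurableSet_lt measurable_const (measurable_pi_apply i))
        (((measurable_fold_min r _).sub (measurable_pi_apply i)).max measurable_const)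
        (measurable_const.sub (measurable_pi_apply i))
    · filter_upwards [hae] with v hv
      have hfold : (Finset.univ.erase i).fold min r v ≤ r :=
        (Finset.fold_min_le r).2 (Or.inl le_rfl)
      split_ifs with hi
      · exact ⟨(min_le_left _ _).trans (le_max_right _ _),
          (max_le (by linarith [hr.2, (hv i).1]) zero_le_one).trans (le_max_left _ _)⟩
      · exact ⟨(min_le_right _ _).trans (by linarith [(hv i).2]),
          le_trans (by linarith [(hv i).1]) (le_max_right _ _)⟩

/-- Rejecting types keep their standard payoff. Types `x < c` gain strictly, since `x` plus the
standard payoff is strictly increasing and equals `p` at `c`; these types have positive probability.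
-/
theorem IsSPAContinuation.lt_sellerPayoff (hN : 2 ≤ N) (hμ : IsValueDistribution μ)
    (hr : r ∈ Set.Ioc (0 : ℝ) 1) (h : σ.IsSPAContinuation μ r p) (hc : 0 < c) (hcr : c ≤ r)
    (ha1 : ∀ i, ∀ x ∈ Set.Ioo 0 c, σ.accept i x = 1)
    (ha0 : ∀ i, ∀ x ∈ Set.Ioc c 1, σ.accept i x = 0) (hp : spaPrice N μ r c = p) (i : Fin N) :
    ∫ x, standardPayoff N μ r x ∂μ < σ.sellerPayoff μ .second r p i := by
  have := hμ.isProbabilityMeasure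
  have := hμ.nullSingletonClass
  rw [h.sellerPayoff_eq hμ hr ha1 ha0 i]
  have hlt : ∀ x, 0 < x → x < c → standardPayoff N μ r x < p - x := by
    intro x hx hxc
    have h1 := strictMonoOn_spaPrice hN hμ r (Set.mem_Ici.2 hx.le) (Set.mem_Ici.2 hc.le) hxc
    unfold standardPayoff
    rw [if_pos (hxc.le.trans hcr), ← hp]
    unfold spaPrice at h1 ⊢
    linarith
  have hle : ∀ᵐ x ∂μ, standardPayoff N μ r x ≤ if c < x then standardPayoff N μ r x else p - x := by
    filter_upwards [hμ.ae_mem, Measure.ae_ne μ c] with x hx hxc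
    split_ifs with hcx
    · exact le_rfl
    · exact (hlt x hx.1 (lt_of_le_of_ne (not_lt.1 hcx) hxc)).le
  have hint1 : Integrable (standardPayoff N μ r) μ :=
    integrable_of_mem_Icc (measurable_standardPayoff N μ r) (by
      filter_upwards [hμ.ae_mem] with x hx using standardPayoff_mem N μ hx.1.le hr.2)
  have hint2 : Integrable (fun x => if c < x then standardPayoff N μ r x else p - x) μ := by
    refine integrable_of_mem_Icc (a := min 0 (p - 1)) (b := max 1 p)
      (Measurable.ite measurableSet_Ioi (measurable_standardPayoff N μ r)
        (measurable_const.sub measurable_id)) ?_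
    filter_upwards [hμ.ae_mem] with x hx
    have := standardPayoff_mem N μ hx.1.le hr.2
    split_ifs
    · exact ⟨(min_le_left _ _).trans this.1, this.2.trans (le_max_left _ _)⟩
    · exact ⟨(min_le_right _ _).trans (by linarith [hx.2]),
          le_trans (by linarith [hx.1]) (le_max_right _ _)⟩
  refine integral_lt_integral_of_ae_le hint1 hint2 hle ?_
  intro hzero
  have h2 : μ (Set.Ioo 0 c) = 0 := measure_mono_null (fun x hx => by
    simp only [Set.mem_ofPred_eq]
    rw [if_neg (not_lt.2 hx.2.le)]
    exact hlt x hx.1 hx.2) hzero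
  have h3 := hμ.cdf_pos_of_pos hc
  rw [cdf_eq_real, measureReal_def] at h3
  have h4 : μ (Set.Iic c) = 0 := by
    refine le_antisymm ((measure_mono_ae ?_).trans h2.le) bot_le
    filter_upwards [hμ.ae_mem, Measure.ae_ne μ c] with x hx hxc hxle
    exact ⟨hx.1, lt_of_le_of_ne hxle hxc⟩
  rw [h4] at h3
  simp at h3

end Profile

/-! ### Profitable offers in the second-price game -/

section Revenue

variable {N : ℕ} {r c t : ℝ}

/-- Lower bound for the speculator's revenue: one seller accepts, or `i₀` and `i₁` accept while
the others are above `t`. -/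
theorem sum_indicator_add_indicator_le {i₀ i₁ : Fin N} (h01 : i₀ ≠ i₁) (hc : 0 ≤ c) (hct : c < t)
    (htr : t ≤ r) {v : Fin N → ℝ} (hv : ∀ i, 0 ≤ v i) :
    (∑ i, (Set.Iic c).indicator (fun _ => (1 : ℝ)) (v i) *
      (c * {v : Fin N → ℝ | ∀ j ∈ Finset.univ.erase i, v j ∈ Set.Ioi c}.indicator (fun _ => 1) v +
        max ((Finset.univ.erase i).fold min r v - c) 0)) +
      t * {v : Fin N → ℝ | ∀ j ∈ Finset.univ, v j ∈ if j = i₀ ∨ j = i₁ then Set.Iic c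
        else Set.Ioi t}.indicator (fun _ => 1) v ≤
      if rejectors c v = Finset.univ then 0 else (rejectors c v).fold min r v := by
  have hcr : c ≤ r := hct.le.trans htr
  -- If exactly one seller accepts, his summand is `c + (M - c)`, the exact revenue, and the event
  -- with two acceptances is excluded.
  by_cases hone : ∃ i, v i ≤ c ∧ ∀ j ∈ Finset.univ.erase i, v j ∈ Set.Ioi c
  · obtain ⟨i, hi, hj⟩ := hone
    have hR : rejectors c v = Finset.univ.erase i := by
      ext j
      rw [mem_rejectors]
      refine ⟨fun hlt => Finset.mem_erase.2 ⟨fun hji => ?_, Finset.mem_univ j⟩, hj j⟩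
      rw [hji] at hlt; exact absurd hi (not_le.2 hlt)
    have hne : rejectors c v ≠ Finset.univ := fun h => absurd hi (not_le.2 (rejectors_eq_univ_iff.1 h i))
    rw [if_neg hne, hR, Finset.sum_eq_single_of_mem i (Finset.mem_univ i),
      Set.indicator_of_mem (show v i ∈ Set.Iic c from hi), Set.indicator_of_mem (show v ∈ {v : Fin N → ℝ | ∀ j ∈ Finset.univ.erase i, v j ∈ Set.Ioi c} from hj),
      Set.indicator_of_notMem]
    · have : c ≤ (Finset.univ.erase i).fold min r v :=
        (Finset.le_fold_min c).2 ⟨hcr, fun j hj' => (hj j hj').le⟩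
      rw [max_eq_left (by linarith)]
      linarith
    · intro hB
      have hB0 := hB i₀ (Finset.mem_univ _)
      have hB1 := hB i₁ (Finset.mem_univ _)
      simp only [true_or, or_true, if_true, Set.mem_Iic] at hB0 hB1
      by_cases h0 : i₀ = i
      · exact absurd hB1 (not_le.2 (hj i₁ (Finset.mem_erase.2 ⟨fun h => h01 (h0.trans h.symm),
          Finset.mem_univ _⟩)))
      · exact absurd hB0 (not_le.2 (hj i₀ (Finset.mem_erase.2 ⟨h0, Finset.mem_univ _⟩)))
    · intro k _ hk
      rw [Set.indicator_of_notMem, zero_mul]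
      exact fun h => absurd (show v k ≤ c from h)
        (not_le.2 (hj k (Finset.mem_erase.2 ⟨hk, Finset.mem_univ _⟩)))
  · push Not at hone
    rw [Finset.sum_eq_zero, zero_add]
    · by_cases hB : v ∈ {v : Fin N → ℝ | ∀ j ∈ Finset.univ, v j ∈ if j = i₀ ∨ j = i₁ then Set.Iic c
        else Set.Ioi t}
      · rw [Set.indicator_of_mem hB, mul_one]
        have hB0 := hB i₀ (Finset.mem_univ _)
        simp only [true_or, if_true, Set.mem_Iic] at hB0
        rw [if_neg fun h => absurd hB0 (not_le.2 (rejectors_eq_univ_iff.1 h i₀))]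
        refine (Finset.le_fold_min t).2 ⟨htr, fun j hj => ?_⟩
        have hBj := hB j (Finset.mem_univ _)
        split_ifs at hBj
        · exact absurd hBj (not_le.2 (mem_rejectors.1 hj))
        · exact (show t < v j from hBj).le
      · rw [Set.indicator_of_notMem hB, mul_zero]
        split_ifs
        · exact le_rfl
        · exact (fold_min_mem (hc.trans hcr) fun j _ => hv j).1
    · intro i _
      by_cases hi : v i ≤ c
      · obtain ⟨j, hj, hjc⟩ := hone i hi
        have hjc' : v j ≤ c := not_lt.1 hjc
        have : (Finset.univ.erase i).fold min r v ≤ c := (Finset.fold_min_le c).2 (Or.inr ⟨j, hj, hjc'⟩)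
        rw [Set.indicator_of_notMem (s := {v : Fin N → ℝ | ∀ j ∈ Finset.univ.erase i, v j ∈ Set.Ioi c})
          fun h => hjc (h j hj),
          max_eq_right (by linarith)]
        ring
      · rw [Set.indicator_of_notMem (show v i ∉ Set.Iic c from hi), zero_mul]

end Revenue

theorem integrable_rejectors_fold_min {N : ℕ} {μ : Measure ℝ} (hμ : IsValueDistribution μ)
    {r c : ℝ} (hr : 0 ≤ r) : Integrable (fun v : Fin N → ℝ =>
      if rejectors c v = Finset.univ then 0 else (rejectors c v).fold min r v)
      (Measure.pi fun _ => μ) := by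
  have := hμ.isProbabilityMeasure
  refine integrable_of_mem_Icc (a := 0) (b := r) (measurable_of_rejectors
    (X := fun R v => if R = Finset.univ then 0 else R.fold min r v) fun R => ?_) ?_
  · split_ifs
    · exact measurable_const
    · exact measurable_fold_min r R
  · filter_upwards [pi_ae_of_forall_ae fun _ : Fin N => hμ.ae_mem] with v hv
    split_ifs
    · exact ⟨le_rfl, hr⟩
    · exact fold_min_mem hr fun j _ => (hv j).1.le

namespace Profile

variable {N : ℕ} {σ : Profile N} {μ : Measure ℝ} {r p c t : ℝ}

theorem IsSPAContinuation.speculatorPayoff_eq (hμ : IsValueDistribution μ)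
    (hr : r ∈ Set.Ioc (0 : ℝ) 1) (h : σ.IsSPAContinuation μ r p)
    (ha1 : ∀ i, ∀ x ∈ Set.Ioo 0 c, σ.accept i x = 1)
    (ha0 : ∀ i, ∀ x ∈ Set.Ioc c 1, σ.accept i x = 0) :
    σ.speculatorPayoff μ .second r p =
      ∫ v, (if rejectors c v = Finset.univ then 0 else (rejectors c v).fold min r v)
        ∂(Measure.pi fun _ : Fin N => μ) - p * (N * cdf μ c) := by
  have := hμ.isProbabilityMeasure
  have hae := pi_ae_of_forall_ae fun _ : Fin N => hμ.ae_mem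
  have hint1 : Integrable (fun v : Fin N → ℝ =>
      if rejectors c v = Finset.univ then 0 else (rejectors c v).fold min r v)
      (Measure.pi fun _ => μ) := integrable_rejectors_fold_min hμ hr.1.le
  have hint3 : ∀ i, Integrable (fun v : Fin N → ℝ =>
      (Set.Iic c).indicator (fun _ => (1 : ℝ)) (v i)) (Measure.pi fun _ => μ) := fun i =>
    integrable_of_mem_Icc (a := 0) (b := 1)
      ((measurable_const.indicator measurableSet_Iic).comp (measurable_pi_apply i))
      (ae_of_all _ fun v => ⟨Set.indicator_nonneg (fun _ _ => zero_le_one) _,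
        Set.indicator_le_self' (fun _ _ => zero_le_one) _⟩)
  have hint2 : Integrable (fun v : Fin N → ℝ =>
      p * ∑ i, (Set.Iic c).indicator (fun _ => (1 : ℝ)) (v i)) (Measure.pi fun _ => μ) :=
    (integrable_finsetSum _ fun i _ => hint3 i).const_mul p
  have hcard : ∫ v : Fin N → ℝ, p * ∑ i, (Set.Iic c).indicator (fun _ => (1 : ℝ)) (v i)
      ∂(Measure.pi fun _ => μ) = p * (N * cdf μ c) := by
    rw [integral_const_mul, integral_finsetSum _ fun i _ => hint3 i]
    congr 1
    have : ∀ i : Fin N, ∫ v : Fin N → ℝ, (Set.Iic c).indicator (fun _ => (1 : ℝ)) (v i)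
        ∂(Measure.pi fun _ => μ) = cdf μ c := by
      intro i
      rw [integral_pi_update μ i (hint3 i)]
      simp only [Function.update_self, integral_const, probReal_univ, one_smul]
      rw [integral_indicator measurableSet_Iic, setIntegral_const, smul_eq_mul, mul_one, cdf_eq_real]
    simp [this]
  rw [← hcard, ← integral_sub hint1 hint2]
  unfold speculatorPayoff
  rw [h.expect_eq hμ ha1 ha0]
  refine integral_congr_ae ?_
  filter_upwards [hae] with v hv
  rw [h.spec_share_mul_price hr.1.le fun i => (hv i).1]
  congr 2
  have : (rejectors c v)ᶜ = Finset.univ.filter fun i => v i ≤ c := by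
    ext i; simp [mem_rejectors]
  rw [this, ← Finset.sum_boole]
  simp [Set.indicator_apply]

/-- The expectation of `(M - c)⁺` is `p - c`, so the terms with one acceptance recover the
acquisition costs up to `N * F * c * (1 - (1 - F) ^ (N - 1))`. This loss and the gain from two
acceptances are both of order `F ^ 2`, and `hsmall` makes the gain the larger one. -/
theorem IsSPAContinuation.speculatorPayoff_pos (hN : 2 ≤ N) (hμ : IsValueDistribution μ)
    (hr : r ∈ Set.Ioc (0 : ℝ) 1) (h : σ.IsSPAContinuation μ r p) (hc : 0 < c) (hct : c < t)
    (htr : t ≤ r) (hsmall : N * (N - 1) * c < t * (1 - cdf μ t) ^ (N - 2))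
    (ha1 : ∀ i, ∀ x ∈ Set.Ioo 0 c, σ.accept i x = 1)
    (ha0 : ∀ i, ∀ x ∈ Set.Ioc c 1, σ.accept i x = 0) (hp : spaPrice N μ r c = p) :
    0 < σ.speculatorPayoff μ .second r p := by
  have := hμ.isProbabilityMeasure
  have hae := pi_ae_of_forall_ae fun _ : Fin N => hμ.ae_mem
  have hcr : c ≤ r := hct.le.trans htr
  set i₀ : Fin N := ⟨0, by omega⟩
  set i₁ : Fin N := ⟨1, by omega⟩
  have h01 : i₀ ≠ i₁ := by simp [i₀, i₁]
  rw [h.speculatorPayoff_eq hμ hr ha1 ha0]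
  set F := cdf μ c with hF
  have hFpos : 0 < F := hμ.cdf_pos_of_pos hc
  have hF1 : F ≤ 1 := cdf_le_one μ c
  set B : Set (Fin N → ℝ) := {v | ∀ j ∈ Finset.univ, v j ∈ if j = i₀ ∨ j = i₁ then Set.Iic c
        else Set.Ioi t} with hB
  set D : Fin N → Set (Fin N → ℝ) := fun i => {v | ∀ j ∈ Finset.univ.erase i, v j ∈ Set.Ioi c}
    with hD
  have hmeas_box : ∀ (T : Finset (Fin N)) (s : Fin N → Set ℝ), (∀ j, MeasurableSet (s j)) →
      MeasurableSet {v : Fin N → ℝ | ∀ j ∈ T, v j ∈ s j} := by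
    intro T s hs
    have : {v : Fin N → ℝ | ∀ j ∈ T, v j ∈ s j} = ⋂ j ∈ T, {v | v j ∈ s j} := by ext; simp
    rw [this]
    exact T.measurableSet_biInter fun j _ => measurable_pi_apply j (hs j)
  have hBm : MeasurableSet B := hmeas_box _ _ fun j => by
    split_ifs
    exacts [measurableSet_Iic, measurableSet_Ioi]
  have hDm : ∀ i, MeasurableSet (D i) := fun i => hmeas_box _ _ fun _ => measurableSet_Ioi
  set g : Fin N → (Fin N → ℝ) → ℝ := fun i v =>
    c * (D i).indicator (fun _ => 1) v + max ((Finset.univ.erase i).fold min r v - c) 0 with hg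
  have hint_D : ∀ i, Integrable (fun v => c * (D i).indicator (fun _ => (1 : ℝ)) v)
      (Measure.pi fun _ => μ) := fun i =>
    ((integrable_const (1 : ℝ)).indicator (hDm i)).const_mul c
  have hint_m : ∀ i, Integrable (fun v : Fin N → ℝ => max ((Finset.univ.erase i).fold min r v - c) 0)
      (Measure.pi fun _ => μ) := fun i => by
    refine integrable_of_mem_Icc (a := 0) (b := r)
      (((measurable_fold_min r _).sub measurable_const).max measurable_const)
      (ae_of_all _ fun v => ⟨le_max_right _ _, max_le ?_ hr.1.le⟩)
    have : (Finset.univ.erase i).fold min r v ≤ r := (Finset.fold_min_le r).2 (Or.inl le_rfl)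
    linarith
  have hint_g : ∀ i, Integrable (g i) (Measure.pi fun _ => μ) := fun i => (hint_D i).add (hint_m i)
  have hint_Ig : ∀ i, Integrable (fun v : Fin N → ℝ =>
      (Set.Iic c).indicator (fun _ => (1 : ℝ)) (v i) * g i v) (Measure.pi fun _ => μ) := fun i => by
    refine ((hint_g i).indicator (s := (fun v : Fin N → ℝ => v i) ⁻¹' Set.Iic c)
      (measurable_pi_apply i measurableSet_Iic)).congr (ae_of_all _ fun v => ?_)
    by_cases hv : v i ∈ Set.Iic c
    · rw [Set.indicator_of_mem (show v ∈ (fun v : Fin N → ℝ => v i) ⁻¹' Set.Iic c from hv)]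
      simp only [Set.indicator_of_mem hv, one_mul]
    · rw [Set.indicator_of_notMem (show v ∉ (fun v : Fin N → ℝ => v i) ⁻¹' Set.Iic c from hv)]
      simp only [Set.indicator_of_notMem hv, zero_mul]
  have hint_B : Integrable (fun v => t * B.indicator (fun _ => (1 : ℝ)) v)
      (Measure.pi fun _ => μ) := ((integrable_const (1 : ℝ)).indicator hBm).const_mul t
  have hint_rev : Integrable (fun v : Fin N → ℝ =>
      if rejectors c v = Finset.univ then 0 else (rejectors c v).fold min r v)
      (Measure.pi fun _ => μ) := integrable_rejectors_fold_min hμ hr.1.le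
  have hint_sum : Integrable (fun v : Fin N → ℝ =>
      ∑ i, (Set.Iic c).indicator (fun _ => (1 : ℝ)) (v i) * g i v) (Measure.pi fun _ => μ) :=
    integrable_finsetSum _ fun i _ => hint_Ig i
  have hlow := integral_mono_ae (hint_sum.add hint_B) hint_rev (by
    filter_upwards [hae] with v hv
    exact sum_indicator_add_indicator_le h01 hc.le hct htr fun i => (hv i).1.le)
  have hIg : ∀ i, ∫ v, (Set.Iic c).indicator (fun _ => (1 : ℝ)) (v i) * g i v
      ∂(Measure.pi fun _ => μ) = F * (c * (1 - F) ^ (N - 1) + (p - c)) := by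
    intro i
    have hgu : ∀ v x, g i (Function.update v i x) = g i v := by
      intro v x
      simp only [hg, fold_min_erase_update]
      have : (Function.update v i x ∈ D i) ↔ v ∈ D i :=
        forall₂_congr fun j hj => by rw [Function.update_of_ne (Finset.ne_of_mem_erase hj)]
      simp only [Set.indicator_apply, this]
    have hgi : ∫ v, g i v ∂(Measure.pi fun _ => μ) = c * (1 - F) ^ (N - 1) + (p - c) := by
      simp only [hg]
      rw [integral_add (hint_D i) (hint_m i), integral_max_fold_min, integral_const_mul,
        integral_indicator (hDm i), setIntegral_const, smul_eq_mul, mul_one,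
        pi_real_box μ _ fun _ => Set.Ioi c, Finset.prod_const, measureReal_Ioi_eq,
        Finset.card_erase_of_mem (Finset.mem_univ i), Finset.card_univ, Fintype.card_fin]
      congr 1
      unfold standardPayoff
      rw [if_pos hcr, ← hp]
      unfold spaPrice
      ring
    rw [integral_pi_update μ i (hint_Ig i)]
    simp only [Function.update_self, hgu, integral_const_mul, integral_mul_const, hgi]
    rw [integral_indicator measurableSet_Iic, setIntegral_const, smul_eq_mul, mul_one, hF, cdf_eq_real]
  have hBi : ∫ v, t * B.indicator (fun _ => (1 : ℝ)) v ∂(Measure.pi fun _ => μ) =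
      t * (F * F * (1 - cdf μ t) ^ (N - 2)) := by
    rw [integral_const_mul, integral_indicator hBm, setIntegral_const, smul_eq_mul, mul_one,
      pi_real_box μ _ fun j => if j = i₀ ∨ j = i₁ then Set.Iic c else Set.Ioi t,
      ← Finset.mul_prod_erase _ _ (Finset.mem_univ i₀),
      ← Finset.mul_prod_erase _ _ (Finset.mem_erase.2 ⟨h01.symm, Finset.mem_univ i₁⟩),
      Finset.prod_congr rfl (g := fun _ => 1 - cdf μ t)]
    · simp only [true_or, or_true, if_true, Finset.prod_const, ← cdf_eq_real, ← hF]
      rw [Finset.card_erase_of_mem (Finset.mem_erase.2 ⟨h01.symm, Finset.mem_univ i₁⟩),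
        Finset.card_erase_of_mem (Finset.mem_univ i₀), Finset.card_univ, Fintype.card_fin,
        Nat.sub_sub]
      ring
    · intro j hj
      have h1 := (Finset.mem_erase.1 hj).1
      have h2 := (Finset.mem_erase.1 (Finset.mem_erase.1 hj).2).1
      rw [if_neg (by tauto), measureReal_Ioi_eq]
  have hsplit : ∫ v, ((fun v : Fin N → ℝ => ∑ i, (Set.Iic c).indicator (fun _ => (1 : ℝ)) (v i) *
      g i v) + fun v => t * B.indicator (fun _ => (1 : ℝ)) v) v ∂(Measure.pi fun _ => μ) =
      N * (F * (c * (1 - F) ^ (N - 1) + (p - c))) + t * (F * F * (1 - cdf μ t) ^ (N - 2)) := by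
    rw [integral_add' hint_sum hint_B, hBi, integral_finsetSum _ fun i _ => hint_Ig i,
      Finset.sum_congr rfl fun i _ => hIg i]
    simp
  rw [hsplit] at hlow
  -- Bernoulli's inequality bounds the loss by `N * (N - 1) * c * F ^ 2`.
  have hbern : 1 - (N - 1) * F ≤ (1 - F) ^ (N - 1) := by
    have := one_add_mul_le_pow (a := -F) (by linarith) (N - 1)
    rw [Nat.cast_sub (by omega), Nat.cast_one] at this
    calc 1 - ((N : ℝ) - 1) * F = 1 + ((N : ℝ) - 1) * -F := by ring
      _ ≤ (1 + -F) ^ (N - 1) := this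
      _ = (1 - F) ^ (N - 1) := by ring
  have h1 : N * F * c * (1 - (N - 1) * F) ≤ N * F * c * (1 - F) ^ (N - 1) :=
    mul_le_mul_of_nonneg_left hbern (by positivity)
  have h2 := mul_lt_mul_of_pos_left hsmall (mul_pos hFpos hFpos)
  nlinarith

end Profile

theorem exists_small_cutoff {N : ℕ} (hN : 2 ≤ N) {μ : Measure ℝ} {t : ℝ} (ht : 0 < t)
    (hF : cdf μ t < 1) : ∃ c, 0 < c ∧ c < t ∧
      N * (N - 1) * c < t * (1 - cdf μ t) ^ (N - 2) := by
  have hN' : (2 : ℝ) ≤ N := by exact_mod_cast hN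
  have hK : (0 : ℝ) < N * (N - 1) := mul_pos (by linarith) (by linarith)
  have hq : 0 < t * (1 - cdf μ t) ^ (N - 2) := mul_pos ht (pow_pos (sub_pos.2 hF) _)
  obtain ⟨c, hc0, hc⟩ := exists_between (lt_min ht (div_pos hq hK))
  refine ⟨c, hc0, hc.trans_le (min_le_left _ _), ?_⟩
  have := hc.trans_le (min_le_right _ _)
  rwa [lt_div_iff₀ hK, mul_comm] at this

/-- The speculator makes a profit in the second-price game. -/
theorem IsSPAEquilibrium.exists_cutoff {N : ℕ} (hN : 2 ≤ N) {μ : Measure ℝ}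
    (hμ : IsValueDistribution μ) {r : ℝ} (hr : r ∈ Set.Ioc (0 : ℝ) 1) (hF : ∀ v < r, cdf μ v < 1)
    {E : SpeculationStrategy N} (hE : IsSPAEquilibrium μ r E) :
    0 < (E.after E.offer).speculatorPayoff μ .second r E.offer ∧
    ∃ c, 0 < c ∧ c ≤ r ∧ (∀ i, ∀ x ∈ Set.Ioo 0 c, (E.after E.offer).accept i x = 1) ∧
      (∀ i, ∀ x ∈ Set.Ioc c 1, (E.after E.offer).accept i x = 0) ∧
      spaPrice N μ r c = E.offer := by
  have := hμ.isProbabilityMeasure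
  have hmono := strictMonoOn_spaPrice hN hμ r
  -- Any level strictly between 0 and `r` could replace `r / 2`; the values exceed it with positive
  -- probability.
  obtain ⟨c, hc0, hct, hsmall⟩ := exists_small_cutoff hN (half_pos hr.1) (hF (r / 2) (half_lt_self hr.1))
  have htr : r / 2 ≤ r := half_le_self hr.1.le
  have hcr : c ≤ r := hct.le.trans htr
  have hmem : spaPrice N μ r c ∈ Set.Icc 0 r := by
    constructor
    · exact add_nonneg hc0.le (intervalIntegral.integral_nonneg hcr fun y _ =>
        pow_nonneg (sub_nonneg.2 (cdf_le_one μ y)) _)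
    · have := hmono.monotoneOn (Set.mem_Ici.2 hc0.le) (Set.mem_Ici.2 hr.1.le) hcr
      simpa [spaPrice] using this
  have hpos : 0 < (E.after E.offer).speculatorPayoff μ .second r E.offer := by
    refine lt_of_lt_of_le ?_ (hE.optimal _ hmem)
    have hcont := hE.continuation _ hmem
    obtain ⟨c', hc', ha1, ha0, hle, heq⟩ := hcont.exists_cutoff hN hμ hr hmem.2
    -- The offer was chosen as the price of the cutoff `c`; since it exceeds the price of the cutoff
    -- 0, every continuation has a positive cutoff, which strict monotonicity identifies with `c`.
    have hc'pos : 0 < c' := by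
      refine lt_of_le_of_ne hc'.1 fun h => ?_
      rw [← h] at hle
      exact absurd hle (not_le.2 (hmono (Set.mem_Ici.2 le_rfl) (Set.mem_Ici.2 hc0.le) hc0))
    have hcc : c' = c := hmono.injOn (Set.mem_Ici.2 hc'.1) (Set.mem_Ici.2 hc0.le) (heq hc'pos)
    subst hcc
    exact hcont.speculatorPayoff_pos hN hμ hr hc0 hct htr hsmall ha1 ha0 rfl
  refine ⟨hpos, ?_⟩
  obtain ⟨c', hc', ha1, ha0, -, heq⟩ :=
    (hE.continuation _ hE.offer_mem).exists_cutoff hN hμ hr hE.offer_mem.2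
  have hc'pos : 0 < c' := by
    refine lt_of_le_of_ne hc'.1 fun h => ?_
    rw [← h] at ha0
    rw [Profile.speculatorPayoff_eq_zero fun i => by
      filter_upwards [hμ.ae_mem] with x hx using ha0 i x ⟨hx.1, hx.2.le⟩] at hpos
    exact lt_irrefl _ hpos
  exact ⟨c', hc'pos, hc'.2, ha1, ha0, heq hc'pos⟩

/-! ### Total surplus -/

theorem ae_pi_ne {ι : Type*} [Fintype ι] (μ : Measure ℝ) [IsProbabilityMeasure μ]
    [NullSingletonClass μ] :
    ∀ᵐ v ∂(Measure.pi fun _ : ι => μ), ∀ i j, i ≠ j → v i ≠ v j := by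
  classical
  refine ae_all_iff.2 fun i => ae_all_iff.2 fun j => ?_
  by_cases hij : i = j
  · simp [hij]
  have hm : MeasurableSet {v : ι → ℝ | i ≠ j → v i ≠ v j} := by
    have : {v : ι → ℝ | i ≠ j → v i ≠ v j} = {v | v i = v j}ᶜ := by ext v; simp [hij]
    rw [this]
    exact (measurableSet_eq_fun (measurable_pi_apply i) (measurable_pi_apply j)).compl
  have h := measurePreserving_update μ i
  rw [← h.map_eq, ae_map_iff h.measurable.aemeasurable hm]
  refine (Measure.ae_prod_iff_ae_ae (h.measurable hm)).2 ?_
  refine ae_of_all _ fun x => ?_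
  filter_upwards [(Measure.quasiMeasurePreserving_eval (μ := fun _ : ι => μ) j).ae
    (Measure.ae_ne μ x)] with v hv _
  rw [Function.update_self, Function.update_of_ne (Ne.symm hij)]
  exact hv.symm

/-- Total surplus in the auction without speculation. -/
def standardSurplus {N : ℕ} (r w : ℝ) (v : Fin N → ℝ) : ℝ :=
  ∑ i, {v : Fin N → ℝ | v i < r ∧ ∀ j ∈ Finset.univ.erase i, v i < v j}.indicator
    (fun v => w - v i) v

section StandardSurplus

variable {N : ℕ} {r w c : ℝ}

theorem standardSurplus_eq_of_forall_lt {v : Fin N → ℝ} {i : Fin N} (hi : v i < r)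
    (h : ∀ j, j ≠ i → v i < v j) : standardSurplus r w v = w - v i := by
  unfold standardSurplus
  rw [Finset.sum_eq_single_of_mem i (Finset.mem_univ i)]
  · exact Set.indicator_of_mem (s := {v : Fin N → ℝ | v i < r ∧ ∀ j ∈ Finset.univ.erase i, v i < v j})
      ⟨hi, fun j hj => h j (Finset.ne_of_mem_erase hj)⟩ _
  · intro k _ hk
    refine Set.indicator_of_notMem
      (s := {v : Fin N → ℝ | v k < r ∧ ∀ j ∈ Finset.univ.erase k, v k < v j}) (fun hmem => ?_) _
    exact lt_asymm (h k hk) (hmem.2 i (Finset.mem_erase.2 ⟨hk.symm, Finset.mem_univ i⟩))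

theorem sum_winShare_mul_sub {v : Fin N → ℝ} (hvr : ∀ i, v i ≠ r)
    (hne : ∀ i j, i ≠ j → v i ≠ v j) {b : Option (Fin N) → ℝ} (hb : ∀ i, b (some i) = v i) :
    ∑ i, winShare r (bidders Finset.univ) b (some i) * (w - v i) = standardSurplus r w v := by
  unfold standardSurplus
  refine Finset.sum_congr rfl fun i _ => ?_
  by_cases hi : v ∈ {v : Fin N → ℝ | v i < r ∧ ∀ j ∈ Finset.univ.erase i, v i < v j}
  · rw [Set.indicator_of_mem hi, winShare_eq_one (some_mem_bidders.2 (Finset.mem_univ i))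
      (by rw [hb]; exact hi.1.le), one_mul]
    rintro (_ | j) hj hji
    · exact absurd rfl (none_mem_bidders.1 hj)
    · rw [hb, hb]
      exact hi.2 j (Finset.mem_erase.2 ⟨fun h => hji (by rw [h]), Finset.mem_univ j⟩)
  · rw [Set.indicator_of_notMem hi]
    by_cases hir : v i < r
    · have : ∃ j ∈ Finset.univ.erase i, v j ≤ v i := by
        by_contra! hall
        exact hi ⟨hir, hall⟩
      obtain ⟨j, hj, hji⟩ := this
      rw [winShare_eq_zero_of_mem (some_mem_bidders.2 (Finset.mem_univ j)), zero_mul]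
      rw [hb, hb]
      exact lt_of_le_of_ne hji (hne j i (Finset.ne_of_mem_erase hj))
    · rw [winShare_eq_zero_of_lt, zero_mul]
      rw [hb]
      exact lt_of_le_of_ne (not_lt.1 hir) (hvr i).symm

/-- If someone accepts, the lowest value is at most `c ≤ r`, so trade also takes place without
speculation, and `w` enters both sides alike. Speculation costs the sum of all values sold to the
speculator instead of the lowest one, which is strictly more when two sellers accept. -/
theorem sub_sum_le_standardSurplus (hcr : c ≤ r) {v : Fin N → ℝ} (hv : ∀ i, 0 < v i)
    (hvr : ∀ i, v i ≠ r) (hne : ∀ i j, i ≠ j → v i ≠ v j) (hR : ∃ k, v k ≤ c) :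
    w - ∑ i, (if c < v i then 0 else v i) ≤ standardSurplus r w v ∧
    ((∃ k l, k ≠ l ∧ v k ≤ c ∧ v l ≤ c) →
      w - ∑ i, (if c < v i then 0 else v i) < standardSurplus r w v) := by
  obtain ⟨k, hk⟩ := hR
  obtain ⟨i, -, hmin⟩ := Finset.exists_min_image Finset.univ v ⟨k, Finset.mem_univ k⟩
  have hic : v i ≤ c := (hmin k (Finset.mem_univ k)).trans hk
  rw [standardSurplus_eq_of_forall_lt (lt_of_le_of_ne (hic.trans hcr) (hvr i)) fun j hj =>
    lt_of_le_of_ne (hmin j (Finset.mem_univ j)) (hne i j hj.symm)]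
  have hnn : ∀ j, 0 ≤ if c < v j then 0 else v j := fun j => by
    split_ifs
    · exact le_rfl
    · exact (hv j).le
  have hi : (if c < v i then 0 else v i) = v i := if_neg (not_lt.2 hic)
  constructor
  · have := Finset.single_le_sum (f := fun j => if c < v j then 0 else v j) (fun j _ => hnn j)
      (Finset.mem_univ i)
    simp only [hi] at this
    linarith
  · rintro ⟨k, l, hkl, hkc, hlc⟩
    obtain ⟨j, hji, hjc⟩ : ∃ j, j ≠ i ∧ v j ≤ c := by
      by_cases h : k = i
      · exact ⟨l, fun hl => hkl (h.trans hl.symm), hlc⟩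
      · exact ⟨k, h, hkc⟩
    have := Finset.single_lt_sum (f := fun j => if c < v j then 0 else v j) hji
      (Finset.mem_univ i) (Finset.mem_univ j) (by rw [if_neg (not_lt.2 hjc)]; exact hv j)
      (fun j _ _ => hnn j)
    simp only [hi] at this
    linarith

theorem measurableSet_standard_winner (r : ℝ) (i : Fin N) : MeasurableSet
    {v : Fin N → ℝ | v i < r ∧ ∀ j ∈ Finset.univ.erase i, v i < v j} := by
  refine (measurableSet_lt (measurable_pi_apply i) measurable_const).inter ?_
  have : {v : Fin N → ℝ | ∀ j ∈ Finset.univ.erase i, v i < v j} =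
      ⋂ j ∈ Finset.univ.erase i, {v | v i < v j} := by ext; simp
  change MeasurableSet {v : Fin N → ℝ | ∀ j ∈ Finset.univ.erase i, v i < v j}
  rw [this]
  exact (Finset.univ.erase i).measurableSet_biInter fun j _ =>
    measurableSet_lt (measurable_pi_apply i) (measurable_pi_apply j)

theorem integrable_standardSurplus_term {μ : Measure ℝ} (hμ : IsValueDistribution μ) (i : Fin N) :
    Integrable (fun v : Fin N → ℝ =>
      {v : Fin N → ℝ | v i < r ∧ ∀ j ∈ Finset.univ.erase i, v i < v j}.indicator
        (fun v => w - v i) v) (Measure.pi fun _ => μ) := by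
  have := hμ.isProbabilityMeasure
  refine Integrable.indicator (integrable_of_mem_Icc (a := w - 1) (b := w)
    (measurable_const.sub (measurable_pi_apply i)) ?_) (measurableSet_standard_winner r i)
  filter_upwards [pi_ae_of_forall_ae fun _ : Fin N => hμ.ae_mem] with v hv
  exact ⟨by linarith [(hv i).2], by linarith [(hv i).1]⟩

theorem integral_standardSurplus {μ : Measure ℝ} (hμ : IsValueDistribution μ) :
    ∫ v : Fin N → ℝ, standardSurplus r w v ∂(Measure.pi fun _ => μ) =
      N * ∫ x, standardWinProb N μ r x * (w - x) ∂μ := by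
  have := hμ.isProbabilityMeasure
  unfold standardSurplus
  rw [integral_finsetSum _ fun i _ => integrable_standardSurplus_term hμ i]
  have : ∀ i : Fin N, ∫ v : Fin N → ℝ,
      {v : Fin N → ℝ | v i < r ∧ ∀ j ∈ Finset.univ.erase i, v i < v j}.indicator
        (fun v => w - v i) v ∂(Measure.pi fun _ => μ) =
      ∫ x, standardWinProb N μ r x * (w - x) ∂μ := by
    intro i
    rw [integral_pi_update μ i (integrable_standardSurplus_term hμ i)]
    refine integral_congr_ae (ae_of_all _ fun x => ?_)
    have hupd : ∀ v : Fin N → ℝ,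
        {v : Fin N → ℝ | v i < r ∧ ∀ j ∈ Finset.univ.erase i, v i < v j}.indicator
          (fun v => w - v i) (Function.update v i x) =
        {v : Fin N → ℝ | ∀ j ∈ Finset.univ.erase i, v j ∈ Set.Ioi x}.indicator
          (fun _ => w - x) v * if x < r then 1 else 0 := by
      intro v
      have hiff : (∀ j ∈ Finset.univ.erase i, x < Function.update v i x j) ↔
          ∀ j ∈ Finset.univ.erase i, x < v j := by
        refine forall₂_congr fun j hj => ?_
        rw [Function.update_of_ne (Finset.ne_of_mem_erase hj)]
      by_cases hx : x < r
      · simp only [Set.indicator_apply, Set.mem_ofPred_eq, hiff, Function.update_self, hx, true_and,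
          if_true, Set.mem_Ioi, mul_one]
      · rw [if_neg hx, mul_zero]
        refine Set.indicator_of_notMem (fun h => hx ?_) _
        have := h.1
        rwa [Function.update_self] at this
    simp only [hupd]
    unfold standardWinProb
    split_ifs with hx
    · simp only [mul_one]
      rw [integral_indicator, setIntegral_const, smul_eq_mul,
        pi_real_box μ _ fun _ => Set.Ioi x, Finset.prod_const, measureReal_Ioi_eq]
      · simp
      · have : {v : Fin N → ℝ | ∀ j ∈ Finset.univ.erase i, v j ∈ Set.Ioi x} =
            ⋂ j ∈ Finset.univ.erase i, {v | v j ∈ Set.Ioi x} := by ext; simp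
        rw [this]
        exact (Finset.univ.erase i).measurableSet_biInter fun j _ =>
          measurable_pi_apply j measurableSet_Ioi
    · simp
  rw [Finset.sum_congr rfl fun i _ => this i]
  simp

end StandardSurplus

namespace Profile

variable {N : ℕ} {σ : Profile N} {μ : Measure ℝ} {r p c : ℝ}

theorem measurable_share_left (σ : Profile N) (r : ℝ) (R : Finset (Fin N)) (s : ℝ)
    (o : Option (Fin N)) : Measurable fun v => σ.share r R v s o :=
  (σ.measurable_share r R o).comp (measurable_id.prodMk measurable_const)

theorem measurable_price_left (σ : Profile N) (fmt : AuctionFormat) (r : ℝ) (R : Finset (Fin N))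
    (s : ℝ) (o : Option (Fin N)) : Measurable fun v => σ.price fmt r R v s o :=
  (measurable_winPrice fmt r (bidders R) o).comp
    ((measurable_allBids (σ.bid_measurable _)).comp (measurable_id.prodMk measurable_const))

theorem IsSPAContinuation.price_mem (h : σ.IsSPAContinuation μ r p) (hr : 0 ≤ r)
    {v : Fin N → ℝ} (hv : ∀ i, 0 ≤ v i) (R : Finset (Fin N)) (o : Option (Fin N)) :
    σ.price .second r R v 0 o ∈ Set.Icc 0 r := by
  refine fold_min_mem hr ?_
  rintro (_ | j) -
  · exact le_rfl
  · rw [allBids_truthful h]; exact hv j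

/-- All payments cancel, including the acquisition price; a seller who accepts enters with minus his
value because he gives up his item. -/
theorem IsSPAContinuation.totalSurplus_eq (hμ : IsValueDistribution μ)
    (hr : r ∈ Set.Ioc (0 : ℝ) 1) (h : σ.IsSPAContinuation μ r p)
    (ha1 : ∀ i, ∀ x ∈ Set.Ioo 0 c, σ.accept i x = 1)
    (ha0 : ∀ i, ∀ x ∈ Set.Ioc c 1, σ.accept i x = 0) (w : ℝ) :
    σ.totalSurplus μ .second r p w = ∫ v, (σ.share r (rejectors c v) v 0 none * w +
      ∑ i, if i ∈ rejectors c v then σ.share r (rejectors c v) v 0 (some i) * (w - v i)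
        else - v i) ∂(Measure.pi fun _ => μ) ∧
    Integrable (fun v => σ.share r (rejectors c v) v 0 none * w +
      ∑ i, if i ∈ rejectors c v then σ.share r (rejectors c v) v 0 (some i) * (w - v i)
        else - v i) (Measure.pi fun _ => μ) := by
  have := hμ.isProbabilityMeasure
  have hae := pi_ae_of_forall_ae fun _ : Fin N => hμ.ae_mem
  have hint_auct : ∀ o, Integrable (fun v => σ.share r (rejectors c v) v 0 o *
      (w - σ.price .second r (rejectors c v) v 0 o)) (Measure.pi fun _ => μ) := by
    intro o
    refine integrable_of_mem_Icc (a := -(|w| + 1)) (b := |w| + 1) (measurable_of_rejectors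
      (X := fun R v => σ.share r R v 0 o * (w - σ.price .second r R v 0 o)) fun R =>
        (σ.measurable_share_left r R 0 o).mul
          (measurable_const.sub (σ.measurable_price_left .second r R 0 o))) ?_
    filter_upwards [hae] with v hv
    have h1 := h.price_mem hr.1.le (fun i => (hv i).1.le) (rejectors c v) o
    rw [Set.mem_Icc, ← abs_le, abs_mul]
    have h2 : |σ.share r (rejectors c v) v 0 o| ≤ 1 := by
      unfold share
      rw [abs_of_nonneg winShare_nonneg]; exact winShare_le_one
    have h3 : |w - σ.price .second r (rejectors c v) v 0 o| ≤ |w| + 1 := by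
      refine (abs_sub _ _).trans ?_
      rw [abs_of_nonneg h1.1]
      linarith [h1.2, hr.2]
    calc _ ≤ 1 * (|w| + 1) := mul_le_mul h2 h3 (abs_nonneg _) zero_le_one
      _ = _ := one_mul _
  have hint_spec : Integrable (fun v => σ.share r (rejectors c v) v 0 none *
      σ.price .second r (rejectors c v) v 0 none - p * ((rejectors c v)ᶜ.card : ℝ))
      (Measure.pi fun _ => μ) := by
    refine Integrable.sub (integrable_of_mem_Icc (a := 0) (b := r) (measurable_of_rejectors
      (X := fun R v => σ.share r R v 0 none * σ.price .second r R v 0 none) fun R =>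
        (σ.measurable_share_left r R 0 none).mul (σ.measurable_price_left .second r R 0 none)) ?_)
      (Integrable.const_mul (integrable_of_mem_Icc (a := 0) (b := N) (measurable_of_rejectors
        (X := fun R _ => (Rᶜ.card : ℝ)) fun R => measurable_const) (ae_of_all _ fun v => ?_)) p)
    · filter_upwards [hae] with v hv
      have h1 := h.price_mem hr.1.le (fun i => (hv i).1.le) (rejectors c v) none
      exact ⟨mul_nonneg winShare_nonneg h1.1,
        (mul_le_of_le_one_left h1.1 winShare_le_one).trans h1.2⟩
    · refine ⟨Nat.cast_nonneg _, ?_⟩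
      have := Finset.card_le_univ (rejectors c v)ᶜ
      rw [Fintype.card_fin] at this
      exact_mod_cast this
  have hint_seller : ∀ i, Integrable (fun v => if i ∈ rejectors c v then
      σ.share r (rejectors c v) v 0 (some i) *
        (σ.price .second r (rejectors c v) v 0 (some i) - v i) else p - v i)
      (Measure.pi fun _ => μ) := by
    intro i
    refine integrable_of_mem_Icc (a := min (-1) (p - 1)) (b := max 1 p) (measurable_of_rejectors
      (X := fun R v => if i ∈ R then σ.share r R v 0 (some i) *
        (σ.price .second r R v 0 (some i) - v i) else p - v i) fun R => ?_) ?_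
    · split_ifs
      · exact (σ.measurable_share_left r R 0 (some i)).mul
          ((σ.measurable_price_left .second r R 0 (some i)).sub (measurable_pi_apply i))
      · exact measurable_const.sub (measurable_pi_apply i)
    · filter_upwards [hae] with v hv
      have h1 := h.price_mem hr.1.le (fun i => (hv i).1.le) (rejectors c v) (some i)
      split_ifs with hi
      · rw [h.share_mul_sub (hv i).1 (mem_rejectors.1 hi)]
        have hfold : (Finset.univ.erase i).fold min r v ≤ r :=
          (Finset.fold_min_le r).2 (Or.inl le_rfl)
        exact ⟨(min_le_left _ _).trans (le_trans (by norm_num) (le_max_right _ _)),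
          (max_le (by linarith [hr.2, (hv i).1]) zero_le_one).trans (le_max_left _ _)⟩
      · exact ⟨(min_le_right _ _).trans (by linarith [(hv i).2]),
          le_trans (by linarith [(hv i).1]) (le_max_right _ _)⟩
  have hauct : σ.auctioneerPayoff μ .second r w = ∫ v, ∑ o, σ.share r (rejectors c v) v 0 o *
      (w - σ.price .second r (rejectors c v) v 0 o) ∂(Measure.pi fun _ => μ) := by
    unfold auctioneerPayoff
    rw [h.expect_eq hμ ha1 ha0]
    refine integral_congr_ae (ae_of_all _ fun v => ?_)
    refine Finset.sum_subset (Finset.subset_univ _) fun o _ ho => ?_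
    unfold share
    rw [winShare_eq_zero_of_notMem ho, zero_mul]
  have hint_A := integrable_finsetSum Finset.univ fun o _ => hint_auct o
  have hint_S := integrable_finsetSum Finset.univ fun i _ => hint_seller i
  have hsum : ∀ v : Fin N → ℝ, (∑ o, σ.share r (rejectors c v) v 0 o *
      (w - σ.price .second r (rejectors c v) v 0 o)) + (σ.share r (rejectors c v) v 0 none *
      σ.price .second r (rejectors c v) v 0 none - p * ((rejectors c v)ᶜ.card : ℝ)) +
      (∑ i, if i ∈ rejectors c v then σ.share r (rejectors c v) v 0 (some i) *
        (σ.price .second r (rejectors c v) v 0 (some i) - v i) else p - v i) =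
      σ.share r (rejectors c v) v 0 none * w +
      ∑ i, if i ∈ rejectors c v then σ.share r (rejectors c v) v 0 (some i) * (w - v i)
        else - v i := by
    intro v
    have hcard : p * ((rejectors c v)ᶜ.card : ℝ) = ∑ i, if i ∈ rejectors c v then 0 else p := by
      have : (rejectors c v)ᶜ = Finset.univ.filter fun i => i ∉ rejectors c v := by ext; simp
      rw [this, ← Finset.sum_boole, Finset.mul_sum]
      refine Finset.sum_congr rfl fun i _ => ?_
      split_ifs <;> simp_all
    have hcomb : (∑ i, σ.share r (rejectors c v) v 0 (some i) *
        (w - σ.price .second r (rejectors c v) v 0 (some i))) -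
        (∑ i, if i ∈ rejectors c v then 0 else p) +
        (∑ i, if i ∈ rejectors c v then σ.share r (rejectors c v) v 0 (some i) *
          (σ.price .second r (rejectors c v) v 0 (some i) - v i) else p - v i) =
        ∑ i, if i ∈ rejectors c v then σ.share r (rejectors c v) v 0 (some i) * (w - v i)
          else - v i := by
      rw [← Finset.sum_sub_distrib, ← Finset.sum_add_distrib]
      refine Finset.sum_congr rfl fun i _ => ?_
      split_ifs with hi
      · ring
      · have : σ.share r (rejectors c v) v 0 (some i) = 0 :=
          winShare_eq_zero_of_notMem fun h => hi (some_mem_bidders.1 h)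
        rw [this]; ring
    rw [Fintype.sum_option, hcard, ← hcomb]
    ring
  have hint := (hint_A.add hint_spec).add hint_S
  refine ⟨?_, hint.congr (ae_of_all _ hsum)⟩
  unfold totalSurplus
  have hspec : σ.speculatorPayoff μ .second r p = ∫ v, (σ.share r (rejectors c v) v 0 none *
      σ.price .second r (rejectors c v) v 0 none - p * ((rejectors c v)ᶜ.card : ℝ))
      ∂(Measure.pi fun _ => μ) := h.expect_eq hμ ha1 ha0 _
  have hseller : ∀ i, σ.sellerPayoff μ .second r p i = ∫ v, (if i ∈ rejectors c v then
      σ.share r (rejectors c v) v 0 (some i) *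
        (σ.price .second r (rejectors c v) v 0 (some i) - v i) else p - v i)
      ∂(Measure.pi fun _ => μ) := fun i => h.expect_eq hμ ha1 ha0 _
  rw [hauct, hspec, Finset.sum_congr rfl fun i _ => hseller i,
    ← integral_finsetSum _ fun i _ => hint_seller i, ← integral_add' hint_A hint_spec,
    ← integral_add' (hint_A.add hint_spec) hint_S]
  exact integral_congr_ae (ae_of_all _ hsum)

theorem IsSPAContinuation.totalSurplus_lt (hN : 2 ≤ N) (hμ : IsValueDistribution μ)
    (hr : r ∈ Set.Ioc (0 : ℝ) 1) (h : σ.IsSPAContinuation μ r p) (hc : 0 < c) (hcr : c ≤ r)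
    (ha1 : ∀ i, ∀ x ∈ Set.Ioo 0 c, σ.accept i x = 1)
    (ha0 : ∀ i, ∀ x ∈ Set.Ioc c 1, σ.accept i x = 0) (w : ℝ) :
    σ.totalSurplus μ .second r p w < N * ∫ x, standardWinProb N μ r x * (w - x) ∂μ := by
  have := hμ.isProbabilityMeasure
  have := hμ.nullSingletonClass
  obtain ⟨htot, hint⟩ := h.totalSurplus_eq hμ hr ha1 ha0 w
  rw [htot, ← integral_standardSurplus hμ]
  have hint' : Integrable (fun v : Fin N → ℝ => standardSurplus r w v) (Measure.pi fun _ => μ) :=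
    integrable_finsetSum _ fun i _ => integrable_standardSurplus_term hμ i
  have hpt : ∀ᵐ v ∂(Measure.pi fun _ : Fin N => μ),
      (σ.share r (rejectors c v) v 0 none * w + ∑ i, if i ∈ rejectors c v then
        σ.share r (rejectors c v) v 0 (some i) * (w - v i) else - v i) ≤ standardSurplus r w v ∧
      ((∃ k l, k ≠ l ∧ v k ≤ c ∧ v l ≤ c) →
        (σ.share r (rejectors c v) v 0 none * w + ∑ i, if i ∈ rejectors c v then
        σ.share r (rejectors c v) v 0 (some i) * (w - v i) else - v i) <
        standardSurplus r w v) := by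
    filter_upwards [pi_ae_of_forall_ae fun _ : Fin N => hμ.ae_mem,
      pi_ae_of_forall_ae fun _ : Fin N => Measure.ae_ne μ r, ae_pi_ne μ] with v hv hvr hne
    by_cases hR : rejectors c v = Finset.univ
    · have hall := rejectors_eq_univ_iff.1 hR
      refine ⟨?_, fun ⟨k, _, _, hk, _⟩ => absurd hk (not_le.2 (hall k))⟩
      rw [hR]
      simp only [Finset.mem_univ, if_true]
      have h0 : σ.share r Finset.univ v 0 none = 0 :=
        winShare_eq_zero_of_notMem fun hn => none_mem_bidders.1 hn rfl
      rw [h0, zero_mul, zero_add]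
      exact (sum_winShare_mul_sub hvr hne fun i => allBids_truthful h _ _ _ _).le
    · have hex : ∃ k, v k ≤ c := by
        by_contra! hall
        exact hR (rejectors_eq_univ_iff.2 hall)
      have h1 : σ.share r (rejectors c v) v 0 none = 1 := by
        refine winShare_eq_one (none_mem_bidders.2 hR) hr.1.le ?_
        rintro (_ | j) hj hne
        · exact absurd rfl hne
        · rw [allBids_truthful h]; exact (hv j).1
      have hs : ∀ i, σ.share r (rejectors c v) v 0 (some i) = 0 := fun i =>
        winShare_eq_zero_of_mem (none_mem_bidders.2 hR) (by
          rw [allBids_truthful h]; exact (hv i).1)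
      have hsum : (σ.share r (rejectors c v) v 0 none * w + ∑ i, if i ∈ rejectors c v then
          σ.share r (rejectors c v) v 0 (some i) * (w - v i) else - v i) =
          w - ∑ i, if c < v i then 0 else v i := by
        rw [h1, one_mul, sub_eq_add_neg, ← Finset.sum_neg_distrib]
        congr 1
        refine Finset.sum_congr rfl fun i _ => ?_
        simp only [hs, zero_mul, mem_rejectors]
        split_ifs <;> simp
      rw [hsum]
      exact sub_sum_le_standardSurplus hcr (fun i => (hv i).1) hvr hne hex
  refine integral_lt_integral_of_ae_le hint hint' (hpt.mono fun v hv => hv.1) fun hzero => ?_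
  -- All values are at most `c` with positive probability, and then at least two sellers accept.
  have hbox : 0 < (Measure.pi fun _ : Fin N => μ).real
      {v | ∀ j ∈ (Finset.univ : Finset (Fin N)), v j ∈ Set.Iic c} := by
    rw [pi_real_box μ _ fun _ => Set.Iic c]
    refine Finset.prod_pos fun _ _ => ?_
    rw [← cdf_eq_real]
    exact hμ.cdf_pos_of_pos hc
  obtain ⟨v, hvb, hv1, hv2⟩ := exists_mem_of_measureReal_pos hbox
    (hpt.and (measure_eq_zero_iff_ae_notMem.1 hzero))
  exact hv2 (hv1.2 ⟨⟨0, by omega⟩, ⟨1, by omega⟩, by simp, hvb _ (Finset.mem_univ _),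
    hvb _ (Finset.mem_univ _)⟩)

end Profile

theorem mainTheorem7 (N : ℕ) (hN : 2 ≤ N) (μ : Measure ℝ) (hμ : IsValueDistribution μ)
    (r : ℝ) (hr : r ∈ Set.Ioc (0 : ℝ) 1) (hF : ∀ v < r, cdf μ v < 1)
    (hprofit : ∀ v ∈ Set.Ioc 0 r, fpaProfit N μ r v < 0)
    (E₁ E₂ : SpeculationStrategy N)
    (hE₁ : IsFPAEquilibrium μ r E₁) (hE₂ : IsSPAEquilibrium μ r E₂) :
    (∀ w : ℝ, (E₂.after E₂.offer).auctioneerPayoff μ .second r w <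
      (E₁.after E₁.offer).auctioneerPayoff μ .first r w) ∧
    (∀ w : ℝ, (E₂.after E₂.offer).totalSurplus μ .second r E₂.offer w <
      (E₁.after E₁.offer).totalSurplus μ .first r E₁.offer w) ∧
    (∀ i : Fin N, (E₁.after E₁.offer).sellerPayoff μ .first r E₁.offer i <
      (E₂.after E₂.offer).sellerPayoff μ .second r E₂.offer i) := by
  have := hμ.isProbabilityMeasure
  have hacc := fun i => hE₁.accept_eq_zero hN hμ hr hF hprofit i
  have h₁ := hE₁.continuation _ hE₁.offer_mem
  have h₂ := hE₂.continuation _ hE₂.offer_mem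
  obtain ⟨hpos, c, hc, hcr, ha1, ha0, hp⟩ := hE₂.exists_cutoff hN hμ hr hF
  have hspec : (E₁.after E₁.offer).speculatorPayoff μ .first r E₁.offer = 0 :=
    Profile.speculatorPayoff_eq_zero (fun i => by
      filter_upwards [hμ.ae_mem] with x hx using hacc i x ⟨hx.1, hx.2.le⟩) _
  have hsurplus : ∀ w : ℝ, (E₂.after E₂.offer).totalSurplus μ .second r E₂.offer w <
      (E₁.after E₁.offer).totalSurplus μ .first r E₁.offer w := fun w => by
    rw [h₁.totalSurplus_of_accept_eq_zero hN hμ hr hF hacc w]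
    exact h₂.totalSurplus_lt hN hμ hr hc hcr ha1 ha0 w
  have hseller : ∀ i : Fin N, (E₁.after E₁.offer).sellerPayoff μ .first r E₁.offer i <
      (E₂.after E₂.offer).sellerPayoff μ .second r E₂.offer i := fun i => by
    rw [h₁.sellerPayoff_of_accept_eq_zero hN hμ hr hF hacc i]
    exact h₂.lt_sellerPayoff hN hμ hr hc hcr ha1 ha0 hp i
  refine ⟨fun w => ?_, hsurplus, hseller⟩
  -- The auctioneer's surplus is what remains of total surplus: the speculator earns 0 in the
  -- first-price game but a profit in the second-price game, and the sellers get less in the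
  -- first-price game.
  have hsum : ∑ i, (E₁.after E₁.offer).sellerPayoff μ .first r E₁.offer i ≤
      ∑ i, (E₂.after E₂.offer).sellerPayoff μ .second r E₂.offer i :=
    Finset.sum_le_sum fun i _ => (hseller i).le
  have h := hsurplus w
  unfold Profile.totalSurplus at h
  rw [hspec] at h
  linarith

end
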